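/- Let $\mathcal{M}^2$ be one of the Euclidean plane $\mathbb{R}^2$, the hyperbolic plane $\mathbb{H}^2$ (curvature $-1$) and the unit sphere $\mathbb{S}^2$, with its geodesic metric. For $r>0$, an $r$-ball convex body is a compact set $K\subset\mathcal{M}^2$ with non-empty interior that is contained in some closed ball of radius $r$ and equals the intersection of all closed balls of radius $r$ containing it. Its inradius $\varrho(K)$ is the largest $R>0$ such that $K$ contains a closed ball of radius $R$. The minimal width of $K$ is the minimum, over all supporting lines $H$ of $K$, of the width $w(K,H)$ of $K$ with respect to $H$; here $w(K,H)$ is the distance of $H$ to the other supporting line parallel to $H$ in $\mathbb{R}^2$, the distance of $H$ to a farthest supporting line of $K$ disjoint from $H$ in $\mathbb{H}^2$, and the least breadth (angle) of a lune containing $K$ of which $H$ is one of the two bounding great circles in $\mathbb{S}^2$. Let $0<w\le r$, and if $\mathcal{M}^2=\mathbb{S}^2$, assume also $r<\frac{\pi}{2}$. Let $T_{w,r}$ denote the regular $r$-disk triangle of minimal width $w$, that is, the set of minimal width $w$ bounded by three arcs of radius $r$ connecting the vertices of a suitable regular triangle (the intersection of three closed disks of radius $r$, each of which has two of the vertices on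 its boundary and the third one in its interior); such a set exists, and it is unique up to congruence. If $K\subset\mathcal{M}^2$ is an $r$-ball convex body of minimal width $w$, then $$\varrho(K)\ge\varrho(T_{w,r}),$$ with equality if and only if $K$ is congruent to $T_{w,r}$. -/

import Mathlib

/-- The three planes of constant curvature `0`, `-1`, `1`. -/
inductive Geometry : Type
  | euclidean
  | hyperbolic
  | spherical

/-- The Euclidean plane. -/
abbrev EuclideanPlane : Type := EuclideanSpace ℝ (Fin 2)

/-- The unit sphere of `ℝ³`; its distance is the geodesic (angular) one, see below. -/
structure UnitSphere : Type where
  /-- The unit vector. -/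
  vec : EuclideanSpace ℝ (Fin 3)
  norm_vec : ‖vec‖ = 1

theorem UnitSphere.eq_of_vec_eq {x y : UnitSphere} (h : x.vec = y.vec) : x = y := by
  cases x; cases y; cases h; rfl

theorem UnitSphere.eq_of_angle_eq_zero {x y : UnitSphere}
    (h : InnerProductGeometry.angle x.vec y.vec = 0) : x = y := by
  apply UnitSphere.eq_of_vec_eq
  obtain ⟨_, c, hc, hy⟩ := InnerProductGeometry.angle_eq_zero_iff.1 h
  have h1 : ‖y.vec‖ = ‖c‖ * ‖x.vec‖ := by rw [hy, norm_smul]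
  rw [x.norm_vec, y.norm_vec, Real.norm_eq_abs, abs_of_pos hc, mul_one] at h1
  rw [hy, ← h1, one_smul]

/-- The sphere with its geodesic metric: the distance of two points is the angle between them. -/
noncomputable instance : MetricSpace UnitSphere where
  dist x y := InnerProductGeometry.angle x.vec y.vec
  dist_self x := InnerProductGeometry.angle_self (by
    intro h
    have := x.norm_vec
    simp [h] at this)
  dist_comm x y := InnerProductGeometry.angle_comm x.vec y.vec
  dist_triangle x y z := InnerProductGeometry.angle_le_angle_add_angle x.vec y.vec z.vec
  eq_of_dist_eq_zero h := UnitSphere.eq_of_angle_eq_zero h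

/-- The plane of the given geometry: `ℝ²`, the hyperbolic plane (the upper half-plane with the
hyperbolic metric) or the unit sphere. -/
@[reducible]
def Plane : Geometry → Type
  | .euclidean => EuclideanPlane
  | .hyperbolic => UpperHalfPlane
  | .spherical => UnitSphere

/-- The geodesic metric of each plane. -/
@[reducible]
noncomputable instance instMetricSpacePlane : (G : Geometry) → MetricSpace (Plane G)
  | .euclidean => inferInstanceAs (MetricSpace EuclideanPlane)
  | .hyperbolic => inferInstanceAs (MetricSpace UpperHalfPlane)
  | .spherical => inferInstanceAs (MetricSpace UnitSphere)

/-- Data of an oriented line of `ℝ²`: the line `⟪normal, x⟫ = offset`. -/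
structure EuclideanLine : Type where
  /-- A normal vector. -/
  normal : EuclideanPlane
  /-- The offset. -/
  offset : ℝ
  normal_ne_zero : normal ≠ 0

/-- Data of an oriented line of the upper half-plane: the points with
`a |z|² + b Re z + c = 0`, where `b² - 4 a c > 0`.  These are exactly the vertical half-lines
(`a = 0`) and the half-circles that are centred on the real axis (`a ≠ 0`). -/
structure HyperbolicLine : Type where
  /-- The coefficient of `|z|²`. -/
  a : ℝ
  /-- The coefficient of `Re z`. -/
  b : ℝ
  /-- The constant coefficient. -/
  c : ℝ
  discr_pos : 0 < b ^ 2 - 4 * a * c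

/-- Oriented lines (complete geodesics).  An oriented great circle of the sphere is given by
the pole (centre) of the closed hemisphere on its positive side. -/
@[reducible]
def OrientedLine : Geometry → Type
  | .euclidean => EuclideanLine
  | .hyperbolic => HyperbolicLine
  | .spherical => UnitSphere

/-- The defining function of an oriented line: it vanishes on the line, and it is positive on
one of the two open sides and negative on the other. -/
noncomputable def lineFun : (G : Geometry) → OrientedLine G → Plane G → ℝ
  | .euclidean, l, x => inner ℝ l.normal x - l.offset
  | .hyperbolic, l, z => l.a * Complex.normSq (z : ℂ) + l.b * z.re + l.c
  | .spherical, n, x => inner ℝ n.vec x.vec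

/-- The set of points of a line. -/
def linePoints {G : Geometry} (l : OrientedLine G) : Set (Plane G) :=
  {x | lineFun G l x = 0}

/-- The closed half-plane (closed hemisphere) on the positive side of an oriented line. -/
def halfPlane {G : Geometry} (l : OrientedLine G) : Set (Plane G) :=
  {x | 0 ≤ lineFun G l x}

/-- `l` is a supporting line of `K`, oriented so that `K` is on its positive side. -/
def Supports {G : Geometry} (l : OrientedLine G) (K : Set (Plane G)) : Prop :=
  K ⊆ halfPlane l ∧ (K ∩ linePoints l).Nonempty

/-- The distance of two sets, `inf {d(x, y) : x ∈ A, y ∈ B}`. -/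
noncomputable def setDist {X : Type*} [MetricSpace X] (A B : Set X) : ℝ :=
  sInf (Set.image2 dist A B)

/-- The width of `K` with respect to a supporting line, if there are parallels: the distance of
the line to a farthest supporting line of `K` that does not meet it.  In `ℝ²` there is only one
such line. -/
noncomputable def parallelWidth {G : Geometry} (l : OrientedLine G) (K : Set (Plane G)) : ℝ :=
  sSup {d : ℝ | ∃ m : OrientedLine G, Supports m K ∧ Disjoint (linePoints l) (linePoints m) ∧
    d = setDist (linePoints l) (linePoints m)}

/-- The width of `K ⊆ S²` with respect to a supporting great circle: the least breadth of a lune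
that contains `K` and of which the great circle is one of the two sides.  A lune is the
intersection of two closed hemispheres whose centres `n`, `m` are neither equal nor antipodal.
Its breadth, the angle of the lune at its corners, is `π` minus the angle between `n` and `m`. -/
noncomputable def luneWidth (n : UnitSphere) (K : Set UnitSphere) : ℝ :=
  sInf {β : ℝ | ∃ m : UnitSphere, m ≠ n ∧ m.vec ≠ -n.vec ∧
    K ⊆ halfPlane (G := .spherical) n ∩ halfPlane (G := .spherical) m ∧
    β = Real.pi - InnerProductGeometry.angle n.vec m.vec}

/-- The width `w(K, l)` of `K` with respect to a supporting line `l`. -/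
noncomputable def widthAlong : (G : Geometry) → OrientedLine G → Set (Plane G) → ℝ
  | .euclidean, l, K => parallelWidth (G := .euclidean) l K
  | .hyperbolic, l, K => parallelWidth (G := .hyperbolic) l K
  | .spherical, n, K => luneWidth n K

/-- The minimal width (thickness) `w(K)`, the least width of `K` over its supporting lines. -/
noncomputable def minimalWidth {G : Geometry} (K : Set (Plane G)) : ℝ :=
  sInf {d : ℝ | ∃ l : OrientedLine G, Supports l K ∧ d = widthAlong G l K}

/-- `K` is an `r`-ball convex body: it is compact, has interior points, is contained in a closed
ball of radius `r`, and is the intersection of all closed balls of radius `r` that contain it. -/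
structure IsBallConvexBody {X : Type*} [MetricSpace X] (r : ℝ) (K : Set X) : Prop where
  isCompact : IsCompact K
  exists_ball : ∃ c : X, K ⊆ Metric.closedBall c r
  eq_iInter : K = ⋂ (c : X) (_ : K ⊆ Metric.closedBall c r), Metric.closedBall c r
  nonempty_interior : (interior K).Nonempty

/-- The inradius: the largest `R > 0` such that `K` contains a closed ball of radius `R`. -/
noncomputable def inradius {X : Type*} [MetricSpace X] (K : Set X) : ℝ :=
  sSup {R : ℝ | 0 < R ∧ ∃ x ∈ K, Metric.closedBall x R ⊆ K}

/-- Two sets are congruent if an isometry of the whole space takes one to the other. -/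
def CongruentSets {X : Type*} [MetricSpace X] (A B : Set X) : Prop :=
  ∃ φ : X ≃ᵢ X, φ '' A = B

/-- `T` is a regular `r`-disk triangle: the set that is bounded by the three arcs of radius `r`
which join the vertices `v 0, v 1, v 2` of a regular triangle.  The arc opposite to `v i` lies on
the circle of radius `r` with centre `c i` that passes through the other two vertices and has
`v i` in its interior, and `T` is the intersection of the three closed disks. -/
def IsRegularDiskTriangle {X : Type*} [MetricSpace X] (r : ℝ) (T : Set X) : Prop :=
  ∃ v c : Fin 3 → X,
    (∃ a : ℝ, 0 < a ∧ ∀ i j, i ≠ j → dist (v i) (v j) = a) ∧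
    (∀ i j, i ≠ j → dist (c i) (v j) = r) ∧
    (∀ i, dist (c i) (v i) < r) ∧
    T = ⋂ i, Metric.closedBall (c i) r

/-! The argument is a duality between an `r`-ball body `K` and the set `C` of the centres of all
disks of radius `r` containing it. A disk of radius `ρ` about `x` lies in `K` exactly when `C` lies
in the disk of radius `r - ρ` about `x`, so `inradius K = r - a'`, where `a'` is the circumradius of
`C` (`inradius_eq_of_minimal_enclosing_ball`). Let `o` be the circumcentre. Optimality of `o` and
Carathéodory's theorem give three centres at distance `a'` from `o`, in unit directions `u i`, and
weights `w i ≥ 0` of sum `1` with `∑ i, w i • u i = 0`.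

A regular disk triangle has its arc centres at some distance `a` and its vertices at some distance
`R` from its own centre, in three directions at angles of 120 degrees; `a` and `R` are linked by the
law of cosines. Its inradius is `r - a`. Its minimal width is `r - a + R` if `R ≤ a`, and exceeds
`r` if `a < R`.

Suppose that `K` has the width of the triangle and `inradius K ≤ r - a`, that is, `a ≤ a'`. Then `K`
also lies in the three disks whose centres are pulled in to distance `a` (`md_bound_of_le`). Let `w
i` be a largest weight, so `w i ≥ 1 / 3`. The intersection of these three disks is covered by the
disk of radius `r` about the point `q` at distance `r - R` from `o` opposite to `u i`
(`dist_lt_or_eq_of_mem_disks`). So `K` lies in a lens whose tangent lines at its two ends have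
distances `r - a'` and `R` from `o`, and it touches the first of them at a point of the inscribed
disk. Hence `minimalWidth K ≤ r - a' + R`, with strict inequality if `K` avoids the circle about `q`
(`minimalWidth_le_of_lens`, `minimalWidth_lt_of_lens`).

Comparison with the width `r - a + R` forces `a' = a` and a point of `K` on the circle about `q`.
That happens only for `w i = 1 / 3` and at the vertex in direction `u i`. Then all weights are
equal, the directions are those of a disk triangle, and `K` contains its vertices. A disk of radius
`r` that contains the vertices contains the whole triangle (`IsDiskTriangle.subset_closedBall`), so
`K` is the triangle.

The three geometries are treated at once by the coordinates of `PolarFrame`. For fixed `y`, both `md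
(dist x y)` and the equation of a line are affine in `(M x, ξ x)`, so the trigonometry becomes
polynomial algebra with the curvature as a parameter. -/

namespace Geometry

/-- The curvature. -/
noncomputable def curv : Geometry → ℝ
  | .euclidean => 0
  | .hyperbolic => -1
  | .spherical => 1

/-- The generalised sine. -/
noncomputable def sn : Geometry → ℝ → ℝ
  | .euclidean, t => t
  | .hyperbolic, t => Real.sinh t
  | .spherical, t => Real.sin t

/-- The generalised cosine. -/
noncomputable def cs : Geometry → ℝ → ℝ
  | .euclidean, _ => 1
  | .hyperbolic, t => Real.cosh t
  | .spherical, t => Real.cos t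

/-- The primitive of the generalised sine that vanishes at `0`. -/
noncomputable def md : Geometry → ℝ → ℝ
  | .euclidean, t => t ^ 2 / 2
  | .hyperbolic, t => Real.cosh t - 1
  | .spherical, t => 1 - Real.cos t

/-- In the spherical case, `t` is less than a right angle. -/
def Small (G : Geometry) (t : ℝ) : Prop := G = .spherical → t < Real.pi / 2

/-! ### Identities and monotonicity of the generalised trigonometric functions. -/

variable {G : Geometry} {s t : ℝ}

theorem Small.mono (h : G.Small t) (hst : s ≤ t) : G.Small s := fun e => hst.trans_lt (h e)

theorem small_neg (h : 0 ≤ t) : G.Small (-t) := fun _ => by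
  have := Real.pi_pos
  linarith

theorem cs_eq (G : Geometry) (t : ℝ) : G.cs t = 1 - G.curv * G.md t := by
  cases G <;> simp [cs, curv, md]

theorem sn_sq (G : Geometry) (t : ℝ) : G.sn t ^ 2 = 2 * G.md t - G.curv * G.md t ^ 2 := by
  cases G
  · simp [sn, curv, md]; ring
  · simp only [sn, curv, md]
    have := Real.cosh_sq t
    linarith
  · simp only [sn, curv, md]
    have := Real.sin_sq_add_cos_sq t
    linarith

theorem sn_sq_add_cs_sq (G : Geometry) (t : ℝ) : G.cs t ^ 2 + G.curv * G.sn t ^ 2 = 1 := by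
  rw [sn_sq, cs_eq]; ring

theorem sn_sq_eq_mul (G : Geometry) (t : ℝ) : G.sn t ^ 2 = G.md t * (1 + G.cs t) := by
  rw [sn_sq, cs_eq]; ring

theorem sn_add (G : Geometry) (s t : ℝ) : G.sn (s + t) = G.sn s * G.cs t + G.cs s * G.sn t := by
  cases G
  · simp [sn, cs]
  · simp [sn, cs, Real.sinh_add]
  · simp [sn, cs, Real.sin_add]

theorem sn_neg (G : Geometry) (t : ℝ) : G.sn (-t) = -G.sn t := by
  cases G <;> simp [sn]

theorem cs_neg (G : Geometry) (t : ℝ) : G.cs (-t) = G.cs t := by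
  cases G <;> simp [cs]

theorem md_neg (G : Geometry) (t : ℝ) : G.md (-t) = G.md t := by
  cases G <;> simp [md]

theorem sn_sub (G : Geometry) (s t : ℝ) : G.sn (s - t) = G.sn s * G.cs t - G.cs s * G.sn t := by
  rw [sub_eq_add_neg, sn_add, sn_neg, cs_neg]; ring

theorem md_add (G : Geometry) (s t : ℝ) :
    G.md (s + t) = G.md s + G.md t - G.curv * G.md s * G.md t + G.sn s * G.sn t := by
  cases G
  · simp [sn, md, curv]; ring
  · simp [sn, md, curv, Real.cosh_add]; ring
  · simp [sn, md, curv, Real.cos_add]; ring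

theorem md_sub (G : Geometry) (s t : ℝ) :
    G.md (s - t) = G.md s + G.md t - G.curv * G.md s * G.md t - G.sn s * G.sn t := by
  rw [sub_eq_add_neg, md_add, sn_neg, md_neg]; ring

@[simp] theorem sn_zero (G : Geometry) : G.sn 0 = 0 := by cases G <;> simp [sn]
@[simp] theorem cs_zero (G : Geometry) : G.cs 0 = 1 := by cases G <;> simp [cs]
@[simp] theorem md_zero (G : Geometry) : G.md 0 = 0 := by cases G <;> simp [md]

theorem continuous_sn (G : Geometry) : Continuous G.sn := by
  cases G
  · exact continuous_id
  · exact Real.continuous_sinh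
  · exact Real.continuous_sin

theorem continuous_cs (G : Geometry) : Continuous G.cs := by
  cases G
  · exact continuous_const
  · exact Real.continuous_cosh
  · exact Real.continuous_cos

theorem continuous_md (G : Geometry) : Continuous G.md := by
  cases G
  · exact (continuous_id.pow 2).div_const 2
  · exact Real.continuous_cosh.sub continuous_const
  · exact continuous_const.sub Real.continuous_cos

theorem sn_lt_sn (hs : G.Small (-s)) (hst : s < t) (ht : G.Small t) : G.sn s < G.sn t := by
  cases G
  · exact hst
  · exact Real.sinh_lt_sinh.2 hst
  · have h1 := hs rfl
    have h2 := ht rfl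
    exact Real.sin_lt_sin_of_lt_of_le_pi_div_two (by linarith) h2.le hst

theorem sn_le_sn (hs : G.Small (-s)) (hst : s ≤ t) (ht : G.Small t) : G.sn s ≤ G.sn t := by
  rcases hst.eq_or_lt with rfl | h
  · exact le_rfl
  · exact (sn_lt_sn hs h ht).le

theorem sn_pos (h : 0 < t) (ht : G.Small t) : 0 < G.sn t := by
  have := sn_lt_sn (G := G) (s := 0) (by simpa using small_neg le_rfl) h ht
  simpa using this

theorem sn_nonneg (h : 0 ≤ t) (ht : G.Small t) : 0 ≤ G.sn t := by
  rcases h.eq_or_lt with rfl | h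
  · simp
  · exact (sn_pos h ht).le

theorem cs_pos (h : G.Small (-t)) (ht : G.Small t) : 0 < G.cs t := by
  cases G
  · exact one_pos
  · exact Real.cosh_pos t
  · have h1 := h rfl
    have h2 := ht rfl
    exact Real.cos_pos_of_mem_Ioo ⟨by linarith, h2⟩

theorem cs_pos_of_nonneg (h : 0 ≤ t) (ht : G.Small t) : 0 < G.cs t := cs_pos (small_neg h) ht

theorem md_nonneg (G : Geometry) (t : ℝ) : 0 ≤ G.md t := by
  cases G
  · simp only [md]; positivity
  · simp only [md]; linarith [Real.one_le_cosh t]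
  · simp only [md]; linarith [Real.cos_le_one t]

theorem md_lt_md (hs : 0 ≤ s) (hst : s < t) (ht : G = .spherical → t ≤ Real.pi) :
    G.md s < G.md t := by
  cases G
  · simp only [md]; nlinarith
  · simp only [md]
    have := Real.cosh_lt_cosh.2 (by rwa [abs_of_nonneg hs, abs_of_nonneg (hs.trans hst.le)] :
      |s| < |t|)
    linarith
  · simp only [md]
    have := Real.cos_lt_cos_of_nonneg_of_le_pi hs (ht rfl) hst
    linarith

theorem md_pos (h : 0 < t) (ht : G.Small t) : 0 < G.md t := by
  have := md_lt_md (G := G) le_rfl h (fun e => by have := ht e; linarith [Real.pi_pos])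
  simpa using this

theorem md_le_md (hs : 0 ≤ s) (hst : s ≤ t) (ht : G = .spherical → t ≤ Real.pi) :
    G.md s ≤ G.md t := by
  rcases hst.eq_or_lt with rfl | h
  · exact le_rfl
  · exact (md_lt_md hs h ht).le

theorem Small.le_pi (h : G.Small t) : G = .spherical → t ≤ Real.pi := fun e => by
  have := h e
  linarith [Real.pi_pos]

theorem cs_anti_of_curv_nonneg (hG : G = .spherical) (hs : 0 ≤ s) (ht : 0 < G.cs s)
    (h : s ≤ Real.pi) : s < Real.pi / 2 := by
  subst hG
  by_contra hc
  push Not at hc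
  have := Real.cos_nonpos_of_pi_div_two_le_of_le hc (by linarith [Real.pi_pos])
  simp only [cs] at ht
  linarith

theorem one_le_cs (hG : G ≠ .spherical) (t : ℝ) : 1 ≤ G.cs t := by
  cases G
  · exact le_rfl
  · exact Real.one_le_cosh t
  · exact absurd rfl hG

theorem exists_sn_eq (hG : G ≠ .spherical) (y : ℝ) : ∃ t, G.sn t = y := by
  cases G
  · exact ⟨y, rfl⟩
  · exact ⟨Real.arsinh y, Real.sinh_arsinh y⟩
  · exact absurd rfl hG

end Geometry

/-! ### Normalised equations of lines, and polar coordinates. -/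

open Geometry

/-- The normalised defining function of an oriented line: the generalised sine of the signed
distance to the line. -/
noncomputable def nline : (G : Geometry) → OrientedLine G → Plane G → ℝ
  | .euclidean, l, x => (inner ℝ l.normal x - l.offset) / ‖l.normal‖
  | .hyperbolic, l, z => (l.a * Complex.normSq (z : ℂ) + l.b * z.re + l.c) /
      (z.im * √(l.b ^ 2 - 4 * l.a * l.c))
  | .spherical, n, x => inner ℝ n.vec x.vec

theorem exists_pos_nline_eq (G : Geometry) (l : OrientedLine G) (x : Plane G) :
    ∃ k : ℝ, 0 < k ∧ nline G l x = lineFun G l x / k := by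
  cases G
  · exact ⟨‖EuclideanLine.normal l‖, norm_pos_iff.2 (EuclideanLine.normal_ne_zero l), rfl⟩
  · exact ⟨_, mul_pos (UpperHalfPlane.im_pos x) (Real.sqrt_pos.2 (HyperbolicLine.discr_pos l)), rfl⟩
  · exact ⟨1, one_pos, by simp [nline, lineFun]⟩

theorem mem_halfPlane_iff {G : Geometry} {l : OrientedLine G} {x : Plane G} :
    x ∈ halfPlane l ↔ 0 ≤ nline G l x := by
  obtain ⟨k, hk, h⟩ := exists_pos_nline_eq G l x
  rw [h, le_div_iff₀ hk, zero_mul]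
  rfl

theorem mem_linePoints_iff {G : Geometry} {l : OrientedLine G} {x : Plane G} :
    x ∈ linePoints l ↔ nline G l x = 0 := by
  obtain ⟨k, hk, h⟩ := exists_pos_nline_eq G l x
  rw [h, div_eq_zero_iff, or_iff_left hk.ne']
  rfl

/-- Geodesic polar coordinates: `x` at distance `s` from the base point in the direction `u` has
`M x = md s` and `ξ x = sn s • u`. -/
structure PolarFrame (G : Geometry) where
  /-- The radial coordinate. -/
  M : Plane G → ℝ
  /-- The vectorial coordinate. -/
  ξ : Plane G → EuclideanPlane
  norm_sq : ∀ x, ‖ξ x‖ ^ 2 = 2 * M x - G.curv * M x ^ 2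
  md_dist : ∀ x y, G.md (dist x y) = M x + M y - G.curv * M x * M y - inner ℝ (ξ x) (ξ y)
  exists_point : ∀ (m : ℝ) (v : EuclideanPlane), 0 ≤ m → ‖v‖ ^ 2 = 2 * m - G.curv * m ^ 2 →
    ∃ x, M x = m ∧ ξ x = v
  nline_eq : ∀ l : OrientedLine G, ∃ (A : ℝ) (B : EuclideanPlane),
    ‖B‖ ^ 2 + G.curv * A ^ 2 = 1 ∧ ∀ x, nline G l x = A * (1 - G.curv * M x) + inner ℝ B (ξ x)
  exists_line : ∀ (A : ℝ) (B : EuclideanPlane), ‖B‖ ^ 2 + G.curv * A ^ 2 = 1 →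
    ∃ l : OrientedLine G, ∀ x, nline G l x = A * (1 - G.curv * M x) + inner ℝ B (ξ x)

theorem norm_sq_eq_coords (v : EuclideanPlane) : ‖v‖ ^ 2 = v 0 ^ 2 + v 1 ^ 2 := by
  rw [EuclideanSpace.real_norm_sq_eq, Fin.sum_univ_two]

theorem inner_eq_coords (v w : EuclideanPlane) : inner ℝ v w = v 0 * w 0 + v 1 * w 1 := by
  simp [PiLp.inner_apply, Fin.sum_univ_two, mul_comm]

theorem exists_polarFrame_euclidean (o : Plane .euclidean) :
    ∃ F : PolarFrame .euclidean, F.M o = 0 := by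
  refine ⟨⟨fun x => ‖x - o‖ ^ 2 / 2, fun x => x - o, ?_, ?_, ?_, ?_, ?_⟩, ?_⟩
  · intro x
    simp only [curv]; ring
  · intro x y
    have h : x - y = (x - o) - (y - o) := by abel
    simp only [md, curv]
    rw [dist_eq_norm, h, norm_sub_sq_real]; ring
  · intro m v _ h
    refine ⟨v + o, ?_, by simp⟩
    simp only [curv] at h
    simp only [add_sub_cancel_right]; linarith
  · intro l
    have hn : ‖l.normal‖ ≠ 0 := norm_ne_zero_iff.2 l.normal_ne_zero
    refine ⟨(inner ℝ l.normal o - l.offset) / ‖l.normal‖, ‖l.normal‖⁻¹ • l.normal, ?_, ?_⟩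
    · rw [norm_smul, norm_inv, norm_norm, inv_mul_cancel₀ hn]; simp [curv]
    · intro x
      simp only [nline, curv, inner_smul_left, inner_sub_right]
      simp
      field_simp
      ring
  · intro A B h
    have hB : ‖B‖ = 1 := by
      simp only [curv, zero_mul, add_zero] at h
      nlinarith [norm_nonneg B]
    refine ⟨⟨B, inner ℝ B o - A, fun h0 => by simp [h0] at hB⟩, fun x => ?_⟩
    simp only [nline, hB, curv, inner_sub_right]
    ring
  · simp

theorem exists_polarFrame_hyperbolic (o : Plane .hyperbolic) :
    ∃ F : PolarFrame .hyperbolic, F.M o = 0 := by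
  have hoy : 0 < o.im := o.im_pos
  set p := o.re with hp
  set q := o.im with hq
  refine ⟨⟨fun z => ((z.re - p) ^ 2 + z.im ^ 2 + q ^ 2) / (2 * z.im * q) - 1,
    fun z => !₂[((z.re - p) ^ 2 + z.im ^ 2 - q ^ 2) / (2 * z.im * q), (z.re - p) / z.im],
    ?_, ?_, ?_, ?_, ?_⟩, ?_⟩
  · intro z
    have hz : z.im ≠ 0 := z.im_pos.ne'
    simp only [norm_sq_eq_coords, curv]
    simp
    field_simp
    ring
  · intro z w
    have hz : z.im ≠ 0 := z.im_pos.ne'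
    have hw : w.im ≠ 0 := w.im_pos.ne'
    simp only [md, curv]
    rw [UpperHalfPlane.cosh_dist, inner_eq_coords]
    have : dist (z : ℂ) w ^ 2 = (z.re - w.re) ^ 2 + (z.im - w.im) ^ 2 := by
      rw [Complex.dist_eq, Complex.sq_norm, Complex.normSq_apply]
      simp
      ring
    rw [this]
    simp
    field_simp
    ring
  · intro m v hm hv
    rw [norm_sq_eq_coords] at hv
    simp only [curv] at hv
    have hlt : v 0 < 1 + m := by
      by_contra hc
      push Not at hc
      nlinarith [sq_nonneg (v 1)]
    have hd : 0 < 1 + m - v 0 := by linarith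
    -- In these coordinates `1 + M z - ξ z 0 = q / z.im`, which determines the height of the point
    -- sought.
    have hy : 0 < q / (1 + m - v 0) := div_pos hoy hd
    refine ⟨⟨⟨p + v 1 * (q / (1 + m - v 0)), q / (1 + m - v 0)⟩, hy⟩, ?_, ?_⟩
    · simp [UpperHalfPlane.re, UpperHalfPlane.im]
      field_simp
      linear_combination hv
    · ext i
      fin_cases i
      · simp [UpperHalfPlane.re, UpperHalfPlane.im]
        field_simp
        linear_combination hv
      · simp [UpperHalfPlane.re, UpperHalfPlane.im]
        field_simp
  · intro l
    have hD := l.discr_pos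
    set S := √(l.b ^ 2 - 4 * l.a * l.c) with hS
    have hS0 : 0 < S := Real.sqrt_pos.2 hD
    have hS2 : S ^ 2 = l.b ^ 2 - 4 * l.a * l.c := Real.sq_sqrt hD.le
    refine ⟨(l.a * q + (l.a * p ^ 2 + l.b * p + l.c) / q) / S,
      !₂[(l.a * q - (l.a * p ^ 2 + l.b * p + l.c) / q) / S, (2 * l.a * p + l.b) / S], ?_, ?_⟩
    · rw [norm_sq_eq_coords]
      simp [curv]
      field_simp
      rw [hS2]
      ring
    · intro z
      have hz : z.im ≠ 0 := z.im_pos.ne'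
      simp only [nline, curv, inner_eq_coords, Complex.normSq_apply]
      rw [← hS]
      simp
      field_simp
      ring
  · intro A B h
    rw [norm_sq_eq_coords] at h
    simp only [curv] at h
    -- The formulas of the preceding clause solved for the coefficients, normalised to discriminant
    -- `1`.
    set a := (A + B 0) / (2 * q) with ha
    set b := B 1 - 2 * a * p with hb
    set c := (A - B 0) / 2 * q - a * p ^ 2 - b * p with hc
    have hdisc : b ^ 2 - 4 * a * c = 1 := by
      rw [hc, hb, ha]
      field_simp
      linear_combination 4 * q ^ 2 * h
    refine ⟨⟨a, b, c, by rw [hdisc]; exact one_pos⟩, fun z => ?_⟩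
    have hz : z.im ≠ 0 := z.im_pos.ne'
    simp only [nline, curv, inner_eq_coords, Complex.normSq_apply]
    rw [hdisc, hc, hb, ha]
    simp
    field_simp
    ring
  · simp only [← hp, ← hq]
    field_simp
    ring

theorem exists_polarFrame_spherical (o : Plane .spherical) :
    ∃ F : PolarFrame .spherical, F.M o = 0 := by
  obtain ⟨b, hb⟩ := Orthonormal.exists_orthonormalBasis_extension_of_card_eq (𝕜 := ℝ)
    (E := EuclideanSpace ℝ (Fin 3)) (ι := Fin 3) (by simp) (v := fun _ => o.vec) (s := {0})
    (by
      constructor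
      · intro i; simpa using o.norm_vec
      · intro i j hij
        exact absurd (Subsingleton.elim i j) hij)
  have hb0 : b 0 = o.vec := hb 0 rfl
  have hexp : ∀ x y : EuclideanSpace ℝ (Fin 3), inner ℝ x y = inner ℝ o.vec x * inner ℝ o.vec y +
      inner ℝ (b 1) x * inner ℝ (b 1) y + inner ℝ (b 2) x * inner ℝ (b 2) y := by
    intro x y
    rw [← b.sum_inner_mul_inner x y, Fin.sum_univ_three, hb0]
    simp only [real_inner_comm]
  have hnorm : ∀ x : UnitSphere, inner ℝ x.vec x.vec = 1 := fun x => by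
    rw [real_inner_self_eq_norm_sq, x.norm_vec]; norm_num
  have hmk : ∀ a c d : ℝ, a ^ 2 + c ^ 2 + d ^ 2 = 1 → ∃ x : UnitSphere,
      inner ℝ o.vec x.vec = a ∧ inner ℝ (b 1) x.vec = c ∧ inner ℝ (b 2) x.vec = d := by
    intro a c d h
    have hon := b.orthonormal
    have e : ∀ i, inner ℝ (b i) (a • b 0 + c • b 1 + d • b 2) = (![a, c, d] : Fin 3 → ℝ) i := by
      intro i
      simp only [inner_add_right, inner_smul_right, orthonormal_iff_ite.1 hon]
      fin_cases i <;> simp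
    have e0 := e 0
    have e1 := e 1
    have e2 := e 2
    rw [hb0] at e0 e1 e2
    simp at e0 e1 e2
    refine ⟨⟨a • o.vec + c • b 1 + d • b 2, ?_⟩, e0, e1, e2⟩
    have : ‖a • o.vec + c • b 1 + d • b 2‖ ^ 2 = 1 := by
      rw [← real_inner_self_eq_norm_sq, hexp, e0, e1, e2]
      linarith
    nlinarith [norm_nonneg (a • o.vec + c • b 1 + d • b 2)]
  refine ⟨⟨fun x => 1 - inner ℝ o.vec x.vec, fun x => !₂[inner ℝ (b 1) x.vec, inner ℝ (b 2) x.vec],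
    ?_, ?_, ?_, ?_, ?_⟩, ?_⟩
  · intro x
    have h := hexp x.vec x.vec
    rw [hnorm] at h
    rw [norm_sq_eq_coords]
    simp [curv]
    linarith
  · intro x y
    simp only [md, curv]
    rw [inner_eq_coords]
    change 1 - Real.cos (InnerProductGeometry.angle x.vec y.vec) = _
    rw [InnerProductGeometry.cos_angle, x.norm_vec, y.norm_vec, hexp]
    simp
    ring
  · intro m v _ hv
    rw [norm_sq_eq_coords] at hv
    simp only [curv] at hv
    obtain ⟨x, h0, h1, h2⟩ := hmk (1 - m) (v 0) (v 1) (by linarith)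
    refine ⟨x, by rw [h0]; ring, ?_⟩
    ext i
    fin_cases i
    · simpa using h1
    · simpa using h2
  · intro n
    refine ⟨inner ℝ o.vec n.vec, !₂[inner ℝ (b 1) n.vec, inner ℝ (b 2) n.vec], ?_, ?_⟩
    · have h := hexp n.vec n.vec
      rw [hnorm] at h
      rw [norm_sq_eq_coords]
      simp [curv]
      linarith
    · intro x
      simp only [nline, curv, inner_eq_coords]
      rw [hexp]
      simp
      ring
  · intro A B h
    rw [norm_sq_eq_coords] at h
    simp only [curv] at h
    obtain ⟨x, h0, h1, h2⟩ := hmk A (B 0) (B 1) (by linarith)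
    refine ⟨x, fun y => ?_⟩
    simp only [nline, curv, inner_eq_coords]
    rw [hexp, h0, h1, h2]
    simp
    ring
  · change 1 - inner ℝ o.vec o.vec = 0
    rw [hnorm]; norm_num

theorem exists_polarFrame {G : Geometry} (o : Plane G) : ∃ F : PolarFrame G, F.M o = 0 := by
  cases G
  · exact exists_polarFrame_euclidean o
  · exact exists_polarFrame_hyperbolic o
  · exact exists_polarFrame_spherical o

theorem dist_le_pi {G : Geometry} (hG : G = .spherical) (x y : Plane G) :
    dist x y ≤ Real.pi := by
  subst hG
  exact InnerProductGeometry.angle_le_pi _ _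

theorem md_dist_le_iff {G : Geometry} {x y : Plane G} {t : ℝ} (h0 : 0 ≤ t)
    (ht : G = .spherical → t ≤ Real.pi) : G.md (dist x y) ≤ G.md t ↔ dist x y ≤ t := by
  constructor
  · intro h
    by_contra hc
    push Not at hc
    exact absurd (md_lt_md h0 hc fun e => dist_le_pi e x y) (not_lt.2 h)
  · intro h
    exact md_le_md dist_nonneg h ht

theorem md_dist_lt_iff {G : Geometry} {x y : Plane G} {t : ℝ} (h0 : 0 ≤ t)
    (ht : G = .spherical → t ≤ Real.pi) : G.md (dist x y) < G.md t ↔ dist x y < t := by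
  constructor
  · intro h
    by_contra hc
    push Not at hc
    exact absurd (md_le_md h0 hc fun e => dist_le_pi e x y) (not_le.2 h)
  · intro h
    exact md_lt_md dist_nonneg h ht

theorem md_dist_eq_iff {G : Geometry} {x y : Plane G} {t : ℝ} (h0 : 0 ≤ t)
    (ht : G = .spherical → t ≤ Real.pi) : G.md (dist x y) = G.md t ↔ dist x y = t := by
  constructor
  · intro h
    apply le_antisymm ((md_dist_le_iff h0 ht).1 h.le)
    by_contra hc
    push Not at hc
    exact absurd ((md_dist_lt_iff h0 ht).2 hc) (not_lt.2 h.ge)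
  · rintro rfl; rfl

theorem sn_dist_nonneg {G : Geometry} (x y : Plane G) : 0 ≤ G.sn (dist x y) := by
  by_cases hG : G = .spherical
  · have h := dist_le_pi hG x y
    have h0 : 0 ≤ dist x y := dist_nonneg
    generalize dist x y = d at h h0
    subst hG
    exact Real.sin_nonneg_of_nonneg_of_le_pi h0 h
  · exact sn_nonneg dist_nonneg fun e => absurd e hG

namespace PolarFrame

variable {G : Geometry} (F : PolarFrame G) {o x y : Plane G}

theorem M_nonneg (x : Plane G) : 0 ≤ F.M x := by
  have h := F.norm_sq x
  by_contra hc
  push Not at hc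
  have h2 := sq_nonneg ‖F.ξ x‖
  by_cases hk : 0 ≤ G.curv
  · nlinarith [mul_nonneg hk (sq_nonneg (F.M x))]
  · cases G
    · simp [curv] at hk
    -- For curvature `-1` the norm identity leaves the lower sheet `M ≤ -2` possible. Comparison
    -- with a point where `M` and `ξ` vanish excludes it, because there `M x` is the value of `md`
    -- at a distance.
    · obtain ⟨o⟩ : Nonempty (Plane .hyperbolic) := ⟨x⟩
      obtain ⟨y, hy, hv⟩ := F.exists_point 0 0 le_rfl (by simp)
      have := F.md_dist x y
      rw [hy, hv] at this
      simp at this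
      have h3 := md_nonneg .hyperbolic (dist x y)
      linarith
    · simp [curv] at hk

theorem ξ_base (ho : F.M o = 0) : F.ξ o = 0 := by
  have h := F.norm_sq o
  rw [ho] at h
  simpa using h

theorem M_eq (ho : F.M o = 0) (x : Plane G) : F.M x = G.md (dist x o) := by
  rw [F.md_dist, ho, F.ξ_base ho]; simp

theorem norm_ξ (ho : F.M o = 0) (x : Plane G) : ‖F.ξ x‖ = G.sn (dist x o) := by
  have h := F.norm_sq x
  rw [F.M_eq ho, ← sn_sq] at h
  exact (pow_left_inj₀ (norm_nonneg _) (sn_dist_nonneg x o) two_ne_zero).1 h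

theorem ext_point (h : F.M x = F.M y) (h' : F.ξ x = F.ξ y) : x = y := by
  have h1 := F.md_dist x y
  rw [h, h', real_inner_self_eq_norm_sq, F.norm_sq] at h1
  have h2 : G.md (dist x y) = G.md 0 := by rw [h1, md_zero]; ring
  exact dist_eq_zero.1 ((md_dist_eq_iff le_rfl fun _ => Real.pi_pos.le).1 h2)

theorem exists_polar (ho : F.M o = 0) {s : ℝ} (h0 : 0 ≤ s) (hs : G = .spherical → s ≤ Real.pi)
    {u : EuclideanPlane} (hu : ‖u‖ = 1) :
    ∃ x, F.M x = G.md s ∧ F.ξ x = G.sn s • u ∧ dist x o = s := by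
  obtain ⟨x, h1, h2⟩ := F.exists_point (G.md s) (G.sn s • u) (md_nonneg G s) (by
    rw [norm_smul, mul_pow, hu, one_pow, mul_one, Real.norm_eq_abs, sq_abs, sn_sq])
  refine ⟨x, h1, h2, ?_⟩
  rw [F.M_eq ho] at h1
  exact (md_dist_eq_iff h0 hs).1 h1

theorem md_dist_polar {s t : ℝ} {u v : EuclideanPlane} (hx : F.M x = G.md s)
    (hx' : F.ξ x = G.sn s • u) (hy : F.M y = G.md t) (hy' : F.ξ y = G.sn t • v) :
    G.md (dist x y) = G.md s + G.md t - G.curv * G.md s * G.md t -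
      G.sn s * G.sn t * inner ℝ u v := by
  rw [F.md_dist, hx, hy, hx', hy', inner_smul_left, inner_smul_right]
  simp only [conj_trivial]
  ring

theorem md_dist_polar_right {t : ℝ} {v : EuclideanPlane} (x : Plane G) (hy : F.M y = G.md t)
    (hy' : F.ξ y = G.sn t • v) :
    G.md (dist x y) = F.M x * G.cs t + G.md t - G.sn t * inner ℝ (F.ξ x) v := by
  rw [F.md_dist, hy, hy', inner_smul_right, cs_eq]
  ring

/-- Points on a common ray. -/
theorem dist_same_ray {s t : ℝ} {u : EuclideanPlane} (hu : ‖u‖ = 1) (hs : 0 ≤ s) (hst : s ≤ t)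
    (ht : G = .spherical → t ≤ Real.pi) (hx : F.M x = G.md s)
    (hx' : F.ξ x = G.sn s • u) (hy : F.M y = G.md t) (hy' : F.ξ y = G.sn t • u) :
    dist x y = t - s := by
  apply (md_dist_eq_iff (by linarith) fun e => by linarith [ht e]).1
  rw [F.md_dist_polar hx hx' hy hy', md_sub, real_inner_self_eq_norm_sq, hu]
  ring

theorem continuous_M (ho : F.M o = 0) : Continuous F.M := by
  have : F.M = fun x => G.md (dist x o) := funext (F.M_eq ho)
  rw [this]
  exact (continuous_md G).comp (continuous_id.dist continuous_const)

/-- By the law of cosines this coordinate is an affine combination of `M x` and of `md` of the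
distance to a fixed point, taken at distance `1` from the base point in the direction of `v`. -/
theorem continuous_inner_ξ (ho : F.M o = 0) (v : EuclideanPlane) :
    Continuous fun x => inner ℝ (F.ξ x) v := by
  rcases eq_or_ne v 0 with rfl | hv
  · simpa using continuous_const
  have hn : ‖v‖ ≠ 0 := norm_ne_zero_iff.2 hv
  have hsm : G.Small 1 := fun _ => by linarith [Real.pi_gt_three]
  obtain ⟨y, h1, h2, -⟩ := F.exists_polar ho zero_le_one hsm.le_pi
    (u := ‖v‖⁻¹ • v) (by rw [norm_smul, norm_inv, norm_norm, inv_mul_cancel₀ hn])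
  have h3 := sn_pos one_pos hsm
  have : (fun x => inner ℝ (F.ξ x) v) = fun x =>
      ‖v‖ / G.sn 1 * (F.M x * G.cs 1 + G.md 1 - G.md (dist x y)) := by
    funext x
    rw [F.md_dist_polar_right x h1 h2, inner_smul_right]
    field_simp
    ring
  rw [this]
  have hM := F.continuous_M ho
  have := (continuous_md G).comp (continuous_id.dist (continuous_const (y := y)))
  exact continuous_const.mul (((hM.mul continuous_const).add continuous_const).sub this)

theorem continuous_ξ (ho : F.M o = 0) : Continuous F.ξ := by
  have h : F.ξ = fun x => !₂[F.ξ x 0, F.ξ x 1] := by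
    funext x
    ext i
    fin_cases i <;> rfl
  rw [h]
  refine (PiLp.continuous_toLp 2 _).comp (continuous_pi fun i => ?_)
  fin_cases i
  · simpa [inner_eq_coords] using F.continuous_inner_ξ ho !₂[1, 0]
  · simpa [inner_eq_coords] using F.continuous_inner_ξ ho !₂[0, 1]

end PolarFrame

theorem abs_inner_unit_le {u : EuclideanPlane} (hu : ‖u‖ = 1) (v : EuclideanPlane) :
    |inner ℝ u v| ≤ ‖v‖ := by
  simpa [hu] using abs_real_inner_le_norm u v

theorem exists_unit_smul (v : EuclideanPlane) : ∃ u : EuclideanPlane, ‖u‖ = 1 ∧ v = ‖v‖ • u := by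
  rcases eq_or_ne v 0 with rfl | hv
  · exact ⟨!₂[1, 0], by
      have := norm_sq_eq_coords !₂[(1 : ℝ), 0]
      simp at this
      rcases this with h | h
      · exact h
      · linarith [norm_nonneg (!₂[(1 : ℝ), 0] : EuclideanPlane)], by simp⟩
  · have hn : ‖v‖ ≠ 0 := norm_ne_zero_iff.2 hv
    exact ⟨‖v‖⁻¹ • v, by rw [norm_smul, norm_inv, norm_norm, inv_mul_cancel₀ hn],
      by rw [smul_smul, mul_inv_cancel₀ hn, one_smul]⟩

/-- In polar coordinates about `c` the line has coefficients `A = sn δ` and `‖B‖ = cs δ`. The bounds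
are the Cauchy–Schwarz inequality followed by the addition formula: the signed distance to a line is
1-Lipschitz. -/
theorem nline_bounds {G : Geometry} (l : OrientedLine G) {c : Plane G} {δ : ℝ} (h1 : G.Small δ)
    (h2 : G.Small (-δ)) (hc : nline G l c = G.sn δ) (x : Plane G) :
    G.sn (δ - dist x c) ≤ nline G l x ∧ nline G l x ≤ G.sn (δ + dist x c) := by
  obtain ⟨F, hF⟩ := exists_polarFrame c
  obtain ⟨A, B, hAB, h⟩ := F.nline_eq l
  have hA : A = G.sn δ := by
    have := h c
    rw [hF, F.ξ_base hF, hc] at this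
    simpa using this.symm
  have hB : ‖B‖ = G.cs δ := by
    rw [hA] at hAB
    have := sn_sq_add_cs_sq G δ
    exact (pow_left_inj₀ (norm_nonneg _) (cs_pos h2 h1).le two_ne_zero).1 (by linarith)
  have hi := abs_le.1 (abs_real_inner_le_norm B (F.ξ x))
  rw [F.norm_ξ hF, hB] at hi
  rw [h x, F.M_eq hF, ← cs_eq, hA, sn_sub, sn_add]
  constructor <;> linarith [hi.1, hi.2]

theorem continuous_nline {G : Geometry} (l : OrientedLine G) : Continuous (nline G l) := by
  rcases isEmpty_or_nonempty (Plane G) with h | ⟨⟨o⟩⟩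
  · exact continuous_of_const fun x => h.elim x
  obtain ⟨F, hF⟩ := exists_polarFrame o
  obtain ⟨A, B, -, h⟩ := F.nline_eq l
  have : nline G l = fun x => A * (1 - G.curv * F.M x) + inner ℝ (F.ξ x) B := by
    funext x
    rw [h, real_inner_comm]
  rw [this]
  have h1 := F.continuous_M hF
  have h2 := F.continuous_inner_ξ hF B
  fun_prop

instance : CompactSpace UnitSphere := by
  let f : Metric.sphere (0 : EuclideanSpace ℝ (Fin 3)) 1 → UnitSphere :=
    fun v => ⟨v.1, by simp⟩
  have hf : Continuous f := by
    rw [continuous_iff_continuousAt]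
    intro v
    rw [ContinuousAt, tendsto_iff_dist_tendsto_zero]
    have h1 : (v : EuclideanSpace ℝ (Fin 3)) ≠ 0 := by
      intro h
      have := v.2
      simp [h] at this
    have h2 : ContinuousAt (fun w : Metric.sphere (0 : EuclideanSpace ℝ (Fin 3)) 1 =>
        InnerProductGeometry.angle w.1 v.1) v :=
      ContinuousAt.comp (f := fun w : Metric.sphere (0 : EuclideanSpace ℝ (Fin 3)) 1 =>
        ((w : EuclideanSpace ℝ (Fin 3)), (v : EuclideanSpace ℝ (Fin 3))))
        (g := fun y => InnerProductGeometry.angle y.1 y.2)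
        (InnerProductGeometry.continuousAt_angle h1 h1) (by fun_prop)
    have h3 := h2.tendsto
    rw [InnerProductGeometry.angle_self h1] at h3
    exact h3
  have hs : Function.Surjective f := fun x => ⟨⟨x.vec, by simpa using x.norm_vec⟩, rfl⟩
  exact ⟨by simpa [hs.range_eq] using isCompact_range hf⟩

instance instProperSpacePlane (G : Geometry) : ProperSpace (Plane G) := by
  cases G
  · exact inferInstanceAs (ProperSpace EuclideanPlane)
  · exact inferInstanceAs (ProperSpace UpperHalfPlane)
  · exact inferInstanceAs (ProperSpace UnitSphere)

/-! ### Upper and lower bounds for the minimal width. -/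

theorem widthAlong_eq {G : Geometry} (hG : G ≠ .spherical) (l : OrientedLine G)
    (K : Set (Plane G)) : widthAlong G l K = parallelWidth l K := by
  cases G
  · rfl
  · rfl
  · exact absurd rfl hG

theorem setDist_nonneg {X : Type*} [MetricSpace X] (A B : Set X) : 0 ≤ setDist A B := by
  apply Real.sInf_nonneg
  rintro _ ⟨a, _, b, _, rfl⟩
  exact dist_nonneg

theorem setDist_le {X : Type*} [MetricSpace X] {A B : Set X} {a b : X} (ha : a ∈ A) (hb : b ∈ B) :
    setDist A B ≤ dist a b := by
  apply csInf_le
  · refine ⟨0, ?_⟩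
    rintro _ ⟨a, _, b, _, rfl⟩
    exact dist_nonneg
  · exact ⟨a, ha, b, hb, rfl⟩

theorem widthAlong_nonneg (G : Geometry) (l : OrientedLine G) (K : Set (Plane G)) :
    0 ≤ widthAlong G l K := by
  by_cases hG : G = .spherical
  · subst hG
    apply Real.sInf_nonneg
    rintro _ ⟨m, -, -, -, rfl⟩
    linarith [InnerProductGeometry.angle_le_pi l.vec m.vec]
  · rw [widthAlong_eq hG]
    apply Real.sSup_nonneg
    rintro _ ⟨m, -, -, rfl⟩
    exact setDist_nonneg _ _

theorem minimalWidth_le_widthAlong {G : Geometry} {l : OrientedLine G} {K : Set (Plane G)}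
    (h : Supports l K) : minimalWidth K ≤ widthAlong G l K := by
  apply csInf_le
  · refine ⟨0, ?_⟩
    rintro _ ⟨l, -, rfl⟩
    exact widthAlong_nonneg G l K
  · exact ⟨l, h, rfl⟩

/-- The foot of the perpendicular. -/
theorem exists_foot {G : Geometry} (l : OrientedLine G) {x : Plane G} {h : ℝ} (h0 : 0 ≤ h)
    (hs : G.Small h) (hx : nline G l x = G.sn h) : ∃ y ∈ linePoints l, dist y x = h := by
  obtain ⟨F, hF⟩ := exists_polarFrame x
  obtain ⟨A, B, hAB, hl⟩ := F.nline_eq l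
  have hA : A = G.sn h := by
    have := hl x
    rw [hF, F.ξ_base hF, hx] at this
    simpa using this.symm
  have hB : ‖B‖ = G.cs h := by
    rw [hA] at hAB
    have := sn_sq_add_cs_sq G h
    exact (pow_left_inj₀ (norm_nonneg _) (cs_pos_of_nonneg h0 hs).le two_ne_zero).1 (by linarith)
  obtain ⟨u, hu, hBu⟩ := exists_unit_smul B
  obtain ⟨y, h1, h2, h3⟩ := F.exists_polar hF h0 hs.le_pi (u := -u) (by rwa [norm_neg])
  refine ⟨y, mem_linePoints_iff.2 ?_, h3⟩
  rw [hl, h1, h2, hBu, hB, ← cs_eq, hA, inner_smul_left, inner_smul_right, inner_neg_right,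
    real_inner_self_eq_norm_sq, hu]
  simp only [conj_trivial]
  ring

/-- The contact point of `m` belongs to `K`, and its perpendicular onto `l` joins the two lines. -/
theorem setDist_le_of_nline_le {G : Geometry} (hG : G ≠ .spherical) {l m : OrientedLine G}
    {K : Set (Plane G)} (hl : Supports l K) {D : ℝ} (hD : ∀ x ∈ K, nline G l x ≤ G.sn D)
    (hm : Supports m K) : setDist (linePoints l) (linePoints m) ≤ D := by
  obtain ⟨x, hxK, hxm⟩ := hm.2
  obtain ⟨h, hh⟩ := exists_sn_eq hG (nline G l x)
  have hsm : ∀ t, G.Small t := fun t e => absurd e hG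
  have h0 : 0 ≤ h := by
    by_contra hc
    push Not at hc
    have h1 := sn_lt_sn (hsm _) hc (hsm _)
    rw [hh, sn_zero] at h1
    exact absurd (mem_halfPlane_iff.1 (hl.1 hxK)) (not_le.2 h1)
  obtain ⟨y, hy, hyx⟩ := exists_foot l h0 (hsm h) hh.symm
  refine (setDist_le hy hxm).trans ?_
  rw [hyx]
  by_contra hc
  push Not at hc
  have h1 := sn_lt_sn (hsm _) hc (hsm _)
  rw [hh] at h1
  exact absurd (hD x hxK) (not_le.2 h1)

/-- A common form for all geometries of the fact that `K` lies between two lines perpendicular to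
the direction `u`, at distances `ρ` and `R` on the two sides of the base point, and touches the
first. On the sphere these lines bound a lune of breadth `ρ + R`. Otherwise a second supporting line
may be any line disjoint from the first, and `hup` bounds its distance by way of its contact point.
-/
theorem minimalWidth_le_of_strip {G : Geometry} {K : Set (Plane G)} (F : PolarFrame G)
    {u : EuclideanPlane} (hu : ‖u‖ = 1) {ρ R : ℝ} (hD0 : 0 < ρ + R) (hD : G.Small (ρ + R))
    (h1 : ∀ x ∈ K, 0 ≤ G.sn ρ * (1 - G.curv * F.M x) + inner ℝ (G.cs ρ • u) (F.ξ x))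
    (hp : ∃ p ∈ K, G.sn ρ * (1 - G.curv * F.M p) + inner ℝ (G.cs ρ • u) (F.ξ p) = 0)
    (hup : ∀ x ∈ K, G.sn ρ * (1 - G.curv * F.M x) + inner ℝ (G.cs ρ • u) (F.ξ x) ≤ G.sn (ρ + R))
    (h2 : ∀ x ∈ K, 0 ≤ G.sn R * (1 - G.curv * F.M x) + inner ℝ (-G.cs R • u) (F.ξ x)) :
    minimalWidth K ≤ ρ + R := by
  by_cases hG : G = .spherical
  · subst hG
    -- The pole of the great circle with coefficients `sn a` and `k • u`, located by its polar
    -- coordinates.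
    have key : ∀ (a : ℝ) (k : ℝ), k ^ 2 = cs .spherical a ^ 2 → ∃ n : UnitSphere,
        F.M n = 1 - sn .spherical a ∧ F.ξ n = k • u ∧ ∀ x : UnitSphere, inner ℝ n.vec x.vec =
        sn .spherical a * (1 - F.M x) + inner ℝ (k • u) (F.ξ x) := by
      intro a k hk
      have h3 := sn_sq_add_cs_sq .spherical a
      simp only [curv] at h3
      obtain ⟨n, hn, hn'⟩ := F.exists_point (1 - sn .spherical a) (k • u)
        (by simp only [sn]; linarith [Real.sin_le_one a]) (by
          rw [norm_smul, hu, mul_one, Real.norm_eq_abs, sq_abs, hk]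
          simp only [curv]
          linarith)
      refine ⟨n, hn, hn', fun x => ?_⟩
      have h4 := F.md_dist n x
      rw [hn, hn'] at h4
      simp only [curv] at h4
      change 1 - Real.cos (InnerProductGeometry.angle n.vec x.vec) = _ at h4
      rw [InnerProductGeometry.cos_angle, n.norm_vec, x.norm_vec] at h4
      linarith
    obtain ⟨n, hn, hn', hnx⟩ := key ρ (cs .spherical ρ) rfl
    obtain ⟨m, hm, hm', hmx⟩ := key R (-cs .spherical R) (by ring)
    simp only [curv, one_mul] at h1 h2 hp
    have hnm : inner ℝ n.vec m.vec = -Real.cos (ρ + R) := by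
      rw [hnx, hm, hm', inner_smul_left, inner_smul_right, real_inner_self_eq_norm_sq, hu,
        Real.cos_add]
      simp [sn, cs]
      ring
    have hπ := hD rfl
    have hlt : Real.cos (ρ + R) < 1 := by
      have := Real.cos_lt_cos_of_nonneg_of_le_pi le_rfl (by linarith [Real.pi_pos]) hD0
      simpa using this
    have hgt : 0 < Real.cos (ρ + R) :=
      Real.cos_pos_of_mem_Ioo ⟨by linarith [Real.pi_pos], hπ⟩
    have hang : Real.pi - InnerProductGeometry.angle n.vec m.vec = ρ + R := by
      rw [InnerProductGeometry.angle, hnm, n.norm_vec, m.norm_vec]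
      simp [Real.arccos_neg]
      exact Real.arccos_cos hD0.le (by linarith [Real.pi_pos])
    have hsup : Supports (G := .spherical) n K := by
      constructor
      · intro x hx
        change 0 ≤ inner ℝ n.vec x.vec
        rw [hnx]
        exact h1 x hx
      · obtain ⟨p, hpK, hp0⟩ := hp
        refine ⟨p, hpK, ?_⟩
        change inner ℝ n.vec p.vec = 0
        rw [hnx]
        exact hp0
    refine (minimalWidth_le_widthAlong hsup).trans ?_
    apply csInf_le
    · refine ⟨0, ?_⟩
      rintro _ ⟨m, -, -, -, rfl⟩
      linarith [InnerProductGeometry.angle_le_pi (UnitSphere.vec n) m.vec]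
    · refine ⟨m, ?_, ?_, fun x hx => ⟨hsup.1 hx, ?_⟩, hang.symm⟩
      · rintro rfl
        rw [real_inner_self_eq_norm_sq, m.norm_vec] at hnm
        linarith
      · intro h
        rw [h, inner_neg_right, real_inner_self_eq_norm_sq, n.norm_vec] at hnm
        linarith
      · change 0 ≤ inner ℝ m.vec x.vec
        rw [hmx]
        exact h2 x hx
  · obtain ⟨l, hl⟩ := F.exists_line (G.sn ρ) (G.cs ρ • u) (by
      rw [norm_smul, hu, mul_one, Real.norm_eq_abs, sq_abs, sn_sq_add_cs_sq])
    have hsup : Supports l K := by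
      constructor
      · intro x hx
        rw [mem_halfPlane_iff, hl]
        exact h1 x hx
      · obtain ⟨p, hpK, hp0⟩ := hp
        exact ⟨p, hpK, mem_linePoints_iff.2 (by rw [hl, hp0])⟩
    refine (minimalWidth_le_widthAlong hsup).trans ?_
    rw [widthAlong_eq hG]
    refine Real.sSup_le ?_ hD0.le
    rintro _ ⟨m, hm, -, rfl⟩
    exact setDist_le_of_nline_le hG hsup (fun x hx => by rw [hl]; exact hup x hx) hm

/-- Let `p` be a point of `K` farthest from `l`, at distance `D`. The line `m` through `p`
perpendicular to the perpendicular from `p` to `l` satisfies `cs D * nline m x = sn D * cs (dist x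
p) - nline l x`. Since `1 ≤ cs` outside the sphere, `m` supports `K` and is at distance at least `D`
from `l`. -/
theorem le_parallelWidth {G : Geometry} (hG : G ≠ .spherical) {l : OrientedLine G}
    {K : Set (Plane G)} (hK : IsCompact K) (hl : Supports l K) {δ : ℝ} (hδ : 0 < δ)
    (h : ∃ x ∈ K, G.sn δ ≤ nline G l x) : δ ≤ parallelWidth l K := by
  have hsm : ∀ t, G.Small t := fun t e => absurd e hG
  obtain ⟨x0, hx0, hδx⟩ := h
  obtain ⟨p, hpK, hmax⟩ := hK.exists_isMaxOn ⟨x0, hx0⟩ (continuous_nline l).continuousOn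
  obtain ⟨D, hD⟩ := exists_sn_eq hG (nline G l p)
  have hδD : δ ≤ D := by
    by_contra hc
    push Not at hc
    have h1 := sn_lt_sn (hsm _) hc (hsm _)
    rw [hD] at h1
    have h2 : nline G l x0 ≤ nline G l p := hmax hx0
    linarith
  obtain ⟨F, hF⟩ := exists_polarFrame p
  obtain ⟨A, B, hAB, hf⟩ := F.nline_eq l
  have hA : A = G.sn D := by
    have := hf p
    rw [hF, F.ξ_base hF, ← hD] at this
    simpa using this.symm
  have hc := cs_pos (hsm (-D)) (hsm D)
  have hB : ‖B‖ = G.cs D := by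
    rw [hA] at hAB
    have := sn_sq_add_cs_sq G D
    exact (pow_left_inj₀ (norm_nonneg _) hc.le two_ne_zero).1 (by linarith)
  have hsn : 0 < G.sn D := sn_pos (hδ.trans_le hδD) (hsm D)
  obtain ⟨m, hm⟩ := F.exists_line 0 (-(G.cs D)⁻¹ • B) (by
    rw [norm_smul, hB, norm_neg, Real.norm_eq_abs, abs_of_pos (inv_pos.2 hc),
      inv_mul_cancel₀ hc.ne']
    simp)
  have hcs : ∀ x, 1 ≤ 1 - G.curv * F.M x := fun x => by
    rw [F.M_eq hF, ← cs_eq]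
    exact one_le_cs hG _
  have hmx : ∀ x, G.cs D * nline G m x = G.sn D * (1 - G.curv * F.M x) - nline G l x := by
    intro x
    rw [hm, hf, hA, inner_smul_left]
    simp only [conj_trivial]
    field_simp
    ring
  have hms : Supports m K := by
    constructor
    · intro x hx
      rw [mem_halfPlane_iff]
      have h1 := hmx x
      have h2 : nline G l x ≤ nline G l p := hmax hx
      rw [← hD] at h2
      by_contra hc'
      push Not at hc'
      nlinarith [hcs x]
    · refine ⟨p, hpK, mem_linePoints_iff.2 ?_⟩
      have h1 := hmx p
      rw [hF, hD] at h1
      simp only [mul_zero, sub_zero, mul_one, sub_self, mul_eq_zero] at h1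
      exact h1.resolve_left hc.ne'
  have hge : ∀ z ∈ linePoints m, G.sn D ≤ nline G l z := by
    intro z hz
    have h1 := hmx z
    rw [mem_linePoints_iff.1 hz] at h1
    nlinarith [hcs z]
  have hdist : ∀ y ∈ linePoints l, ∀ z ∈ linePoints m, D ≤ dist y z := by
    intro y hy z hz
    have h1 := (nline_bounds l (c := y) (δ := 0) (hsm _) (hsm _)
      (by rw [mem_linePoints_iff.1 hy, sn_zero]) z).2
    by_contra hc'
    push Not at hc'
    rw [dist_comm] at hc'
    have h2 := sn_lt_sn (hsm _) hc' (hsm _)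
    rw [zero_add] at h1
    linarith [hge z hz]
  have hdisj : Disjoint (linePoints l) (linePoints m) := by
    rw [Set.disjoint_left]
    intro z hz hz'
    have h1 := hge z hz'
    rw [mem_linePoints_iff.1 hz] at h1
    linarith
  have hmem : D ≤ setDist (linePoints l) (linePoints m) := by
    apply le_csInf
    · obtain ⟨y, _, hy⟩ := hl.2
      obtain ⟨z, _, hz⟩ := hms.2
      exact ⟨_, y, hy, z, hz, rfl⟩
    · rintro _ ⟨y, hy, z, hz, rfl⟩
      exact hdist y hy z hz
  refine hδD.trans (hmem.trans (le_csSup ⟨D, ?_⟩ ⟨m, hms, hdisj, rfl⟩))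
  rintro _ ⟨m', hm', -, rfl⟩
  exact setDist_le_of_nline_le hG hl (fun x hx => by rw [hD]; exact hmax hx) hm'

/-- If `x ∈ K` has height at least `δ` over the circle with pole `n`, then the angle from `n` to `x`
is at most `π / 2 - δ`, and that from `x` to the other pole `m` is at most `π / 2`. The triangle
inequality bounds the angle between the poles. -/
theorem le_luneWidth {K : Set UnitSphere} {n : UnitSphere}
    (hn : Supports (G := .spherical) n K) {δ r : ℝ} (hδ : 0 < δ)
    (hδ' : δ < Real.pi / 2) (h : ∃ x ∈ K, Real.sin δ ≤ inner ℝ n.vec x.vec) {c : UnitSphere}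
    (hr : r < Real.pi / 2) (hc : K ⊆ Metric.closedBall c r) : δ ≤ luneWidth n K := by
  have hpos : ∀ x ∈ K, 0 < inner ℝ c.vec x.vec := by
    intro x hx
    have h1 : InnerProductGeometry.angle x.vec c.vec ≤ r := hc hx
    have h2 : 0 < Real.cos (InnerProductGeometry.angle x.vec c.vec) :=
      Real.cos_pos_of_mem_Ioo ⟨by
        linarith [InnerProductGeometry.angle_nonneg x.vec c.vec, Real.pi_pos], by linarith⟩
    rw [InnerProductGeometry.cos_angle, c.norm_vec, x.norm_vec, real_inner_comm] at h2
    simpa using h2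
  apply le_csInf
  -- The infimum of the empty set would be `0`, so some lune is needed. Its second pole can be `c`,
  -- because `K` lies in the open hemisphere about `c`.
  · obtain ⟨p, hp, hp0⟩ := hn.2
    have hp0' : inner ℝ (UnitSphere.vec n) p.vec = 0 := hp0
    have hpc := hpos p hp
    refine ⟨_, c, ?_, ?_, fun x hx => ⟨hn.1 hx, (hpos x hx).le⟩, rfl⟩
    · rintro rfl
      linarith
    · intro e
      rw [e, inner_neg_left] at hpc
      linarith
  · rintro _ ⟨m, -, -, hm, rfl⟩
    obtain ⟨x, hx, hxδ⟩ := h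
    have h1 : InnerProductGeometry.angle n.vec x.vec ≤ Real.pi / 2 - δ := by
      rw [InnerProductGeometry.angle, n.norm_vec, x.norm_vec]
      calc Real.arccos (inner ℝ n.vec x.vec / (1 * 1)) ≤ Real.arccos (Real.cos (Real.pi / 2 - δ)) :=
            Real.arccos_le_arccos (by rw [Real.cos_pi_div_two_sub]; simpa using hxδ)
        _ = _ := Real.arccos_cos (by linarith) (by linarith)
    have h2 : InnerProductGeometry.angle x.vec m.vec ≤ Real.pi / 2 := by
      rw [InnerProductGeometry.angle_comm, InnerProductGeometry.angle, Real.arccos_le_pi_div_two]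
      exact div_nonneg (hm hx).2 (by positivity)
    linarith [InnerProductGeometry.angle_le_angle_add_angle n.vec x.vec m.vec]

theorem le_minimalWidth {G : Geometry} {K : Set (Plane G)} (hK : IsCompact K)
    (hne : ∃ l : OrientedLine G, Supports l K) {δ r : ℝ} (hδ : 0 < δ) (hδ' : G.Small δ)
    {c : Plane G} (hr : G.Small r) (hc : K ⊆ Metric.closedBall c r)
    (h : ∀ l : OrientedLine G, Supports l K → ∃ x ∈ K, G.sn δ ≤ nline G l x) :
    δ ≤ minimalWidth K := by
  obtain ⟨l0, hl0⟩ := hne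
  refine le_csInf (Set.nonempty_of_mem (x := widthAlong G l0 K) ⟨l0, hl0, rfl⟩) ?_
  rintro _ ⟨l, hl, rfl⟩
  by_cases hG : G = .spherical
  · subst hG
    exact le_luneWidth hl hδ (hδ' rfl) (h l hl) (hr rfl) hc
  · rw [widthAlong_eq hG]
    exact le_parallelWidth hG hK hl hδ (h l hl)

/-! ### The width of a set contained in a lens. -/

section Lens

variable {G : Geometry} {K : Set (Plane G)} {F : PolarFrame G} {o c p q : Plane G}
  {u : EuclideanPlane} {r ρ R : ℝ}

/-- The tangent line of the disk of radius `r` about `c` at the point `p`. -/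
theorem exists_tangent_line (hu : ‖u‖ = 1) (hr : G.Small r) (hρ : 0 ≤ ρ) (hρr : ρ ≤ r)
    (hcM : F.M c = G.md (r - ρ)) (hcξ : F.ξ c = G.sn (r - ρ) • u)
    (hcK : K ⊆ Metric.closedBall c r) :
    ∃ l : OrientedLine G,
      (∀ x, nline G l x = G.sn ρ * (1 - G.curv * F.M x) + inner ℝ (G.cs ρ • u) (F.ξ x)) ∧
      ∀ x ∈ K, 0 ≤ nline G l x := by
  obtain ⟨l, hl⟩ := F.exists_line (G.sn ρ) (G.cs ρ • u) (by
    rw [norm_smul, hu, mul_one, Real.norm_eq_abs, sq_abs, sn_sq_add_cs_sq])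
  refine ⟨l, hl, fun x hx => ?_⟩
  have h1 : nline G l c = G.sn r := by
    rw [hl, hcM, hcξ, ← cs_eq, inner_smul_left, inner_smul_right, real_inner_self_eq_norm_sq, hu]
    conv_rhs => rw [show r = ρ + (r - ρ) by ring, sn_add]
    simp only [conj_trivial]
    ring
  have h2 := (nline_bounds l hr (small_neg (hρ.trans hρr)) h1 x).1
  exact (sn_nonneg (sub_nonneg.2 (hcK hx)) (hr.mono (by linarith [@dist_nonneg _ _ x c]))).trans h2

theorem tangent_line_apply (hu : ‖u‖ = 1) (hpM : F.M p = G.md ρ) (hpξ : F.ξ p = G.sn ρ • -u) :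
    G.sn ρ * (1 - G.curv * F.M p) + inner ℝ (G.cs ρ • u) (F.ξ p) = 0 := by
  rw [hpM, hpξ, ← cs_eq, inner_smul_left, inner_smul_right, inner_neg_right,
    real_inner_self_eq_norm_sq, hu]
  simp only [conj_trivial]
  ring

theorem exists_supports_of_subset_ball (hu : ‖u‖ = 1) (hr : G.Small r) (hρ : 0 ≤ ρ) (hρr : ρ ≤ r)
    (hcM : F.M c = G.md (r - ρ)) (hcξ : F.ξ c = G.sn (r - ρ) • u)
    (hcK : K ⊆ Metric.closedBall c r) (hpK : p ∈ K) (hpM : F.M p = G.md ρ)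
    (hpξ : F.ξ p = G.sn ρ • -u) : ∃ l : OrientedLine G, Supports l K := by
  obtain ⟨l, hl, h⟩ := exists_tangent_line hu hr hρ hρr hcM hcξ hcK
  exact ⟨l, fun x hx => mem_halfPlane_iff.2 (h x hx), p, hpK,
    mem_linePoints_iff.2 (by rw [hl, tangent_line_apply hu hpM hpξ])⟩

/-- The disks about `c` and `q` meet the axis at distance `ρ` in direction `-u` and at distance `R`
in direction `u`. Their tangent lines there are the two sides of a strip containing `K`, and the
first supports `K` at `p`. -/
theorem minimalWidth_le_of_lens (hu : ‖u‖ = 1) (hr : G.Small r) (hρ : 0 ≤ ρ) (hR : 0 ≤ R)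
    (hρR : 0 < ρ + R) (hρRr : ρ + R ≤ r)
    (hcM : F.M c = G.md (r - ρ)) (hcξ : F.ξ c = G.sn (r - ρ) • u)
    (hqM : F.M q = G.md (r - R)) (hqξ : F.ξ q = G.sn (r - R) • -u)
    (hcK : K ⊆ Metric.closedBall c r) (hqK : K ⊆ Metric.closedBall q r) (hpK : p ∈ K)
    (hpM : F.M p = G.md ρ) (hpξ : F.ξ p = G.sn ρ • -u) : minimalWidth K ≤ ρ + R := by
  obtain ⟨l, hl, h⟩ := exists_tangent_line hu hr hρ (by linarith) hcM hcξ hcK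
  obtain ⟨m, hm, h'⟩ := exists_tangent_line (by rwa [norm_neg]) hr hR (by linarith) hqM hqξ hqK
  have h1 : nline G l q = G.sn (ρ - (r - R)) := by
    rw [hl, hqM, hqξ, ← cs_eq, inner_smul_left, inner_smul_right, inner_neg_right,
      real_inner_self_eq_norm_sq, hu, sn_sub G ρ (r - R)]
    simp only [conj_trivial]
    ring
  refine minimalWidth_le_of_strip F hu hρR (hr.mono hρRr) (fun x hx => ?_)
    ⟨p, hpK, tangent_line_apply hu hpM hpξ⟩ (fun x hx => ?_) (fun x hx => ?_)
  · rw [← hl]; exact h x hx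
  · rw [← hl]
    have h2 := (nline_bounds l (hr.mono (by linarith)) (hr.mono (by linarith)) h1 x).2
    have h3 : dist x q ≤ r := hqK hx
    exact h2.trans (sn_le_sn (hr.mono (by linarith [@dist_nonneg _ _ x q])) (by linarith)
      (hr.mono hρRr))
  · have := h' x hx
    rw [hm, smul_neg, ← neg_smul] at this
    exact this

/-- By compactness `K` has a positive distance from the circle about `q`, so `q` can be moved
outwards along the axis by some `ε`, which replaces `R` by `R - ε`. -/
theorem minimalWidth_lt_of_lens (hF : F.M o = 0) (hu : ‖u‖ = 1) (hr : G.Small r) (hρ : 0 ≤ ρ)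
    (hR : 0 < R) (hρR : 0 < ρ) (hρRr : ρ + R ≤ r)
    (hcM : F.M c = G.md (r - ρ)) (hcξ : F.ξ c = G.sn (r - ρ) • u)
    (hqM : F.M q = G.md (r - R)) (hqξ : F.ξ q = G.sn (r - R) • -u) (hK : IsCompact K)
    (hcK : K ⊆ Metric.closedBall c r) (hqK : ∀ x ∈ K, dist x q < r) (hpK : p ∈ K)
    (hpM : F.M p = G.md ρ) (hpξ : F.ξ p = G.sn ρ • -u) : minimalWidth K < ρ + R := by
  obtain ⟨x0, hx0, hmax⟩ := hK.exists_isMaxOn ⟨p, hpK⟩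
    (continuous_id.dist (continuous_const (y := q))).continuousOn
  simp only [id] at hmax
  set ε := min (r - dist x0 q) R with hε
  have hε0 : 0 < ε := lt_min (sub_pos.2 (hqK x0 hx0)) hR
  have hεR : ε ≤ R := min_le_right _ _
  have hεd : ε ≤ r - dist x0 q := min_le_left _ _
  have hu' : ‖-u‖ = 1 := by rwa [norm_neg]
  have hsm : G.Small (r - (R - ε)) := hr.mono (by linarith)
  obtain ⟨q', hM, hξ, -⟩ := F.exists_polar hF (s := r - (R - ε)) (by linarith) hsm.le_pi hu'
  have hqq' : dist q q' = ε := by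
    rw [F.dist_same_ray hu' (by linarith) (by linarith) hsm.le_pi hqM hqξ hM hξ]
    ring
  have := minimalWidth_le_of_lens hu hr hρ (R := R - ε) (by linarith) (by linarith) (by linarith)
    hcM hcξ hM hξ hcK (fun x hx => ?_) hpK hpM hpξ
  · linarith
  · rw [Metric.mem_closedBall]
    have h1 : dist x q ≤ dist x0 q := hmax hx
    linarith [dist_triangle x q q']

end Lens

/-! ### Convex hulls in the plane, minimal enclosing disks and the inradius. -/

/-- Carathéodory's theorem in the plane. -/
theorem exists_weights_of_mem_convexHull {U : Set EuclideanPlane} {x : EuclideanPlane}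
    (h : x ∈ convexHull ℝ U) : ∃ (w : Fin 3 → ℝ) (z : Fin 3 → EuclideanPlane),
      (∀ i, 0 ≤ w i) ∧ ∑ i, w i = 1 ∧ (∀ i, z i ∈ U) ∧ ∑ i, w i • z i = x := by
  obtain ⟨u₀, hu₀⟩ : U.Nonempty := convexHull_nonempty_iff.1 ⟨x, h⟩
  obtain ⟨ι, _, z, w, hz, haff, hw, hw1, hx⟩ := eq_pos_convex_span_of_mem_convexHull h
  have hcard : Fintype.card ι ≤ 3 := by
    have := haff.card_le_finrank_succ
    have h2 := Submodule.finrank_le (vectorSpan ℝ (Set.range z))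
    rw [finrank_euclideanSpace_fin] at h2
    omega
  obtain ⟨e⟩ : Nonempty (ι ↪ Fin 3) :=
    Function.Embedding.nonempty_of_card_le (by simpa using hcard)
  have hext : ∀ i, Function.extend e w 0 (e i) = w i := fun i => e.injective.extend_apply _ _ _
  have hext' : ∀ i, Function.extend e z (fun _ => u₀) (e i) = z i :=
    fun i => e.injective.extend_apply _ _ _
  have hno : ∀ j, j ∉ Set.range e → Function.extend e w 0 j = 0 := fun j hj =>
    Function.extend_apply' _ _ _ (by simpa using hj)
  refine ⟨Function.extend e w 0, Function.extend e z fun _ => u₀, fun j => ?_, ?_, fun j => ?_, ?_⟩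
  · by_cases hj : j ∈ Set.range e
    · obtain ⟨i, rfl⟩ := hj
      rw [hext]; exact (hw i).le
    · rw [hno j hj]
  · rw [← hw1]
    refine (Finset.sum_of_injOn e e.injective.injOn (by simp) (fun j _ hj => hno j ?_)
      fun i _ => (hext i).symm).symm
    simpa using hj
  · by_cases hj : j ∈ Set.range e
    · obtain ⟨i, rfl⟩ := hj
      rw [hext']; exact hz ⟨i, rfl⟩
    · rw [Function.extend_apply' _ _ _ (by simpa using hj)]
      exact hu₀
  · rw [← hx]
    refine (Finset.sum_of_injOn e e.injective.injOn (by simp) (fun j _ hj => ?_)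
      fun i _ => by rw [hext, hext']).symm
    rw [hno j (by simpa using hj), zero_smul]

theorem isCompact_convexHull_of_isCompact {U : Set EuclideanPlane} (hU : IsCompact U) :
    IsCompact (convexHull ℝ U) := by
  have h1 : IsCompact (stdSimplex ℝ (Fin 3) ×ˢ Set.univ.pi fun _ : Fin 3 => U) :=
    (isCompact_stdSimplex ℝ (Fin 3)).prod (isCompact_univ_pi fun _ => hU)
  have h2 : Continuous fun p : (Fin 3 → ℝ) × (Fin 3 → EuclideanPlane) => ∑ i, p.1 i • p.2 i := by
    fun_prop
  convert h1.image h2 using 1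
  ext x
  constructor
  · intro hx
    obtain ⟨w, z, hw, hw1, hz, h⟩ := exists_weights_of_mem_convexHull hx
    exact ⟨(w, z), ⟨⟨hw, hw1⟩, fun i _ => hz i⟩, h⟩
  · rintro ⟨⟨w, z⟩, ⟨⟨hw, hw1⟩, hz⟩, rfl⟩
    exact (convex_convexHull ℝ U).sum_mem (fun i _ => hw i) hw1
      fun i _ => subset_convexHull ℝ U (hz i trivial)

/-- A closed convex set not containing the origin lies in an open half-plane. -/
theorem exists_inner_pos_of_zero_notMem_convexHull {U : Set EuclideanPlane} (hU : IsCompact U)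
    (h : (0 : EuclideanPlane) ∉ convexHull ℝ U) :
    ∃ η : EuclideanPlane, ‖η‖ = 1 ∧ ∀ u ∈ U, 0 < inner ℝ u η := by
  obtain ⟨f, a, h1, h2⟩ := geometric_hahn_banach_point_closed (convex_convexHull ℝ U)
    (isCompact_convexHull_of_isCompact hU).isClosed h
  rw [map_zero] at h1
  set v := (InnerProductSpace.toDual ℝ EuclideanPlane).symm f with hv
  have hf : ∀ u, inner ℝ u v = f u := fun u => by
    rw [real_inner_comm, hv, InnerProductSpace.toDual_symm_apply]
  obtain ⟨η, hη, hvη⟩ := exists_unit_smul v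
  refine ⟨η, hη, fun u hu => ?_⟩
  have h3 := h2 u (subset_convexHull ℝ U hu)
  rw [← hf, hvη, inner_smul_right] at h3
  have h4 : 0 < ‖v‖ * inner ℝ u η := h1.trans h3
  exact pos_of_mul_pos_right h4 (norm_nonneg v)

/-- If the origin were not in the convex hull of the directions of the farthest points, some `η`
would have positive inner product with all of them, and a small step of the centre along `η` would
decrease the enclosing radius. -/
theorem exists_minimal_enclosing_ball {G : Geometry} {C : Set (Plane G)} (hC : IsCompact C)
    (hne : C.Nonempty) {c₀ : Plane G} {r : ℝ} (hr : G.Small r) (hc₀ : C ⊆ Metric.closedBall c₀ r) :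
    ∃ (o : Plane G) (R : ℝ), 0 ≤ R ∧ R ≤ r ∧ C ⊆ Metric.closedBall o R ∧
      (∀ o' R', C ⊆ Metric.closedBall o' R' → R ≤ R') ∧
      ∀ F : PolarFrame G, F.M o = 0 → (0 : EuclideanPlane) ∈
        convexHull ℝ (F.ξ '' {c ∈ C | dist c o = R}) := by
  obtain ⟨c₁, hc₁⟩ := hne
  set φ : Plane G → ℝ := fun x => sSup ((fun c => dist c x) '' C) with hφ
  have hcont : Continuous φ := hC.continuous_sSup (f := fun x c => dist c x) (by
    exact continuous_snd.dist continuous_fst)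
  have hbdd : ∀ x, BddAbove ((fun c => dist c x) '' C) := fun x =>
    (hC.image (continuous_id.dist continuous_const)).bddAbove
  have hle : ∀ x, ∀ c ∈ C, dist c x ≤ φ x := fun x c hc => le_csSup (hbdd x) ⟨c, hc, rfl⟩
  have hφle : ∀ x t, C ⊆ Metric.closedBall x t → φ x ≤ t := by
    intro x t h
    refine csSup_le (Set.Nonempty.image _ ⟨c₁, hc₁⟩) ?_
    rintro _ ⟨c, hc, rfl⟩
    exact h hc
  have hr0 : 0 ≤ r := dist_nonneg.trans (hc₀ hc₁)
  -- A centre at distance more than `r` from `c₁ ∈ C` has enclosing radius more than `r`, so a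
  -- minimum over this disk is a global one.
  obtain ⟨o, -, ho⟩ := (isCompact_closedBall c₁ r).exists_isMinOn
    ⟨c₁, Metric.mem_closedBall_self hr0⟩ hcont.continuousOn
  have hmin : ∀ x, φ o ≤ φ x := by
    intro x
    by_cases hx : x ∈ Metric.closedBall c₁ r
    · exact ho hx
    · have h1 : φ o ≤ φ c₀ := ho (by
        rw [Metric.mem_closedBall, dist_comm]; exact hc₀ hc₁)
      rw [Metric.mem_closedBall, not_le, dist_comm] at hx
      linarith [hφle c₀ r hc₀, hle x c₁ hc₁]
  have hR0 : 0 ≤ φ o := dist_nonneg.trans (hle o c₁ hc₁)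
  have hRr : φ o ≤ r := (hmin c₀).trans (hφle c₀ r hc₀)
  refine ⟨o, φ o, hR0, hRr, fun c hc => hle o c hc, fun o' R' h => (hmin o').trans (hφle _ _ h),
    fun F hF => ?_⟩
  by_contra hcon
  have hcomp : IsCompact (F.ξ '' {c ∈ C | dist c o = φ o}) := by
    apply IsCompact.image _ (F.continuous_ξ hF)
    exact hC.inter_right (isClosed_eq (continuous_id.dist continuous_const) continuous_const)
  obtain ⟨η, hη, hpos⟩ := exists_inner_pos_of_zero_notMem_convexHull hcomp hcon
  have hRsm : G.Small (φ o) := hr.mono hRr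
  have hMle : ∀ c ∈ C, F.M c ≤ G.md (φ o) := fun c hc => by
    rw [F.M_eq hF]; exact (md_dist_le_iff hR0 hRsm.le_pi).2 (hle o c hc)
  have hlim : Filter.Tendsto G.sn (nhds 0) (nhds 0) := by
    simpa using (continuous_sn G).tendsto 0
  -- Compactness makes the step length uniform in `c`. Near a point that is not farthest, continuity
  -- suffices. Near a farthest point the gain `sn t * ⟪ξ c, η⟫` is of first order, while the loss is
  -- at most of order `md t ≤ sn t ^ 2`.
  have hev : ∀ᶠ t in nhds (0 : ℝ), ∀ c ∈ C, 0 < t → t < 1 →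
      F.M c ≤ G.md (φ o) → F.M c * G.cs t + G.md t - G.sn t * inner ℝ (F.ξ c) η < G.md (φ o) := by
    apply hC.eventually_forall_of_forall_eventually
    intro c hc
    have hi := F.continuous_inner_ξ hF η
    have hMc := F.continuous_M hF
    by_cases hlt : F.M c < G.md (φ o)
    · have hcon : Continuous fun z : ℝ × Plane G =>
          F.M z.2 * G.cs z.1 + G.md z.1 - G.sn z.1 * inner ℝ (F.ξ z.2) η := by
        have h1 := (continuous_cs G).comp (continuous_fst (X := ℝ) (Y := Plane G))
        have h2 := (continuous_md G).comp (continuous_fst (X := ℝ) (Y := Plane G))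
        have h3 := (continuous_sn G).comp (continuous_fst (X := ℝ) (Y := Plane G))
        exact (((hMc.comp continuous_snd).mul h1).add h2).sub (h3.mul (hi.comp continuous_snd))
      have := hcon.continuousAt.eventually_lt (x₀ := ((0 : ℝ), c))
        (continuousAt_const (y := G.md (φ o))) (by simpa using hlt)
      filter_upwards [this] with z hz _ _ _
      exact hz
    · have hceq : dist c o = φ o := by
        apply (md_dist_eq_iff hR0 hRsm.le_pi).1
        rw [← F.M_eq hF]
        exact le_antisymm (hMle c hc) (not_lt.1 hlt)
      have hcpos := hpos _ ⟨c, ⟨hc, hceq⟩, rfl⟩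
      have hcon : Continuous fun z : ℝ × Plane G =>
          G.sn z.1 * (1 - G.curv * F.M z.2) - inner ℝ (F.ξ z.2) η := by
        have h3 := (continuous_sn G).comp (continuous_fst (X := ℝ) (Y := Plane G))
        exact (h3.mul (continuous_const.sub (continuous_const.mul (hMc.comp continuous_snd)))).sub
          (hi.comp continuous_snd)
      have := hcon.continuousAt.eventually_lt (x₀ := ((0 : ℝ), c))
        (continuousAt_const (y := (0 : ℝ))) (by simpa using hcpos)
      have hcM : ∀ᶠ z in nhds ((0 : ℝ), c), 0 < 1 - G.curv * F.M z.2 := by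
        have h0 : 0 < 1 - G.curv * F.M c := by
          rw [F.M_eq hF, ← cs_eq, hceq]
          exact cs_pos_of_nonneg hR0 hRsm
        exact (continuousAt_const (y := (0 : ℝ))).eventually_lt
          (continuous_const.sub (continuous_const.mul (hMc.comp continuous_snd))).continuousAt h0
      filter_upwards [this, hcM] with z hz hz' h0 h1 hM
      have hsm1 : G.Small z.1 := fun _ => by linarith [Real.pi_gt_three]
      have hcs := cs_pos_of_nonneg h0.le hsm1
      have hsn := sn_pos h0 hsm1
      have hmd : G.md z.1 ≤ G.sn z.1 ^ 2 := by
        rw [sn_sq_eq_mul]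
        nlinarith [md_nonneg G z.1]
      have h3 : G.md z.1 * (1 - G.curv * F.M z.2) ≤ G.sn z.1 ^ 2 * (1 - G.curv * F.M z.2) :=
        mul_le_mul_of_nonneg_right hmd hz'.le
      have h4 : G.sn z.1 * (G.sn z.1 * (1 - G.curv * F.M z.2)) < G.sn z.1 * inner ℝ (F.ξ z.2) η :=
        mul_lt_mul_of_pos_left (by linarith) hsn
      rw [cs_eq]
      linarith
  obtain ⟨ε, hε, hball⟩ := Metric.eventually_nhds_iff.1 hev
  obtain ⟨t, ht0, ht⟩ := exists_between (lt_min hε one_pos)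
  obtain ⟨o', hM', hξ', -⟩ := F.exists_polar hF (s := t) ht0.le (fun _ => by
    linarith [Real.pi_gt_three, ht.trans_le (min_le_right _ _)]) hη
  have hlt : ∀ c ∈ C, dist c o' < φ o := by
    intro c hc
    apply (md_dist_lt_iff hR0 hRsm.le_pi).1
    rw [F.md_dist_polar_right c hM' hξ']
    refine hball ?_ c hc ht0 (ht.trans_le (min_le_right _ _)) (hMle c hc)
    rw [Real.dist_eq, sub_zero, abs_of_pos ht0]
    exact ht.trans_le (min_le_left _ _)
  obtain ⟨c, hc, hceq⟩ := (hC.image (continuous_id.dist (continuous_const (y := o')))).sSup_mem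
    ⟨_, c₁, hc₁, rfl⟩
  have h1 := hlt c hc
  have h2 : φ o' = dist c o' := hceq.symm
  linarith [hmin o']

theorem dist_add_le_of_closedBall_subset {G : Geometry} {x c : Plane G} {r R : ℝ} (hr : G.Small r)
    (hR : 0 ≤ R) (h : Metric.closedBall x R ⊆ Metric.closedBall c r) : dist x c + R ≤ r := by
  by_contra hc
  push Not at hc
  have hx : dist x c ≤ r := h (Metric.mem_closedBall_self hR)
  have hd : 0 ≤ dist x c := dist_nonneg
  obtain ⟨F, hF⟩ := exists_polarFrame c
  obtain ⟨u, hu, hxu⟩ := exists_unit_smul (F.ξ x)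
  rw [F.norm_ξ hF] at hxu
  -- The cap `r + 1` keeps the point on the ray within distance `π` on the sphere, where `R` is
  -- arbitrary.
  set t := min (dist x c + R) (r + 1) with ht
  have hrt : r < t := lt_min hc (by linarith)
  have htπ : G = .spherical → t ≤ Real.pi := fun e => by
    have h1 := hr e
    have h2 : t ≤ r + 1 := min_le_right _ _
    linarith [Real.pi_gt_three]
  obtain ⟨y, hy, hy', hyt⟩ := F.exists_polar hF (s := t) (by linarith) htπ hu
  have h1 := F.dist_same_ray hu hd (by linarith) htπ (F.M_eq hF x) hxu hy hy'
  have h2 : y ∈ Metric.closedBall c r := h (by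
    rw [Metric.mem_closedBall, dist_comm, h1]
    have : t ≤ dist x c + R := min_le_left _ _
    linarith)
  rw [Metric.mem_closedBall, hyt] at h2
  linarith

/-- A disk of radius `R` about `x` lies in every disk of radius `r` with centre in `C` if and only
if `C` lies in the disk of radius `r - R` about `x`. -/
theorem inradius_eq_of_minimal_enclosing_ball {G : Geometry} {K C : Set (Plane G)} {o : Plane G}
    {r a : ℝ} (hr : G.Small r) (hK : K = ⋂ c ∈ C, Metric.closedBall c r) (har : a < r)
    (hC : C ⊆ Metric.closedBall o a) (hmin : ∀ o' R', C ⊆ Metric.closedBall o' R' → a ≤ R') :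
    Metric.closedBall o (r - a) ⊆ K ∧ inradius K = r - a := by
  have hsub : Metric.closedBall o (r - a) ⊆ K := by
    intro x hx
    rw [hK]
    refine Set.mem_iInter₂.2 fun c hc => ?_
    have h1 : dist c o ≤ a := hC hc
    rw [Metric.mem_closedBall] at hx ⊢
    rw [dist_comm] at h1
    linarith [dist_triangle x o c]
  refine ⟨hsub, IsGreatest.csSup_eq ⟨⟨sub_pos.2 har, o, hsub (Metric.mem_closedBall_self
    (sub_nonneg.2 har.le)), hsub⟩, ?_⟩⟩
  rintro R ⟨hR, x, -, hxR⟩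
  have := hmin x (r - R) fun c hc => by
    have := dist_add_le_of_closedBall_subset hr hR.le (hxR.trans (by
      rw [hK]; exact Set.iInter₂_subset c hc))
    rw [Metric.mem_closedBall, dist_comm]
    linarith
  linarith

/-! ### Families indexed by three elements, and triads of unit vectors. -/

theorem Fin.sum_three_cyclic {M : Type*} [AddCommMonoid M] (f : Fin 3 → M) (i : Fin 3) :
    ∑ j, f j = f i + f (i + 1) + f (i + 2) := by
  rw [Fin.sum_univ_three]
  fin_cases i
  · rfl
  · change f 0 + f 1 + f 2 = f 1 + f 2 + f 0
    abel
  · change f 0 + f 1 + f 2 = f 2 + f 0 + f 1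
    abel

theorem Fin.ne_add_one_three (i : Fin 3) : i ≠ i + 1 := by decide +revert
theorem Fin.ne_add_two_three (i : Fin 3) : i ≠ i + 2 := by decide +revert
theorem Fin.add_one_ne_add_two_three (i : Fin 3) : i + 1 ≠ i + 2 := by decide +revert
theorem Fin.eq_or_three (i j : Fin 3) : j = i ∨ j = i + 1 ∨ j = i + 2 := by decide +revert

/-- Weights for a family indexed by `Fin 3`. -/
theorem exists_weights_of_mem_convexHull_image {g : Fin 3 → EuclideanPlane}
    {P : Fin 3 → Prop} {x : EuclideanPlane} (h : x ∈ convexHull ℝ (g '' {i | P i})) :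
    ∃ w : Fin 3 → ℝ, (∀ i, 0 ≤ w i) ∧ ∑ i, w i = 1 ∧ (∀ i, w i ≠ 0 → P i) ∧
      ∑ i, w i • g i = x := by
  obtain ⟨w, z, hw, hw1, hz, hs⟩ := exists_weights_of_mem_convexHull h
  choose f hfP hf using hz
  refine ⟨fun i => ∑ k, if f k = i then w k else 0, fun i => Finset.sum_nonneg fun k _ => ?_,
    ?_, fun i hi => ?_, ?_⟩
  · split_ifs
    · exact hw k
    · exact le_rfl
  · rw [Finset.sum_comm]
    simpa using hw1
  · by_contra hP
    refine hi (Finset.sum_eq_zero fun k _ => ?_)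
    rw [if_neg]
    rintro rfl
    exact hP (hfP k)
  · simp_rw [Finset.sum_smul]
    rw [Finset.sum_comm, ← hs]
    refine Finset.sum_congr rfl fun k _ => ?_
    rw [← hf k]
    simp [ite_smul]

/-- Three unit vectors at angles of 120 degrees. -/
structure IsTriad (u : Fin 3 → EuclideanPlane) : Prop where
  norm_eq : ∀ i, ‖u i‖ = 1
  inner_eq : ∀ i j, i ≠ j → inner ℝ (u i) (u j) = -1 / 2

theorem eq_zero_of_inner_eq_zero {a b w : EuclideanPlane} (ha : ‖a‖ = 1) (hb : ‖b‖ = 1)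
    (hab : inner ℝ a b ^ 2 ≠ 1) (h1 : inner ℝ w a = 0) (h2 : inner ℝ w b = 0) : w = 0 := by
  have ha' := norm_sq_eq_coords a
  have hb' := norm_sq_eq_coords b
  rw [ha] at ha'
  rw [hb] at hb'
  rw [inner_eq_coords] at hab h1 h2
  have hdet : a 0 * b 1 - a 1 * b 0 ≠ 0 := by
    intro h
    apply hab
    have : (a 0 * b 0 + a 1 * b 1) ^ 2 + (a 0 * b 1 - a 1 * b 0) ^ 2 =
      (a 0 ^ 2 + a 1 ^ 2) * (b 0 ^ 2 + b 1 ^ 2) := by ring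
    rw [h, ← ha', ← hb'] at this
    linarith
  ext i
  fin_cases i
  · have : w 0 * (a 0 * b 1 - a 1 * b 0) = 0 := by linear_combination b 1 * h1 - a 1 * h2
    simpa using (mul_eq_zero.1 this).resolve_right hdet
  · have : w 1 * (a 0 * b 1 - a 1 * b 0) = 0 := by linear_combination a 0 * h2 - b 0 * h1
    simpa using (mul_eq_zero.1 this).resolve_right hdet

namespace IsTriad

variable {u : Fin 3 → EuclideanPlane} (hu : IsTriad u)
include hu

theorem sum_eq_zero : ∑ i, u i = 0 := by
  rw [← norm_eq_zero, ← sq_eq_zero_iff, ← real_inner_self_eq_norm_sq]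
  simp only [Fin.sum_univ_three, inner_add_left, inner_add_right, real_inner_self_eq_norm_sq,
    hu.norm_eq]
  rw [hu.inner_eq 0 1 (by decide), hu.inner_eq 0 2 (by decide), hu.inner_eq 1 2 (by decide),
    hu.inner_eq 1 0 (by decide), hu.inner_eq 2 0 (by decide), hu.inner_eq 2 1 (by decide)]
  norm_num

theorem sum_inner_eq_zero (v : EuclideanPlane) : ∑ i, inner ℝ v (u i) = 0 := by
  rw [← inner_sum, hu.sum_eq_zero, inner_zero_right]

theorem eq_sum (v : EuclideanPlane) : v = (2 / 3 : ℝ) • ∑ i, inner ℝ v (u i) • u i := by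
  rw [← sub_eq_zero]
  have h := hu.sum_inner_eq_zero v
  rw [Fin.sum_univ_three] at h
  apply eq_zero_of_inner_eq_zero (hu.norm_eq 0) (hu.norm_eq 1)
  · rw [hu.inner_eq 0 1 (by decide)]; norm_num
  · simp only [Fin.sum_univ_three, inner_sub_left, inner_add_left, inner_smul_left,
      real_inner_self_eq_norm_sq, hu.norm_eq, conj_trivial, hu.inner_eq 1 0 (by decide),
      hu.inner_eq 2 0 (by decide)]
    linear_combination (1 / 3) * h
  · simp only [Fin.sum_univ_three, inner_sub_left, inner_add_left, inner_smul_left,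
      real_inner_self_eq_norm_sq, hu.norm_eq, conj_trivial, hu.inner_eq 0 1 (by decide),
      hu.inner_eq 2 1 (by decide)]
    linear_combination (1 / 3) * h

theorem inner_eq_sum (v w : EuclideanPlane) :
    inner ℝ v w = 2 / 3 * ∑ i, inner ℝ v (u i) * inner ℝ w (u i) := by
  conv_lhs => rw [hu.eq_sum v]
  rw [inner_smul_left, sum_inner]
  simp only [inner_smul_left, conj_trivial, real_inner_comm]

theorem norm_sq_eq_sum (v : EuclideanPlane) : ‖v‖ ^ 2 = 2 / 3 * ∑ i, inner ℝ v (u i) ^ 2 := by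
  rw [← real_inner_self_eq_norm_sq, hu.inner_eq_sum]
  simp only [sq]

theorem exists_inner_le (v : EuclideanPlane) : ∃ i, inner ℝ v (u i) ≤ -‖v‖ / 2 := by
  by_contra hc
  push Not at hc
  have h1 := hu.sum_inner_eq_zero v
  have h2 := hu.norm_sq_eq_sum v
  rw [Fin.sum_univ_three] at h1 h2
  have h0 := hc 0
  have h3 := hc 1
  have h4 := hc 2
  have hn := norm_nonneg v
  set n := ‖v‖
  set x := inner ℝ v (u 0)
  set y := inner ℝ v (u 1)
  set z := inner ℝ v (u 2)
  have hz : z = -x - y := by linarith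
  rw [hz] at h2 h4
  -- With `x + y + z = 0` and `n ^ 2 = 2 / 3 * (x ^ 2 + y ^ 2 + z ^ 2)`, these three positive
  -- products sum to `x * y + y * z + z * x + 3 / 4 * n ^ 2 = 0`.
  nlinarith [mul_pos (by linarith : 0 < x + n / 2) (by linarith : 0 < y + n / 2),
    mul_pos (by linarith : 0 < x + n / 2) (by linarith : 0 < -x - y + n / 2),
    mul_pos (by linarith : 0 < y + n / 2) (by linarith : 0 < -x - y + n / 2)]

end IsTriad

/-- Points `v i` at distance `R` and `c i` at distance `a` from the base point, in the directions
of a triad, such that `c i` has distance `r` from `v j` for `j ≠ i`. -/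
structure IsDiskTriangle {G : Geometry} (F : PolarFrame G) (o : Plane G) (r a R : ℝ)
    (u : Fin 3 → EuclideanPlane) (v c : Fin 3 → Plane G) : Prop where
  base : F.M o = 0
  small : G.Small r
  a_pos : 0 < a
  a_lt : a < r
  R_pos : 0 < R
  R_lt : R < r
  triad : IsTriad u
  v_M : ∀ i, F.M (v i) = G.md R
  v_ξ : ∀ i, F.ξ (v i) = G.sn R • u i
  c_M : ∀ i, F.M (c i) = G.md a
  c_ξ : ∀ i, F.ξ (c i) = G.sn a • u i
  md_eq : G.md r = G.md R + G.md a - G.curv * G.md R * G.md a + G.sn R * G.sn a / 2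

/-! ### Consequences of the law of cosines at an angle of 120 degrees. -/

section Trig

variable {G : Geometry} {r a R : ℝ}

/-- The hypothesis `h` is the law of cosines for sides `R` and `a` enclosing 120 degrees with
opposite side `r`; the claim is the strict triangle inequality for it. -/
theorem sub_lt_of_md_eq (hr : G.Small r) (ha : 0 < a) (har : a < r) (hR : 0 < R)
    (h : G.md r = G.md R + G.md a - G.curv * G.md R * G.md a + G.sn R * G.sn a / 2) :
    r - a < R := by
  by_contra hc
  push Not at hc
  have hs : G.Small (r - a) := hr.mono (by linarith)
  have h1 := md_add G (r - a) a
  rw [sub_add_cancel, h] at h1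
  have h2 := md_le_md (G := G) hR.le hc hs.le_pi
  have h3 := sn_le_sn (G := G) (small_neg hR.le) hc hs
  have h4 := sn_pos ha (hr.mono har.le)
  have h5 := sn_pos hR (hs.mono hc)
  have h6 := cs_pos_of_nonneg ha.le (hr.mono har.le)
  rw [cs_eq] at h6
  nlinarith [mul_le_mul_of_nonneg_right h3 h4.le, mul_le_mul_of_nonneg_right h2 h6.le,
    mul_pos h5 h4]

/-- Multiplied by `sn R`, the expression equals `2 * cs r * (md a - md (r - R))`, and `r - R < a`.
It is the slope in `M x` that settles the case `md R < M x` of `dist_lt_or_eq_of_mem_disks`. -/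
theorem two_mul_cs_mul_sn_sub_pos (hr : G.Small r) (ha : 0 < a) (har : a < r) (hR : 0 < R)
    (hRr : R ≤ r)
    (h : G.md r = G.md R + G.md a - G.curv * G.md R * G.md a + G.sn R * G.sn a / 2) :
    0 < 2 * G.cs a * G.sn (r - R) - G.sn a * G.cs (r - R) := by
  have hlt := sub_lt_of_md_eq hr ha har hR h
  have h1 := md_add G R (r - R)
  rw [add_sub_cancel] at h1
  have h2 : G.md (r - R) < G.md a :=
    md_lt_md (by linarith) (by linarith) (hr.mono har.le).le_pi
  have h3 := sn_pos hR (hr.mono hRr)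
  have h4 := cs_pos_of_nonneg (ha.le.trans har.le) hr
  have key : G.sn R * (2 * G.cs a * G.sn (r - R) - G.sn a * G.cs (r - R)) =
      (G.md a - G.md (r - R)) * (2 * G.cs r) := by
    simp only [cs_eq]
    linear_combination (-2 * (1 - G.curv * G.md a)) * h1 + 2 * (1 - G.curv * G.md a) * h +
      (2 * G.curv * (G.md a - G.md (r - R))) * h
  have h5 : 0 < (G.md a - G.md (r - R)) * (2 * G.cs r) :=
    mul_pos (sub_pos.2 h2) (by linarith)
  rw [← key] at h5
  exact pos_of_mul_pos_right h5 h3.le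

/-- The quotient `md / sn` is `t / 2`, `tanh (t / 2)` or `tan (t / 2)`, hence increasing; this is
the form without division. -/
theorem sn_mul_md_le {a a' : ℝ} (ha : 0 ≤ a) (haa : a ≤ a') (h : G.Small a') :
    G.sn a' * G.md a ≤ G.sn a * G.md a' := by
  have h1 := sn_nonneg ha (h.mono haa)
  have h2 := sn_le_sn (G := G) (small_neg ha) haa h
  have h3 := sn_nonneg (sub_nonneg.2 haa) (h.mono (by linarith))
  rw [sn_sub] at h3
  have c1 := cs_pos_of_nonneg ha (h.mono haa)
  have c2 := cs_pos_of_nonneg (ha.trans haa) h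
  have e1 := sn_sq_eq_mul G a
  have e2 := sn_sq_eq_mul G a'
  have h4 : 0 ≤ G.sn a * G.sn a' *
      (G.sn a' * (1 + G.cs a) - G.sn a * (1 + G.cs a')) :=
    mul_nonneg (mul_nonneg h1 (h1.trans h2)) (by linarith)
  have h5 : (G.sn a * G.md a' - G.sn a' * G.md a) * ((1 + G.cs a) * (1 + G.cs a')) =
      G.sn a * G.sn a' * (G.sn a' * (1 + G.cs a) - G.sn a * (1 + G.cs a')) := by
    linear_combination (-G.sn a * (1 + G.cs a)) * e2 + (G.sn a' * (1 + G.cs a')) * e1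
  rw [← h5] at h4
  have := nonneg_of_mul_nonneg_left h4 (by positivity)
  linarith

/-- A disk of radius `r` that contains the base point and whose centre is moved towards the base
point still contains the intersection of the two disks. -/
theorem md_bound_of_le {a a' m t : ℝ} (hr : G.Small r) (ha : 0 < a) (haa : a ≤ a') (har : a' < r)
    (hm : m ≤ G.md r) (h : m * G.cs a' + G.md a' - G.sn a' * t ≤ G.md r) :
    m * G.cs a + G.md a - G.sn a * t ≤ G.md r := by
  have hs : G.Small a' := hr.mono har.le
  have h1 := sn_mul_md_le ha.le haa hs
  have h2 := sn_pos ha (hs.mono haa)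
  have h3 := sn_pos (ha.trans_le haa) hs
  have h4 := sn_nonneg (sub_nonneg.2 haa) (hs.mono (by linarith))
  have h5 := cs_pos_of_nonneg (ha.le.trans (haa.trans har.le)) hr
  have h6 := mul_le_mul_of_nonneg_right hm h4
  have e := sn_sub G a' a
  have h7 : (G.sn a' * G.md a - G.sn a * G.md a') * G.cs r ≤ 0 :=
    mul_nonpos_of_nonpos_of_nonneg (by linarith) h5.le
  have h8 := mul_le_mul_of_nonneg_left h h2.le
  by_contra hc
  push Not at hc
  have h9 := mul_lt_mul_of_pos_left hc h3
  rw [e] at h6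
  simp only [cs_eq] at h6 h7 h8 h9
  linarith

theorem le_md_of_mul_cs_add_le {a m : ℝ} (hr : G.Small r) (ha : 0 ≤ a) (har : a < r)
    (h : m * G.cs a + G.md a ≤ G.md r) : m ≤ G.md r := by
  have h1 := cs_pos_of_nonneg ha (hr.mono har.le)
  have h2 := cs_pos_of_nonneg (ha.trans har.le) hr
  have h3 := mul_nonneg (md_nonneg G a) h2.le
  by_contra hc
  push Not at hc
  have h4 := mul_lt_mul_of_pos_right hc h1
  rw [cs_eq] at h1 h2 h3 h4 h
  linarith

end Trig

/-- The base point is the circumcentre of the vertices. Equal side lengths make the vertex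
directions a triad, and an arc centre equidistant from two vertices lies on the axis through the
third. -/
theorem exists_isDiskTriangle {G : Geometry} {r : ℝ} {T : Set (Plane G)} (hr : G.Small r)
    (hT : IsRegularDiskTriangle r T) :
    ∃ (F : PolarFrame G) (o : Plane G) (a R : ℝ) (u : Fin 3 → EuclideanPlane)
      (v c : Fin 3 → Plane G), IsDiskTriangle F o r a R u v c ∧
        T = ⋂ i, Metric.closedBall (c i) r := by
  obtain ⟨v, c, ⟨s, hs, hvv⟩, hcv, hcv', hTeq⟩ := hT
  have hr0 : 0 < r := dist_nonneg.trans_lt (hcv' 0)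
  have hV : Set.range v ⊆ Metric.closedBall (c 0) r := by
    rintro _ ⟨i, rfl⟩
    rw [Metric.mem_closedBall, dist_comm]
    rcases eq_or_ne 0 i with rfl | hi
    · exact (hcv' 0).le
    · exact (hcv 0 i hi).le
  obtain ⟨o, R, hR0, hRr, hVo, -, hconv⟩ := exists_minimal_enclosing_ball
    (Set.finite_range v).isCompact (Set.range_nonempty v) hr hV
  obtain ⟨F, hF⟩ := exists_polarFrame o
  have hRs := hr.mono hRr
  have hvo : ∀ i, dist (v i) o ≤ R := fun i => hVo ⟨i, rfl⟩
  have himg : F.ξ '' {c ∈ Set.range v | dist c o = R} =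
      (fun i => F.ξ (v i)) '' {i | dist (v i) o = R} := by
    ext x
    constructor
    · rintro ⟨_, ⟨⟨i, rfl⟩, hi⟩, rfl⟩
      exact ⟨i, hi, rfl⟩
    · rintro ⟨i, hi, rfl⟩
      exact ⟨v i, ⟨⟨i, rfl⟩, hi⟩, rfl⟩
  have h0 := hconv F hF
  rw [himg] at h0
  obtain ⟨w, hw, hw1, hwI, hw0⟩ := exists_weights_of_mem_convexHull_image h0
  have hRpos : 0 < R := by
    rcases hR0.eq_or_lt with h | h
    · exfalso
      have h1 := hvv 0 1 (by decide)
      have h2 := dist_triangle_right (v 0) (v 1) o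
      linarith [hvo 0, hvo 1]
    · exact h
  have hsn := sn_pos hRpos hRs
  have hcs := cs_pos_of_nonneg hR0 hRs
  set σ := G.sn R ^ 2 with hσ
  have hσ0 : 0 < σ := by positivity
  set γ := σ - G.md s with hγ
  have hmds : 0 < G.md s := by
    have := md_lt_md (G := G) le_rfl hs (fun e => by
      rw [← hvv 0 1 (by decide)]; exact dist_le_pi e _ _)
    simpa using this
  have hM : ∀ i, w i ≠ 0 → F.M (v i) = G.md R := fun i hi => by rw [F.M_eq hF, hwI i hi]
  have hself : ∀ i, w i ≠ 0 → inner ℝ (F.ξ (v i)) (F.ξ (v i)) = σ := fun i hi => by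
    rw [real_inner_self_eq_norm_sq, F.norm_ξ hF, hwI i hi]
  have hpair : ∀ i j, i ≠ j → w i ≠ 0 → w j ≠ 0 → inner ℝ (F.ξ (v i)) (F.ξ (v j)) = γ := by
    intro i j hij hi hj
    have h1 := F.md_dist (v i) (v j)
    rw [hM i hi, hM j hj, hvv i j hij] at h1
    rw [hγ, hσ, sn_sq]
    linarith
  -- If `w k = 0`, the other two vertices are opposite each other about `o`, so `md s = 2 * σ`. One
  -- of them makes a nonobtuse angle with `v k` at `o`, and then the side from it to `v k` has `md`
  -- at most `σ`.
  have hne : ∀ k, w k ≠ 0 := by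
    intro k hk
    have h1 := Fin.sum_three_cyclic w k
    have h2 := Fin.sum_three_cyclic (fun i => w i • F.ξ (v i)) k
    rw [hw1, hk] at h1
    rw [hw0] at h2
    simp only [hk, zero_smul, zero_add] at h1 h2
    set i := k + 1 with hi
    set j := k + 2 with hj
    have hij : i ≠ j := Fin.add_one_ne_add_two_three k
    have hwi : w i ≠ 0 := by
      intro h
      rw [h] at h1 h2
      have hj0 : w j ≠ 0 := by linarith
      have h3 := congrArg (fun y => inner ℝ y (F.ξ (v j))) h2
      simp only [zero_smul, zero_add, inner_zero_left, inner_smul_left, conj_trivial,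
        hself j hj0] at h3
      have : w j = 1 := by linarith
      rw [this] at h3
      linarith
    have hwj : w j ≠ 0 := by
      intro h
      rw [h] at h1 h2
      have h3 := congrArg (fun y => inner ℝ y (F.ξ (v i))) h2
      simp only [zero_smul, add_zero, inner_zero_left, inner_smul_left, conj_trivial,
        hself i hwi] at h3
      have : w i = 1 := by linarith
      rw [this] at h3
      linarith
    have hi' := congrArg (fun y => inner ℝ y (F.ξ (v i))) h2
    have hj' := congrArg (fun y => inner ℝ y (F.ξ (v j))) h2
    have hk' := congrArg (fun y => inner ℝ y (F.ξ (v k))) h2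
    simp only [inner_zero_left, inner_add_left, inner_smul_left, conj_trivial, hself i hwi,
      hself j hwj, hpair i j hij hwi hwj, hpair j i hij.symm hwj hwi] at hi' hj' hk'
    have hγ' : γ = -σ := by
      have : (w i + w j) * (σ + γ) = 0 := by linear_combination -hi' - hj'
      rw [← h1, one_mul] at this
      linarith
    have hmdσ : G.md s = 2 * σ := by linarith
    have hMk : F.M (v k) ≤ G.md R := by
      rw [F.M_eq hF]
      exact (md_dist_le_iff hR0 hRs.le_pi).2 (hvo k)
    have hstep : ∀ e, k ≠ e → w e ≠ 0 → 0 ≤ inner ℝ (F.ξ (v e)) (F.ξ (v k)) → False := by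
      intro e hke he h3
      have h4 := F.md_dist (v k) (v e)
      rw [hvv k e hke, hM e he, real_inner_comm, hmdσ] at h4
      have h5 : σ = G.md R * (1 + G.cs R) := sn_sq_eq_mul G R
      have h6 := mul_le_mul_of_nonneg_right hMk hcs.le
      rw [cs_eq] at h5 h6
      nlinarith
    rcases le_total 0 (inner ℝ (F.ξ (v i)) (F.ξ (v k))) with h3 | h3
    · exact hstep i (Fin.ne_add_one_three k) hwi h3
    · refine hstep j (Fin.ne_add_two_three k) hwj ?_
      by_contra hc
      push Not at hc
      have p1 := (hw i).lt_of_ne' hwi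
      have p2 := (hw j).lt_of_ne' hwj
      nlinarith [mul_pos_of_neg_of_neg hc (neg_lt_zero.2 p2), mul_nonneg p1.le (neg_nonneg.2 h3)]
  -- The relation `∑ j, w j • ξ (v j) = 0` paired with `ξ (v i)`. Summing over `i` then gives `γ =
  -- -σ / 2`, the angle of 120 degrees.
  have hwγ : ∀ i, w i * (σ - γ) = -γ := by
    intro i
    have h1 := Fin.sum_three_cyclic w i
    have h2 := Fin.sum_three_cyclic (fun i => w i • F.ξ (v i)) i
    rw [hw1] at h1
    rw [hw0] at h2
    have h3 := congrArg (fun y => inner ℝ y (F.ξ (v i))) h2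
    simp only [inner_zero_left, inner_add_left, inner_smul_left, conj_trivial, hself i (hne i),
      hpair (i + 1) i (Fin.ne_add_one_three i).symm (hne _) (hne _),
      hpair (i + 2) i (Fin.ne_add_two_three i).symm (hne _) (hne _)] at h3
    linear_combination -h3 + γ * h1
  have hγσ : γ = -σ / 2 := by
    have h1 := hwγ 0
    have h2 := hwγ 1
    have h3 := hwγ 2
    rw [Fin.sum_univ_three] at hw1
    have h4 : (w 0 + w 1 + w 2) * (σ - γ) = -3 * γ := by linear_combination h1 + h2 + h3
    rw [hw1] at h4
    linarith
  set u : Fin 3 → EuclideanPlane := fun i => (G.sn R)⁻¹ • F.ξ (v i) with hu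
  have hξu : ∀ i, F.ξ (v i) = G.sn R • u i := fun i => by
    rw [hu]; simp only [smul_smul, mul_inv_cancel₀ hsn.ne', one_smul]
  have htri : IsTriad u := by
    constructor
    · intro i
      rw [hu]
      simp only [norm_smul, norm_inv, Real.norm_eq_abs, abs_of_pos hsn]
      rw [F.norm_ξ hF, hwI i (hne i), inv_mul_cancel₀ hsn.ne']
    · intro i j hij
      rw [hu]
      simp only [inner_smul_left, inner_smul_right, conj_trivial]
      rw [hpair i j hij (hne i) (hne j), hγσ, hσ]
      field_simp
  -- Equal distances to the two other vertices put `c i` on the axis of `u i`. It is on the positive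
  -- side because `v i` is strictly closer to it than they are.
  have hcu : ∀ i, F.ξ (c i) = inner ℝ (F.ξ (c i)) (u i) • u i ∧ 0 < inner ℝ (F.ξ (c i)) (u i) ∧
      G.md r = F.M (c i) * G.cs R + G.md R + G.sn R * inner ℝ (F.ξ (c i)) (u i) / 2 := by
    intro i
    have n1 := Fin.ne_add_one_three i
    have n2 := Fin.ne_add_two_three i
    have d0 := F.md_dist_polar_right (c i) (hM i (hne i)) (hξu i)
    have d1 := F.md_dist_polar_right (c i) (hM (i + 1) (hne _)) (hξu _)
    have d2 := F.md_dist_polar_right (c i) (hM (i + 2) (hne _)) (hξu _)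
    rw [hcv _ _ n1] at d1
    rw [hcv _ _ n2] at d2
    have d0' := (md_dist_lt_iff hr0.le hr.le_pi).2 (hcv' i)
    rw [d0] at d0'
    have hsum := htri.sum_inner_eq_zero (F.ξ (c i))
    have hrep := htri.eq_sum (F.ξ (c i))
    have hu0 := htri.sum_eq_zero
    rw [Fin.sum_three_cyclic _ i] at hsum hrep hu0
    have e12 : inner ℝ (F.ξ (c i)) (u (i + 1)) = inner ℝ (F.ξ (c i)) (u (i + 2)) :=
      mul_left_cancel₀ hsn.ne' (by linarith)
    have e1 : inner ℝ (F.ξ (c i)) (u (i + 1)) = -inner ℝ (F.ξ (c i)) (u i) / 2 := by linarith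
    refine ⟨?_, ?_, ?_⟩
    · have hu2 : u (i + 2) = -(u i) - u (i + 1) := by
        rw [← sub_eq_zero, ← hu0]; abel
      rw [← e12, e1, hu2] at hrep
      rw [hrep]
      set y := inner ℝ (F.ξ (c i)) (u i)
      have : (2 / 3 : ℝ) • (y • u i + (-y / 2) • u (i + 1) + (-y / 2) • (-u i - u (i + 1))) =
          y • u i := by module
      rw [this, inner_smul_left, real_inner_self_eq_norm_sq, htri.norm_eq]
      simp
    · by_contra hc
      push Not at hc
      rw [e1] at d1
      nlinarith
    · rw [d1, e1]; ring
  have hcM : ∀ i, F.M (c i) = G.md (dist (c i) o) := fun i => F.M_eq hF _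
  have hcn : ∀ i, inner ℝ (F.ξ (c i)) (u i) = G.sn (dist (c i) o) := by
    intro i
    obtain ⟨h1, h2, -⟩ := hcu i
    rw [← F.norm_ξ hF, h1, norm_smul, htri.norm_eq, mul_one, inner_smul_left,
      real_inner_self_eq_norm_sq, htri.norm_eq, Real.norm_eq_abs, abs_of_pos h2]
    simp
  have heq : ∀ i, G.md r = G.md (dist (c i) o) * G.cs R + G.md R +
      G.sn R * G.sn (dist (c i) o) / 2 := by
    intro i
    have := (hcu i).2.2
    rwa [hcn, hcM] at this
  have hcsr := cs_pos_of_nonneg hr0.le hr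
  have hapos : ∀ i, 0 < dist (c i) o := by
    intro i
    apply (dist_nonneg (x := c i) (y := o)).lt_of_ne'
    intro h
    have := (hcu i).2.1
    rw [hcn, h, sn_zero] at this
    exact lt_irrefl _ this
  have hasm : ∀ i, G.Small (dist (c i) o) := by
    intro i hG
    apply cs_anti_of_curv_nonneg hG dist_nonneg _ (dist_le_pi hG _ _)
    have h1 := heq i
    have h2 : 0 < G.sn (dist (c i) o) := by rw [← hcn]; exact (hcu i).2.1
    rw [cs_eq] at hcsr hcs h1
    have hk : G.curv = 1 := by subst hG; rfl
    rw [hk] at h1 hcsr hcs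
    rw [cs_eq, hk]
    by_contra hc
    push Not at hc
    nlinarith [mul_pos hsn h2, mul_nonneg hcs.le (neg_nonneg.2 hc)]
  -- All three distances solve the same law of cosines, whose right-hand side is strictly increasing
  -- in the distance.
  have haeq : ∀ i, dist (c i) o = dist (c 0) o := by
    have hmono : ∀ i j, ¬ dist (c i) o < dist (c j) o := by
      intro i j hlt
      have h1 := heq i
      have h2 := heq j
      have h3 := md_lt_md (G := G) dist_nonneg hlt (hasm j).le_pi
      have h4 := sn_le_sn (G := G) (small_neg dist_nonneg) hlt.le (hasm j)
      nlinarith [mul_lt_mul_of_pos_right h3 hcs, mul_le_mul_of_nonneg_left h4 hsn.le]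
    intro i
    exact le_antisymm (not_lt.1 (hmono 0 i)) (not_lt.1 (hmono i 0))
  set a := dist (c 0) o with ha
  have hmdeq : G.md r = G.md R + G.md a - G.curv * G.md R * G.md a + G.sn R * G.sn a / 2 := by
    rw [heq 0, cs_eq]; ring
  have hsna : 0 < G.sn a := sn_pos (hapos 0) (hasm 0)
  have hcsa := cs_pos_of_nonneg (hapos 0).le (hasm 0)
  refine ⟨F, o, a, R, u, v, c, ⟨hF, hr, hapos 0, ?_, hRpos, ?_, htri, fun i => hM i (hne i), hξu,
    fun i => by rw [hcM, haeq], fun i => by rw [(hcu i).1, hcn, haeq], hmdeq⟩, hTeq⟩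
  · by_contra hc
    push Not at hc
    have h1 := md_le_md (G := G) hr0.le hc (hasm 0).le_pi
    have h2 := md_nonneg G R
    rw [cs_eq] at hcsa
    nlinarith [mul_pos hsn hsna, mul_nonneg h2 hcsa.le]
  · by_contra hc
    push Not at hc
    have h1 := md_le_md (G := G) hr0.le hc hRs.le_pi
    have h2 := md_nonneg G a
    rw [cs_eq] at hcs
    nlinarith [mul_pos hsn hsna, mul_nonneg h2 hcs.le]

/-- The third side of a triangle with angle 120 degrees and one side `b` increases with the other
side. On the sphere the inequality `h'` itself first forces `s < π / 2`, where `md` and `sn` are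
both monotone. -/
theorem le_of_md_mul_cs_add_le {G : Geometry} {r b s t : ℝ} (hr : G.Small r) (hr0 : 0 ≤ r)
    (hb : 0 < b) (hbs : G.Small b) (hs : 0 ≤ s) (hsπ : G = .spherical → s ≤ Real.pi)
    (hsn : 0 ≤ G.sn s) (ht : 0 ≤ t) (h : G.md r = G.md t * G.cs b + G.md b + G.sn b * G.sn t / 2)
    (h' : G.md s * G.cs b + G.md b + G.sn b * G.sn s / 2 ≤ G.md r) : s ≤ t := by
  have hb1 := cs_pos_of_nonneg hb.le hbs
  have hb2 := sn_pos hb hbs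
  have hss : G.Small s := by
    intro hG
    apply cs_anti_of_curv_nonneg hG hs _ (hsπ hG)
    have h1 := cs_pos_of_nonneg hr0 hr
    rw [cs_eq] at h1 hb1 h'
    have hk : G.curv = 1 := by subst hG; rfl
    rw [hk] at h1 h' hb1
    rw [cs_eq, hk]
    by_contra hc
    push Not at hc
    nlinarith [mul_nonneg hb2.le hsn, mul_nonneg hb1.le (neg_nonneg.2 hc)]
  by_contra hc
  push Not at hc
  have h3 := md_lt_md (G := G) ht hc hss.le_pi
  have h4 := sn_le_sn (G := G) (small_neg ht) hc.le hss
  nlinarith [mul_lt_mul_of_pos_right h3 hb1, mul_le_mul_of_nonneg_left h4 hb2.le]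

theorem Fin.univ_eq_of_ne_three {i j k : Fin 3} (hij : i ≠ j) (hik : i ≠ k) (hjk : j ≠ k) :
    (Finset.univ : Finset (Fin 3)) = {i, j, k} := by
  decide +revert

theorem IsTriad.eq_smul_of_inner_eq {u : Fin 3 → EuclideanPlane} (hu : IsTriad u) {i j k : Fin 3}
    (hij : i ≠ j) (hik : i ≠ k) (hjk : j ≠ k) {x : EuclideanPlane}
    (h : inner ℝ x (u i) = inner ℝ x (u k)) :
    x = inner ℝ x (u j) • u j ∧ inner ℝ x (u i) = -inner ℝ x (u j) / 2 := by
  have hsum := hu.sum_inner_eq_zero x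
  rw [Fin.univ_eq_of_ne_three hij hik hjk, Finset.sum_insert (by simp [hij, hik]), Finset.sum_pair hjk] at hsum
  have e : inner ℝ x (u i) = -inner ℝ x (u j) / 2 := by linarith
  refine ⟨?_, e⟩
  rw [← sub_eq_zero]
  apply eq_zero_of_inner_eq_zero (hu.norm_eq i) (hu.norm_eq j)
  · rw [hu.inner_eq i j hij]; norm_num
  · rw [inner_sub_left, inner_smul_left, hu.inner_eq j i hij.symm, e]
    simp only [conj_trivial]
    ring
  · rw [inner_sub_left, inner_smul_left, real_inner_self_eq_norm_sq, hu.norm_eq]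
    simp

/-! ### Distances in a disk triangle, and the normals of its supporting lines. -/

namespace IsDiskTriangle

variable {G : Geometry} {F : PolarFrame G} {o : Plane G} {r a R : ℝ}
  {u : Fin 3 → EuclideanPlane} {v c : Fin 3 → Plane G}

section
variable (h : IsDiskTriangle F o r a R u v c)
include h

theorem r_pos : 0 < r := h.a_pos.trans h.a_lt
theorem small_a : G.Small a := h.small.mono h.a_lt.le
theorem small_R : G.Small R := h.small.mono h.R_lt.le
theorem sn_a_pos : 0 < G.sn a := sn_pos h.a_pos h.small_a
theorem sn_R_pos : 0 < G.sn R := sn_pos h.R_pos h.small_R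
theorem cs_a_pos : 0 < G.cs a := cs_pos_of_nonneg h.a_pos.le h.small_a
theorem cs_R_pos : 0 < G.cs R := cs_pos_of_nonneg h.R_pos.le h.small_R
theorem cs_r_pos : 0 < G.cs r := cs_pos_of_nonneg h.r_pos.le h.small
theorem sn_r_pos : 0 < G.sn r := sn_pos h.r_pos h.small

theorem md_dist_c (x : Plane G) (i : Fin 3) : G.md (dist x (c i)) =
    F.M x * G.cs a + G.md a - G.sn a * inner ℝ (F.ξ x) (u i) :=
  F.md_dist_polar_right x (h.c_M i) (h.c_ξ i)

theorem md_dist_v (x : Plane G) (i : Fin 3) : G.md (dist x (v i)) =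
    F.M x * G.cs R + G.md R - G.sn R * inner ℝ (F.ξ x) (u i) :=
  F.md_dist_polar_right x (h.v_M i) (h.v_ξ i)

theorem dist_le_r_iff {x y : Plane G} : dist x y ≤ r ↔ G.md (dist x y) ≤ G.md r :=
  (md_dist_le_iff h.r_pos.le h.small.le_pi).symm

theorem dist_c_base (i : Fin 3) : dist (c i) o = a := by
  apply (md_dist_eq_iff h.a_pos.le h.small_a.le_pi).1
  rw [← F.M_eq h.base, h.c_M]

theorem dist_v_c {i j : Fin 3} (hij : i ≠ j) : dist (v i) (c j) = r := by
  apply (md_dist_eq_iff h.r_pos.le h.small.le_pi).1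
  rw [h.md_dist_c, h.v_M, h.v_ξ, inner_smul_left, h.triad.inner_eq i j hij, h.md_eq, cs_eq]
  simp only [conj_trivial]
  ring

theorem dist_v_c_self (i : Fin 3) : dist (v i) (c i) = |a - R| := by
  rcases le_total R a with hRa | hRa
  · rw [abs_of_nonneg (sub_nonneg.2 hRa)]
    exact F.dist_same_ray (h.triad.norm_eq i) h.R_pos.le hRa h.small_a.le_pi (h.v_M i) (h.v_ξ i)
      (h.c_M i) (h.c_ξ i)
  · rw [abs_sub_comm, abs_of_nonneg (sub_nonneg.2 hRa), dist_comm]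
    exact F.dist_same_ray (h.triad.norm_eq i) h.a_pos.le hRa h.small_R.le_pi (h.c_M i) (h.c_ξ i)
      (h.v_M i) (h.v_ξ i)

theorem abs_sub_lt : |a - R| < r := by
  rw [abs_lt]
  constructor <;> linarith [h.a_pos, h.R_pos, h.a_lt, h.R_lt]

theorem v_mem (i : Fin 3) : v i ∈ ⋂ j, Metric.closedBall (c j) r := by
  refine Set.mem_iInter.2 fun j => ?_
  rw [Metric.mem_closedBall]
  rcases eq_or_ne i j with rfl | hij
  · rw [h.dist_v_c_self]; exact h.abs_sub_lt.le
  · exact (h.dist_v_c hij).le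

theorem le_dist_v_v {i j : Fin 3} (hij : i ≠ j) (hRa : R ≤ a) : r - a + R ≤ dist (v i) (v j) := by
  have h1 := dist_triangle (v i) (v j) (c j)
  rw [h.dist_v_c hij, h.dist_v_c_self, abs_of_nonneg (sub_nonneg.2 hRa)] at h1
  linarith

theorem dist_v_v_le {i j : Fin 3} (hij : i ≠ j) (hRa : R ≤ a) : dist (v i) (v j) ≤ r := by
  apply h.dist_le_r_iff.2
  rw [h.md_dist_v, h.v_M, h.v_ξ, inner_smul_left, h.triad.inner_eq i j hij, h.md_eq]
  have h1 := md_le_md (G := G) h.R_pos.le hRa h.small_a.le_pi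
  have h2 := sn_le_sn (G := G) (small_neg h.R_pos.le) hRa h.small_a
  have h3 := h.cs_R_pos
  have h4 := mul_le_mul_of_nonneg_left h2 h.sn_R_pos.le
  have h5 := mul_le_mul_of_nonneg_right h1 h3.le
  simp only [conj_trivial]
  rw [cs_eq] at h5 ⊢
  linarith

theorem dist_c_c_lt {i j : Fin 3} (hij : i ≠ j) (hRa : a < R) : dist (c i) (c j) < r := by
  apply (md_dist_lt_iff h.r_pos.le h.small.le_pi).1
  rw [h.md_dist_c, h.c_M, h.c_ξ, inner_smul_left, h.triad.inner_eq i j hij, h.md_eq]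
  have h1 := md_lt_md (G := G) h.a_pos.le hRa h.small_R.le_pi
  have h2 := sn_le_sn (G := G) (small_neg h.a_pos.le) hRa.le h.small_R
  have h3 := h.cs_a_pos
  have h4 := mul_le_mul_of_nonneg_left h2 h.sn_a_pos.le
  have h5 := mul_lt_mul_of_pos_right h1 h3
  simp only [conj_trivial]
  rw [cs_eq] at h5 ⊢
  linarith

theorem dist_c_c_eq {i j k l : Fin 3} (hij : i ≠ j) (hkl : k ≠ l) :
    dist (c i) (c j) = dist (c k) (c l) := by
  apply (md_dist_eq_iff dist_nonneg (fun e => dist_le_pi e _ _)).1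
  rw [h.md_dist_c, h.md_dist_c, h.c_M, h.c_ξ, h.c_M, h.c_ξ, inner_smul_left, inner_smul_left,
    h.triad.inner_eq i j hij, h.triad.inner_eq k l hkl]

/-- Equidistance from `c i` and `c k` puts `x` on the axis of `u j`, and membership in the third
disk selects its positive half. There the distance from `o` is determined by monotonicity. -/
theorem eq_v_of_dist_eq {i j k : Fin 3} (hij : i ≠ j) (hik : i ≠ k) (hjk : j ≠ k) {x : Plane G}
    (hi : dist x (c i) = r) (hk : dist x (c k) = r) (hj : dist x (c j) ≤ r) : x = v j := by
  have di := h.md_dist_c x i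
  have dk := h.md_dist_c x k
  have dj := h.md_dist_c x j
  rw [hi] at di
  rw [hk] at dk
  have hsa := h.sn_a_pos
  obtain ⟨hx, hxi⟩ := h.triad.eq_smul_of_inner_eq hij hik hjk (x := F.ξ x)
    (mul_left_cancel₀ hsa.ne' (by linarith))
  have hj' := h.dist_le_r_iff.1 hj
  have ht : 0 ≤ inner ℝ (F.ξ x) (u j) := by
    rw [hxi] at di
    by_contra hc
    push Not at hc
    nlinarith
  have hn : inner ℝ (F.ξ x) (u j) = G.sn (dist x o) := by
    rw [← F.norm_ξ h.base]
    conv_rhs => rw [hx, norm_smul, h.triad.norm_eq, mul_one, Real.norm_eq_abs, abs_of_nonneg ht]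
  rw [hn] at hx hxi
  rw [hxi, F.M_eq h.base] at di
  have e : dist x o = R := by
    have hm : G.md r = G.md R * G.cs a + G.md a + G.sn a * G.sn R / 2 := by
      rw [h.md_eq, cs_eq]; ring
    apply le_antisymm
    · exact le_of_md_mul_cs_add_le h.small h.r_pos.le h.a_pos h.small_a dist_nonneg
        (fun e => dist_le_pi e _ _) (sn_dist_nonneg _ _) h.R_pos.le hm (by linarith)
    · exact le_of_md_mul_cs_add_le h.small h.r_pos.le h.a_pos h.small_a h.R_pos.le
        h.small_R.le_pi h.sn_R_pos.le dist_nonneg (by linarith) hm.ge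
  apply F.ext_point
  · rw [F.M_eq h.base, e, h.v_M]
  · rw [hx, e, h.v_ξ]

/-- The line `⟪B, ·⟫ = 0` through a boundary point supports the disk triangle only if `B` is in
the cone spanned by the directions of those centres that have distance `r`. -/
theorem exists_cone_of_supports {l : OrientedLine G}
    (hl : Supports l (⋂ j, Metric.closedBall (c j) r)) :
    ∃ (E : PolarFrame G) (p : Plane G) (B : EuclideanPlane) (e : Fin 3 → EuclideanPlane)
      (μ : Fin 3 → ℝ), E.M p = 0 ∧ p ∈ ⋂ j, Metric.closedBall (c j) r ∧ ‖B‖ = 1 ∧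
      (∀ x, nline G l x = inner ℝ B (E.ξ x)) ∧ (∀ m, E.ξ (c m) = G.sn r • e m) ∧
      (∀ m, 0 ≤ μ m) ∧ (∀ m, μ m ≠ 0 → dist (c m) p = r) ∧ B = ∑ m, μ m • e m := by
  obtain ⟨hlT, p, hpT, hp⟩ := hl
  obtain ⟨E, hE⟩ := exists_polarFrame p
  obtain ⟨A, B, hAB, hf⟩ := E.nline_eq l
  have hA : A = 0 := by
    have := hf p
    rw [hE, E.ξ_base hE, mem_linePoints_iff.1 hp] at this
    simpa using this.symm
  subst hA
  have hB : ‖B‖ = 1 := by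
    have : ‖B‖ ^ 2 = 1 ^ 2 := by linarith
    exact (pow_left_inj₀ (norm_nonneg _) one_pos.le two_ne_zero).1 this
  simp only [zero_mul, zero_add] at hf
  have hpd : ∀ m, dist (c m) p ≤ r := fun m => by
    rw [dist_comm]; exact Set.mem_iInter.1 hpT m
  have hsr := h.sn_r_pos
  set S : Set EuclideanPlane := (fun m => E.ξ (c m)) '' {m | dist (c m) p = r} with hS
  have hSfin : S.Finite := (Set.toFinite _).image _
  -- Otherwise some direction `η` leads from `p` into the triangle, being towards all centres at
  -- distance `r`, and strictly to the negative side of the line.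
  have h0 : (0 : EuclideanPlane) ∈ convexHull ℝ (insert (-B) S) := by
    by_contra hcon
    obtain ⟨η, hη, hpos⟩ := exists_inner_pos_of_zero_notMem_convexHull
      (hSfin.insert (-B)).isCompact hcon
    have hBη := hpos (-B) (Set.mem_insert _ _)
    rw [inner_neg_left] at hBη
    have hev : ∀ᶠ t in nhds (0 : ℝ), ∀ m, 0 < t → t < 1 →
        E.M (c m) * G.cs t + G.md t - G.sn t * inner ℝ (E.ξ (c m)) η ≤ G.md r := by
      rw [Filter.eventually_all]
      intro m
      rcases (hpd m).eq_or_lt with hm | hm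
      · have hI := hpos (E.ξ (c m)) (Set.mem_insert_of_mem _ ⟨m, hm, rfl⟩)
        have hlim : Filter.Tendsto G.sn (nhds 0) (nhds 0) := by
          simpa using (continuous_sn G).tendsto 0
        filter_upwards [((hlim.mul_const (G.cs r)).eventually_lt_const
          (by simpa using hI) : ∀ᶠ t in nhds 0, G.sn t * G.cs r < inner ℝ (E.ξ (c m)) η)]
          with t ht ht0 ht1
        have hsm1 : G.Small t := fun _ => by linarith [Real.pi_gt_three]
        have hcs := cs_pos_of_nonneg ht0.le hsm1
        have hsn := sn_pos ht0 hsm1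
        have hmd : G.md t ≤ G.sn t ^ 2 := by
          rw [sn_sq_eq_mul]
          nlinarith [md_nonneg G t]
        have h3 := mul_le_mul_of_nonneg_right hmd h.cs_r_pos.le
        have h4 := mul_lt_mul_of_pos_left ht hsn
        rw [E.M_eq hE, hm]
        simp only [cs_eq] at h3 h4 ⊢
        linarith
      · have hcon : Continuous fun t : ℝ =>
            E.M (c m) * G.cs t + G.md t - G.sn t * inner ℝ (E.ξ (c m)) η :=
          ((continuous_const.mul (continuous_cs G)).add (continuous_md G)).sub
            ((continuous_sn G).mul continuous_const)
        have hlt : E.M (c m) < G.md r := by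
          rw [E.M_eq hE]
          exact (md_dist_lt_iff h.r_pos.le h.small.le_pi).2 hm
        filter_upwards [hcon.continuousAt.eventually_lt (x₀ := (0 : ℝ))
          (continuousAt_const (y := G.md r)) (by simpa using hlt)] with t ht _ _
        exact ht.le
    obtain ⟨ε, hε, hball⟩ := Metric.eventually_nhds_iff.1 hev
    obtain ⟨t, ht0, ht⟩ := exists_between (lt_min hε one_pos)
    have ht1 := ht.trans_le (min_le_right _ _)
    obtain ⟨y, hM', hξ', -⟩ := E.exists_polar hE (s := t) ht0.le (fun _ => by
      linarith [Real.pi_gt_three]) hη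
    have hyT : y ∈ ⋂ j, Metric.closedBall (c j) r := by
      refine Set.mem_iInter.2 fun m => ?_
      rw [Metric.mem_closedBall, dist_comm]
      apply h.dist_le_r_iff.2
      rw [E.md_dist_polar_right _ hM' hξ']
      refine hball ?_ m ht0 ht1
      rw [Real.dist_eq, sub_zero, abs_of_pos ht0]
      exact ht.trans_le (min_le_left _ _)
    have h1 := mem_halfPlane_iff.1 (hlT hyT)
    rw [hf, hξ', inner_smul_right] at h1
    have h2 := sn_pos ht0 (G := G) (fun _ => by linarith [Real.pi_gt_three])
    nlinarith
  -- The active centres all lie on the side of `o` as seen from `p`. So the origin is not in the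
  -- hull of `S` alone, and `-B` has a positive coefficient in `h0`.
  have ho : ∀ y ∈ convexHull ℝ S, 0 < inner ℝ y (E.ξ o) := by
    have hconv : Convex ℝ {y : EuclideanPlane | 0 < inner ℝ y (E.ξ o)} := by
      intro x hx y hy s t hs ht hst
      simp only [Set.mem_ofPred_eq, inner_add_left, inner_smul_left, conj_trivial] at hx hy ⊢
      rcases hs.eq_or_lt with rfl | hs
      · have : t = 1 := by linarith
        subst this
        simpa using hy
      · have := mul_pos hs hx
        have := mul_nonneg ht hy.le
        linarith
    refine fun y hy => convexHull_min ?_ hconv hy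
    rintro _ ⟨m, hm, rfl⟩
    have h1 := E.md_dist (c m) o
    have hm' : dist (c m) p = r := hm
    rw [h.dist_c_base, E.M_eq hE (c m), hm'] at h1
    have h2 := md_lt_md h.a_pos.le h.a_lt h.small.le_pi
    have h3 := mul_nonneg (E.M_nonneg o) h.cs_r_pos.le
    rw [cs_eq] at h3
    simp only [Set.mem_ofPred_eq]
    linarith
  have hB0 : B ≠ 0 := fun e => by simp [e] at hB
  rcases S.eq_empty_or_nonempty with hSe | hSne
  · rw [hSe] at h0
    simp only [insert_empty_eq, convexHull_singleton, Set.mem_singleton_iff] at h0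
    exact absurd (neg_eq_zero.1 h0.symm) hB0
  rw [convexHull_insert hSne, mem_convexJoin] at h0
  obtain ⟨x, hx, y, hy, s, t, hs, ht, hst, hsum⟩ := h0
  rw [Set.mem_singleton_iff] at hx
  subst hx
  have hs0 : s ≠ 0 := by
    rintro rfl
    have : t = 1 := by linarith
    subst this
    have h1 := ho y hy
    simp only [zero_smul, one_smul, zero_add] at hsum
    rw [hsum] at h1
    simp at h1
  obtain ⟨w, hw, -, hwP, hwy⟩ := exists_weights_of_mem_convexHull_image
    (g := fun m => E.ξ (c m)) (P := fun m => dist (c m) p = r) hy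
  refine ⟨E, p, B, fun m => (G.sn r)⁻¹ • E.ξ (c m), fun m => t / s * w m * G.sn r, hE, hpT, hB, hf,
    fun m => by rw [smul_smul, mul_inv_cancel₀ hsr.ne', one_smul],
    fun m => mul_nonneg (mul_nonneg (div_nonneg ht hs) (hw m)) hsr.le, fun m hm => hwP m ?_, ?_⟩
  · rintro e
    simp [e] at hm
  · have h1 : s • B = t • y := by
      rw [smul_neg, neg_add_eq_zero] at hsum
      exact hsum
    have h2 : B = (t / s) • y := by
      rw [div_eq_inv_mul, ← smul_smul, ← h1, smul_smul, inv_mul_cancel₀ hs0, one_smul]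
    rw [h2, ← hwy, Finset.smul_sum]
    refine Finset.sum_congr rfl fun m _ => ?_
    rw [smul_smul, smul_smul]
    congr 1
    field_simp

end
end IsDiskTriangle

/-- Coordinates are taken with `e = (1, 0)`, `e' = (g, s)`. The expressions in `c1`, `c2`, `c3` are
the sines of the angles from `B` to `e'`, from `f` to `B` and from `f` to `e'`. Their signs say that
the vectors come in the order `e`, `f`, `B`, `e'`. -/
theorem inner_le_of_between_aux {g s f₁ f₂ B₁ B₂ μ ν : ℝ} (he : g ^ 2 + s ^ 2 = 1)
    (hf : f₁ ^ 2 + f₂ ^ 2 = 1) (hB : B₁ ^ 2 + B₂ ^ 2 = 1) (hμ : 0 ≤ μ) (hν : 0 ≤ ν)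
    (h₁ : B₁ = μ * g + ν) (h₂ : B₂ = μ * s) (hs : 0 < s) (hf₂ : 0 ≤ f₂) (hBf : B₁ ≤ f₁) :
    g * f₁ + s * f₂ ≤ B₁ * f₁ + B₂ * f₂ := by
  have hB₂ : 0 ≤ B₂ := h₂ ▸ mul_nonneg hμ hs.le
  have c1 : 0 ≤ B₁ * s - B₂ * g := by
    have : B₁ * s - B₂ * g = ν * s := by rw [h₁, h₂]; ring
    rw [this]; positivity
  have c2 : 0 ≤ f₁ * B₂ - f₂ * B₁ := by
    have hsq : (f₁ * B₂) ^ 2 - (f₂ * B₁) ^ 2 = f₁ ^ 2 - B₁ ^ 2 := by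
      linear_combination f₁ ^ 2 * hB - B₁ ^ 2 * hf
    rcases le_total 0 B₁ with h | h
    · have h3 : f₂ * B₁ ≤ f₁ * B₂ := by
        apply le_of_sq_le_sq _ (mul_nonneg (h.trans hBf) hB₂)
        nlinarith
      linarith
    · rcases le_total 0 f₁ with h' | h'
      · nlinarith [mul_nonneg h' hB₂, mul_nonneg hf₂ (neg_nonneg.2 h)]
      · have h3 : -f₁ * B₂ ≤ f₂ * -B₁ := by
          apply le_of_sq_le_sq _ (mul_nonneg hf₂ (neg_nonneg.2 h))
          nlinarith
        linarith
  rcases hB₂.eq_or_lt with h0 | h0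
  · have hμ0 : μ = 0 := by
      rcases mul_eq_zero.1 (h₂.symm.trans h0.symm) with h | h
      · exact h
      · exact absurd h hs.ne'
    rw [hμ0] at h₁
    have hB1 : B₁ = 1 := by
      rw [← h0] at hB
      nlinarith
    have : f₁ = 1 := by nlinarith
    have hf0 : f₂ = 0 := by nlinarith
    rw [this, hf0, hB1]
    nlinarith
  have c3 : 0 ≤ f₁ * s - f₂ * g := by
    have h3 : B₂ * (f₁ * s - f₂ * g) = s * (f₁ * B₂ - f₂ * B₁) + f₂ * (B₁ * s - B₂ * g) := by ring
    have h4 : 0 ≤ B₂ * (f₁ * s - f₂ * g) := by rw [h3]; positivity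
    exact nonneg_of_mul_nonneg_right h4 h0
  have c4 : 0 < 1 + (B₁ * g + B₂ * s) := by
    have h3 : 0 < (B₁ + g) ^ 2 + (B₂ + s) ^ 2 := by positivity
    nlinarith
  -- A sum-to-product formula cleared of half angles; it reduces the comparison to the signs above.
  have key : (1 + (B₁ * g + B₂ * s)) * ((B₁ * f₁ + B₂ * f₂) - (g * f₁ + s * f₂)) =
      (B₁ * s - B₂ * g) * ((f₁ * B₂ - f₂ * B₁) + (f₁ * s - f₂ * g)) := by
    linear_combination (-(B₁ * f₁ + B₂ * f₂)) * he + (g * f₁ + s * f₂) * hB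
  have h5 : 0 ≤ (1 + (B₁ * g + B₂ * s)) * ((B₁ * f₁ + B₂ * f₂) - (g * f₁ + s * f₂)) := by
    rw [key]; positivity
  have := nonneg_of_mul_nonneg_right h5 c4
  linarith

/-- If `B` lies between the unit vectors `f` and `e'`, then it encloses a smaller angle with `f`
than `e'` does. -/
theorem inner_le_of_between {e e' f B : EuclideanPlane} (he : ‖e‖ = 1) (he' : ‖e'‖ = 1)
    (hf : ‖f‖ = 1) (hB : ‖B‖ = 1) {μ ν : ℝ} (hμ : 0 ≤ μ) (hν : 0 ≤ ν) (hBe : B = μ • e' + ν • e)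
    (h1 : inner ℝ B e ≤ inner ℝ f e) (h2 : inner ℝ f e * inner ℝ e e' ≤ inner ℝ f e') :
    inner ℝ e' f ≤ inner ℝ B f := by
  have lag : ∀ x y : EuclideanPlane, inner ℝ x y = inner ℝ x e * inner ℝ y e +
      (x 0 * e 1 - x 1 * e 0) * (y 0 * e 1 - y 1 * e 0) := by
    intro x y
    have h := norm_sq_eq_coords e
    rw [he] at h
    simp only [inner_eq_coords]
    linear_combination (x 0 * y 0 + x 1 * y 1) * h
  have nrm : ∀ x : EuclideanPlane, ‖x‖ = 1 → inner ℝ x e ^ 2 + (x 0 * e 1 - x 1 * e 0) ^ 2 = 1 := by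
    intro x hx
    have := lag x x
    rw [real_inner_self_eq_norm_sq, hx] at this
    linarith
  have n1 := nrm e' he'
  have n2 := nrm f hf
  have n3 := nrm B hB
  have b1 : inner ℝ B e = μ * inner ℝ e' e + ν := by
    rw [hBe, inner_add_left, inner_smul_left, inner_smul_left, real_inner_self_eq_norm_sq, he]
    simp
  have b2 : B 0 * e 1 - B 1 * e 0 = μ * (e' 0 * e 1 - e' 1 * e 0) := by
    rw [hBe]
    simp
    ring
  have h3 := lag f e'
  rw [lag e' f, lag B f]
  rw [h3, real_inner_comm e' e] at h2
  set g := inner ℝ e' e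
  set s := e' 0 * e 1 - e' 1 * e 0
  set f₁ := inner ℝ f e
  set f₂ := f 0 * e 1 - f 1 * e 0
  set B₁ := inner ℝ B e
  set B₂ := B 0 * e 1 - B 1 * e 0
  have hfs : 0 ≤ f₂ * s := by linarith
  rcases lt_trichotomy s 0 with hs | hs | hs
  · have := inner_le_of_between_aux (s := -s) (f₂ := -f₂) (B₂ := -B₂) (by linarith) (by linarith)
      (by linarith) hμ hν b1 (by rw [b2]; ring) (neg_pos.2 hs) (by nlinarith) h1
    linarith
  · rw [hs, mul_zero] at b2
    rw [hs] at n1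
    rw [b2] at n3
    rw [hs, b2]
    have hg : g = 1 ∨ g = -1 := by
      rw [← sq_eq_one_iff]; linarith
    have hB1 : B₁ = 1 ∨ B₁ = -1 := by
      rw [← sq_eq_one_iff]; linarith
    have hf1 : f₁ ≤ 1 := by nlinarith [sq_nonneg f₂]
    rcases hg with hg | hg <;> rcases hB1 with hb | hb <;> rw [hg] at b1 ⊢ <;> rw [hb] at b1 h1 ⊢ <;>
      nlinarith
  · exact inner_le_of_between_aux n1 n2 n3 hμ hν b1 b2 hs (nonneg_of_mul_nonneg_left hfs hs) h1

/-! ### Lower bounds for the heights over supporting lines of a disk triangle. -/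

namespace IsDiskTriangle

variable {G : Geometry} {F : PolarFrame G} {o : Plane G} {r a R : ℝ}
  {u : Fin 3 → EuclideanPlane} {v c : Fin 3 → Plane G}

/-- A supporting line is tangent to one of the three disks, or it passes through a vertex. -/
theorem supports_cases (h : IsDiskTriangle F o r a R u v c) {l : OrientedLine G}
    (hl : Supports l (⋂ j, Metric.closedBall (c j) r)) :
    ∃ (E : PolarFrame G) (p : Plane G) (B : EuclideanPlane), E.M p = 0 ∧ ‖B‖ = 1 ∧
      (∀ x, nline G l x = inner ℝ B (E.ξ x)) ∧
      ((∃ i, dist (c i) p = r ∧ E.ξ (c i) = G.sn r • B) ∨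
       ∃ (i j k : Fin 3) (e e' : EuclideanPlane) (μ ν : ℝ), i ≠ j ∧ i ≠ k ∧ j ≠ k ∧ p = v j ∧
        ‖e‖ = 1 ∧ ‖e'‖ = 1 ∧ E.ξ (c i) = G.sn r • e ∧ E.ξ (c k) = G.sn r • e' ∧ 0 ≤ μ ∧ 0 ≤ ν ∧
        B = μ • e + ν • e') := by
  obtain ⟨E, p, B, e, μ, hE, hpT, hB, hf, he, hμ, hμP, hsum⟩ := h.exists_cone_of_supports hl
  refine ⟨E, p, B, hE, hB, hf, ?_⟩
  have hnorm : ∀ m, dist (c m) p = r → ‖e m‖ = 1 := by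
    intro m hm
    have h1 := E.norm_ξ hE (c m)
    rw [he, hm, norm_smul, Real.norm_eq_abs, abs_of_pos h.sn_r_pos] at h1
    exact mul_left_cancel₀ h.sn_r_pos.ne' (by rw [h1, mul_one])
  by_cases h2 : ∃ i k, i ≠ k ∧ μ i ≠ 0 ∧ μ k ≠ 0
  · right
    obtain ⟨i, k, hik, hi, hk⟩ := h2
    obtain ⟨j, hij, hjk⟩ : ∃ j, i ≠ j ∧ j ≠ k := by
      clear hi hk; decide +revert
    have hpv : p = v j := by
      refine h.eq_v_of_dist_eq hij hik hjk ?_ ?_ (Set.mem_iInter.1 hpT j)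
      · rw [dist_comm]; exact hμP i hi
      · rw [dist_comm]; exact hμP k hk
    have hj : μ j = 0 := by
      by_contra hj
      have h3 := hμP j hj
      rw [hpv, dist_comm, h.dist_v_c_self] at h3
      exact absurd h.abs_sub_lt (by rw [h3]; exact lt_irrefl _)
    refine ⟨i, j, k, e i, e k, μ i, μ k, hij, hik, hjk, hpv, hnorm i (hμP i hi),
      hnorm k (hμP k hk), he i, he k, hμ i, hμ k, ?_⟩
    rw [hsum, Fin.univ_eq_of_ne_three hij hik hjk, Finset.sum_insert (by simp [hij, hik]),
      Finset.sum_pair hjk, hj, zero_smul, zero_add]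
  · left
    push Not at h2
    obtain ⟨i, hi⟩ : ∃ i, μ i ≠ 0 := by
      by_contra hc
      push Not at hc
      simp only [hc, zero_smul, Finset.sum_const_zero] at hsum
      simp [hsum] at hB
    have hBi : B = μ i • e i := by
      rw [hsum]
      refine Finset.sum_eq_single i (fun k _ hk => ?_) (by simp)
      rw [h2 i k hk.symm hi, zero_smul]
    have hi1 : μ i = 1 := by
      rw [hBi, norm_smul, hnorm i (hμP i hi), mul_one, Real.norm_eq_abs, abs_of_nonneg (hμ i)] at hB
      exact hB
    exact ⟨i, hμP i hi, by rw [he, hBi, hi1, one_smul]⟩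

/-- Over a line tangent to the disk about `c i`, the opposite vertex `v i` is high enough. Over a
line through a vertex, either the point at distance `r - a + R` along the normal or one of the other
two vertices is. -/
theorem exists_le_nline (h : IsDiskTriangle F o r a R u v c) (hRa : R ≤ a) {l : OrientedLine G}
    (hl : Supports l (⋂ j, Metric.closedBall (c j) r)) :
    ∃ x ∈ ⋂ j, Metric.closedBall (c j) r, G.sn (r - a + R) ≤ nline G l x := by
  obtain ⟨E, p, B, hE, hB, hf, ⟨i, hi, hci⟩ | ⟨i, j, k, e, e', μ, ν, hij, hik, hjk, hp, he, he', hci,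
    hck, hμ, hν, hBe⟩⟩ := h.supports_cases hl
  · refine ⟨v i, h.v_mem i, ?_⟩
    have h1 : nline G l (c i) = G.sn r := by
      rw [hf, hci, inner_smul_right, real_inner_self_eq_norm_sq, hB]; simp
    have h2 := (nline_bounds l h.small (small_neg h.r_pos.le) h1 (v i)).1
    rw [h.dist_v_c_self, abs_of_nonneg (sub_nonneg.2 hRa)] at h2
    convert h2 using 2
    ring
  set D := r - a + R with hD
  have hD0 : 0 < D := by linarith [h.a_lt, h.R_pos]
  have hDr : D ≤ r := by linarith
  have hDs : G.Small D := h.small.mono hDr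
  have hsD := sn_pos hD0 hDs
  have hsr := h.sn_r_pos
  have hcr := h.cs_r_pos
  have hdp : ∀ {m : Fin 3}, m ≠ j → dist (c m) p = r := fun {m} hm => by
    rw [hp, dist_comm, h.dist_v_c hm.symm]
  -- The candidate has height exactly `D`. It lies in the disk about `c j` by the triangle
  -- inequality, since `D + (a - R) = r`; only the disks about `c i` and `c k` can fail to contain
  -- it.
  obtain ⟨x, hxM, hxξ, hxp⟩ := E.exists_polar hE hD0.le hDs.le_pi hB
  have hEM : ∀ {m : Fin 3}, m ≠ j → E.M (c m) = G.md r := fun {m} hm => by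
    rw [E.M_eq hE, hdp hm]
  have hxc : ∀ {m : Fin 3} {w : EuclideanPlane}, m ≠ j → E.ξ (c m) = G.sn r • w →
      G.md D * G.cs r ≤ G.sn D * G.sn r * inner ℝ B w → dist x (c m) ≤ r := by
    intro m w hm hw hle
    apply h.dist_le_r_iff.2
    rw [E.md_dist_polar hxM hxξ (hEM hm) hw]
    rw [cs_eq] at hle
    linarith
  -- If the candidate leaves the disk about `c k`, the vertex `v i` on that circle takes over. Its
  -- direction `f` from `p` encloses with `B` an angle no larger than with `e`, and already over the
  -- tangent line with normal `e` its height is at least `D`.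
  have key : ∀ (i k : Fin 3) (e e' : EuclideanPlane) (μ ν : ℝ), i ≠ j → i ≠ k → j ≠ k →
      ‖e‖ = 1 → ‖e'‖ = 1 → E.ξ (c i) = G.sn r • e → E.ξ (c k) = G.sn r • e' → 0 ≤ μ → 0 ≤ ν →
      B = μ • e + ν • e' → G.sn D * G.sn r * inner ℝ B e' < G.md D * G.cs r →
      G.sn D ≤ nline G l (v i) := by
    intro i k e e' μ ν hij hik hjk he he' hci hck hμ hν hBe hlt
    set t := dist (v i) p with ht
    have htr : t ≤ r := by rw [ht, hp]; exact h.dist_v_v_le hij hRa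
    have hDt : D ≤ t := by rw [ht, hp]; exact h.le_dist_v_v hij hRa
    have hts : G.Small t := h.small.mono htr
    have ht0 : 0 < t := hD0.trans_le hDt
    have hst := sn_pos ht0 hts
    obtain ⟨f, hf1, hvf⟩ := exists_unit_smul (E.ξ (v i))
    rw [E.norm_ξ hE, ← ht] at hvf
    have hvM : E.M (v i) = G.md t := E.M_eq hE _
    have e1 := E.md_dist_polar hvM hvf (hEM hjk.symm) hck
    rw [h.dist_v_c hik] at e1
    have e2 := E.md_dist_polar hvM hvf (hEM hij) hci
    rw [h.dist_v_c_self, abs_of_nonneg (sub_nonneg.2 hRa), show a - R = r - D by rw [hD]; ring,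
      md_sub] at e2
    have q1 : G.sn t * G.sn r * inner ℝ f e' = G.md t * G.cs r := by rw [cs_eq]; linarith
    have q2 : G.sn t * G.sn r * inner ℝ f e =
        (G.md t - G.md D) * G.cs r + G.sn r * G.sn D := by rw [cs_eq]; linarith
    have hmd : G.md D ≤ G.md t := md_le_md hD0.le hDt hts.le_pi
    have q3 : G.sn D * G.sn r ≤ G.sn t * G.sn r * inner ℝ f e := by
      rw [q2]
      nlinarith [mul_nonneg (sub_nonneg.2 hmd) hcr.le]
    have hfe' : 0 ≤ inner ℝ f e' := by
      have : 0 ≤ G.sn t * G.sn r * inner ℝ f e' := by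
        rw [q1]; exact mul_nonneg (md_nonneg G t) hcr.le
      exact nonneg_of_mul_nonneg_right this (mul_pos hst hsr)
    have hfe : inner ℝ f e' ≤ inner ℝ f e := by
      have h5 : G.md r - (G.md r + G.md D - G.curv * G.md r * G.md D - G.sn r * G.sn D) ≥ 0 := by
        rw [← md_sub]
        have := md_le_md (G := G) (sub_nonneg.2 hDr) (by linarith : r - D ≤ r) h.small.le_pi
        linarith
      have : G.sn t * G.sn r * inner ℝ f e' ≤ G.sn t * G.sn r * inner ℝ f e := by
        rw [q1, q2]
        rw [cs_eq]
        linarith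
      exact le_of_mul_le_mul_left this (mul_pos hst hsr)
    -- At a point of the circle about `c k` at distance `t` from `p`, the cosine to `e'` is
    -- proportional to `md t / sn t`, which increases with `t`; here `D ≤ t`.
    have hBf : inner ℝ B e' ≤ inner ℝ f e' := by
      have h6 := sn_mul_md_le hD0.le hDt hts
      have h7 := mul_le_mul_of_nonneg_right h6 hcr.le
      have h8 := mul_lt_mul_of_pos_left hlt hst
      have h9 : G.sn D * (G.sn t * G.sn r * inner ℝ f e') = G.sn D * (G.md t * G.cs r) := by
        rw [q1]
      have : G.sn t * G.sn D * G.sn r * inner ℝ B e' ≤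
          G.sn t * G.sn D * G.sn r * inner ℝ f e' := by linarith
      exact le_of_mul_le_mul_left this (by positivity)
    have hle := inner_le_of_between he' he hf1 hB hμ hν hBe hBf (by
      have : inner ℝ e' e ≤ 1 := by
        have := (abs_le.1 (abs_inner_unit_le he' e)).2
        rwa [he] at this
      nlinarith)
    rw [hf, hvf, inner_smul_right]
    have h10 : G.sn D * G.sn r ≤ G.sn t * inner ℝ B f * G.sn r := by
      refine q3.trans ?_
      rw [real_inner_comm e f]
      have := mul_le_mul_of_nonneg_left hle (mul_pos hst hsr).le
      linarith
    exact le_of_mul_le_mul_right h10 hsr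
  by_cases h1 : G.md D * G.cs r ≤ G.sn D * G.sn r * inner ℝ B e
  · by_cases h2 : G.md D * G.cs r ≤ G.sn D * G.sn r * inner ℝ B e'
    · refine ⟨x, Set.mem_iInter.2 fun m => ?_, ?_⟩
      · rw [Metric.mem_closedBall]
        have hm : m = i ∨ m = j ∨ m = k := by
          have := Finset.mem_univ m
          rw [Fin.univ_eq_of_ne_three hij hik hjk] at this
          simpa using this
        rcases hm with rfl | rfl | rfl
        · exact hxc hij hci h1
        · have h3 := dist_triangle x (v m) (c m)
          rw [← hp, hxp, hp, h.dist_v_c_self, abs_of_nonneg (sub_nonneg.2 hRa)] at h3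
          linarith
        · exact hxc hjk.symm hck h2
      · rw [hf, hxξ, inner_smul_right, real_inner_self_eq_norm_sq, hB]
        simp
    · exact ⟨v i, h.v_mem i, key i k e e' μ ν hij hik hjk he he' hci hck hμ hν hBe (not_le.1 h2)⟩
  · exact ⟨v k, h.v_mem k, key k i e' e ν μ hjk.symm hik.symm hij.symm he' he hck hci hν hμ
      (by rw [hBe, add_comm]) (not_le.1 h1)⟩

/-- For `a < R` the arc centres are at mutual distances less than `r`. Prolonging a radius from the
contact point beyond its centre by `δ` therefore stays in all three disks. -/
theorem exists_le_nline_of_lt (h : IsDiskTriangle F o r a R u v c) (haR : a < R) {δ : ℝ}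
    (hδ0 : 0 < δ) (hδs : G.Small (r + δ)) (hδ : dist (c 0) (c 1) + δ ≤ r) {l : OrientedLine G}
    (hl : Supports l (⋂ j, Metric.closedBall (c j) r)) :
    ∃ x ∈ ⋂ j, Metric.closedBall (c j) r, G.sn (r + δ) ≤ nline G l x := by
  have hcc : ∀ {i j : Fin 3}, i ≠ j → dist (c i) (c j) + δ ≤ r := fun {i j} hij => by
    rw [h.dist_c_c_eq hij (by decide : (0 : Fin 3) ≠ 1)]; exact hδ
  obtain ⟨E, p, B, hE, hB, hf, hcases⟩ := h.supports_cases hl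
  have hrδ : 0 ≤ r + δ := by linarith [h.r_pos]
  obtain ⟨y, hyM, hyξ, hyp⟩ := E.exists_polar hE hrδ hδs.le_pi hB
  refine ⟨y, Set.mem_iInter.2 fun m => ?_, ?_⟩
  swap
  · rw [hf, hyξ, inner_smul_right, real_inner_self_eq_norm_sq, hB]
    simp
  rw [Metric.mem_closedBall]
  have hextend : ∀ {i : Fin 3} {w : EuclideanPlane} {z : Plane G}, ‖w‖ = 1 → E.M (c i) = G.md r →
      E.ξ (c i) = G.sn r • w → E.M z = G.md (r + δ) → E.ξ z = G.sn (r + δ) • w →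
      ∀ m, dist z (c m) ≤ r := by
    intro i w z hw hM hξ hzM hzξ m
    have h1 := E.dist_same_ray hw h.r_pos.le (by linarith) hδs.le_pi hM hξ hzM hzξ
    rcases eq_or_ne i m with rfl | him
    · rw [dist_comm, h1]
      linarith [@dist_nonneg _ _ (c 0) (c 1)]
    · have := dist_triangle z (c i) (c m)
      rw [dist_comm z (c i), h1] at this
      linarith [hcc him]
  rcases hcases with ⟨i, hi, hci⟩ | ⟨i, j, k, e, e', μ, ν, hij, hik, hjk, hp, he, he', hci, hck, hμ,
    hν, hBe⟩
  · exact hextend hB (by rw [E.M_eq hE, hi]) hci hyM hyξ m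
  have hEM : ∀ {m : Fin 3}, m ≠ j → E.M (c m) = G.md r := fun {m} hm => by
    rw [E.M_eq hE, hp, dist_comm, h.dist_v_c hm.symm]
  obtain ⟨z, hzM, hzξ, -⟩ := E.exists_polar hE hrδ hδs.le_pi he
  obtain ⟨z', hzM', hzξ', -⟩ := E.exists_polar hE hrδ hδs.le_pi he'
  have hz := hextend he (hEM hij) hci hzM hzξ
  have hz' := hextend he' (hEM hjk.symm) hck hzM' hzξ'
  have hsr := h.sn_r_pos
  have hsδ := sn_pos (by linarith [h.r_pos]) hδs
  have hck' : E.M (c k) = G.md r := hEM hjk.symm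
  have hci' : E.M (c i) = G.md r := hEM hij
  have hμν : 1 ≤ μ + ν := by
    rw [hBe] at hB
    have := norm_add_le (μ • e) (ν • e')
    rw [hB, norm_smul, norm_smul, he, he', Real.norm_eq_abs, Real.norm_eq_abs, abs_of_nonneg hμ,
      abs_of_nonneg hν] at this
    linarith
  have hg : 0 < inner ℝ e e' := by
    have h1 := E.md_dist_polar hci' hci hck' hck
    have h2 := (md_dist_lt_iff h.r_pos.le h.small.le_pi).2 (h.dist_c_c_lt hik haR)
    rw [h1] at h2
    have h3 := md_nonneg G r
    have h4 := mul_nonneg h3 h.cs_r_pos.le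
    rw [cs_eq] at h4
    have : 0 < G.sn r * G.sn r * inner ℝ e e' := by linarith
    exact pos_of_mul_pos_right this (by positivity)
  -- Among points at distance `r + δ` from `p`, a larger inner product with `ξ (c m)` means a
  -- smaller distance to `c m`. So `y` is compared with the prolonged radii `z` and `z'`, using `μ +
  -- ν ≥ 1`.
  have hdc : ∀ {x x' : Plane G} {w w' : EuclideanPlane}, E.M x = G.md (r + δ) →
      E.ξ x = G.sn (r + δ) • w → E.M x' = G.md (r + δ) → E.ξ x' = G.sn (r + δ) • w' →
      inner ℝ w' (E.ξ (c m)) ≤ inner ℝ w (E.ξ (c m)) → dist x' (c m) ≤ r → dist x (c m) ≤ r := by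
    intro x x' w w' hM hξ hM' hξ' hle hx'
    apply h.dist_le_r_iff.2
    refine le_trans ?_ (h.dist_le_r_iff.1 hx')
    rw [E.md_dist, E.md_dist, hM, hξ, hM', hξ', inner_smul_left, inner_smul_left]
    have := mul_le_mul_of_nonneg_left hle hsδ.le
    simp only [conj_trivial]
    linarith
  have hm : m = i ∨ m = j ∨ m = k := by
    have := Finset.mem_univ m
    rw [Fin.univ_eq_of_ne_three hij hik hjk] at this
    simpa using this
  have hge : inner ℝ e e' ≤ 1 := by
    have := (abs_le.1 (abs_inner_unit_le he e')).2
    rwa [he'] at this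
  rcases hm with rfl | rfl | rfl
  · refine hdc hyM hyξ hzM' hzξ' ?_ (hz' m)
    rw [hci, inner_smul_right, inner_smul_right]
    apply mul_le_mul_of_nonneg_left _ hsr.le
    rw [hBe, inner_add_left, inner_smul_left, inner_smul_left, real_inner_self_eq_norm_sq, he,
      real_inner_comm]
    simp only [conj_trivial]
    nlinarith
  · refine hdc hyM hyξ hzM hzξ ?_ (hz m)
    have hvc := h.dist_c_c_lt hij haR
    have pos : 0 ≤ inner ℝ e (E.ξ (c m)) := by
      have h1 := E.md_dist_polar_right (c m) hci' hci
      rw [dist_comm] at h1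
      have h2 := (md_dist_lt_iff h.r_pos.le h.small.le_pi).2 hvc
      rw [h1, real_inner_comm] at h2
      have h3 := mul_nonneg (E.M_nonneg (c m)) h.cs_r_pos.le
      have : 0 < G.sn r * inner ℝ e (E.ξ (c m)) := by linarith
      exact (pos_of_mul_pos_right this hsr.le).le
    have heq : inner ℝ e' (E.ξ (c m)) = inner ℝ e (E.ξ (c m)) := by
      have h1 := E.md_dist_polar_right (c m) hci' hci
      have h2 := E.md_dist_polar_right (c m) hck' hck
      rw [h.dist_c_c_eq hij.symm hjk] at h1
      rw [h1, real_inner_comm, real_inner_comm e'] at h2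
      exact mul_left_cancel₀ hsr.ne' (by linarith)
    rw [hBe, inner_add_left, inner_smul_left, inner_smul_left, heq]
    simp only [conj_trivial]
    nlinarith
  · refine hdc hyM hyξ hzM hzξ ?_ (hz m)
    rw [hck, inner_smul_right, inner_smul_right]
    apply mul_le_mul_of_nonneg_left _ hsr.le
    rw [hBe, inner_add_left, inner_smul_left, inner_smul_left, real_inner_self_eq_norm_sq, he']
    simp only [conj_trivial]
    nlinarith

end IsDiskTriangle

/-! ### The covering disk opposite to a direction of largest weight. -/

/-- Let `q` be the point at distance `r - R` from the base point opposite to the direction `u i`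
of largest weight.  Then the disk of radius `r` about `q` contains the intersection of the disks
of radius `r` about the points at distance `a` in the directions `u j`. -/
theorem dist_lt_or_eq_of_mem_disks {G : Geometry} {F : PolarFrame G} {o x q : Plane G}
    {r a R : ℝ} (hF : F.M o = 0) (hr : G.Small r) (ha : 0 < a) (har : a < r) (hR : 0 < R)
    (hRr : R < r)
    (heq : G.md r = G.md R + G.md a - G.curv * G.md R * G.md a + G.sn R * G.sn a / 2)
    {u : Fin 3 → EuclideanPlane} {w : Fin 3 → ℝ} {i : Fin 3} (hu : ‖u i‖ = 1)
    (hw : ∀ j, 0 ≤ w j) (hw1 : ∑ j, w j = 1) (hwu : ∑ j, w j • u j = 0) (hmax : ∀ j, w j ≤ w i)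
    (hx : ∀ j, F.M x * G.cs a + G.md a - G.sn a * inner ℝ (F.ξ x) (u j) ≤ G.md r)
    (hqM : F.M q = G.md (r - R)) (hqξ : F.ξ q = G.sn (r - R) • -u i) :
    dist x q < r ∨
      (dist x q = r ∧ w i = 1 / 3 ∧ F.M x = G.md R ∧ F.ξ x = G.sn R • u i) := by
  have hr0 : 0 < r := ha.trans har
  have hRs := hr.mono hRr.le
  have hsa := sn_pos ha (hr.mono har.le)
  have hsR := sn_pos hR hRs
  have hbs : G.Small (r - R) := hr.mono (by linarith)
  have hsb := sn_pos (sub_pos.2 hRr) hbs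
  have hd := F.md_dist_polar_right x hqM hqξ
  rw [inner_neg_right] at hd
  have hslope := two_mul_cs_mul_sn_sub_pos hr ha har hR hRr.le heq
  have hb := md_add G R (r - R)
  rw [add_sub_cancel] at hb
  have hsum : ∑ j, w j * inner ℝ (F.ξ x) (u j) = 0 := by
    have h1 : inner ℝ (F.ξ x) (∑ j, w j • u j) = 0 := by rw [hwu, inner_zero_right]
    simpa only [inner_sum, inner_smul_right] using h1
  rw [Fin.sum_three_cyclic _ i] at hsum hw1
  have hi3 : 1 / 3 ≤ w i := by linarith [hmax (i + 1), hmax (i + 2)]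
  have hx0 := hx i
  have hx1 := hx (i + 1)
  have hx2 := hx (i + 2)
  set t := inner ℝ (F.ξ x) (u i)
  set t₁ := inner ℝ (F.ξ x) (u (i + 1))
  set t₂ := inner ℝ (F.ξ x) (u (i + 2))
  set Y := F.M x * G.cs a + G.md a - G.md r with hY
  -- Each disk says `Y ≤ sn a * ⟪ξ x, u j⟫`, and the weighted sum of the right-hand sides vanishes.
  have hY0 : Y ≤ 0 := by
    have h0 := mul_le_mul_of_nonneg_left (show Y ≤ G.sn a * t by linarith) (hw i)
    have h1 := mul_le_mul_of_nonneg_left (show Y ≤ G.sn a * t₁ by linarith) (hw (i + 1))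
    have h2 := mul_le_mul_of_nonneg_left (show Y ≤ G.sn a * t₂ by linarith) (hw (i + 2))
    have h3 : G.sn a * (w i * t + w (i + 1) * t₁ + w (i + 2) * t₂) = 0 := by rw [hsum, mul_zero]
    have h4 : Y * (w i + w (i + 1) + w (i + 2)) = Y := by rw [hw1, mul_one]
    linarith
  have ht : w i * (G.sn a * t) ≤ -(1 - w i) * Y := by
    have h1 := mul_le_mul_of_nonneg_left (show Y ≤ G.sn a * t₁ by linarith) (hw (i + 1))
    have h2 := mul_le_mul_of_nonneg_left (show Y ≤ G.sn a * t₂ by linarith) (hw (i + 2))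
    have h3 : G.sn a * (w i * t + w (i + 1) * t₁ + w (i + 2) * t₂) = 0 := by rw [hsum, mul_zero]
    have h4 : Y * (w i + w (i + 1) + w (i + 2)) = Y := by rw [hw1, mul_one]
    linarith
  -- From `ht`, because `1 - w i ≤ 2 * w i` when `w i ≥ 1 / 3`. With this bound inserted, the
  -- distance to `q` is controlled by `M x` alone.
  have ht2 : G.sn a * t ≤ -2 * Y := by
    have h1 : w i * (G.sn a * t) ≤ w i * (-2 * Y) := by nlinarith
    exact le_of_mul_le_mul_left h1 (by linarith)
  rcases lt_trichotomy (F.M x) (G.md R) with hM | hM | hM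
  · left
    have h1 : dist x o < R := by
      apply (md_dist_lt_iff hR.le hRs.le_pi).1
      rwa [← F.M_eq hF]
    have h2 : dist o q = r - R := by
      rw [dist_comm]
      apply (md_dist_eq_iff (sub_pos.2 hRr).le hbs.le_pi).1
      rw [← F.M_eq hF, hqM]
    linarith [dist_triangle x o q]
  · have hYR : Y = -(G.sn R * G.sn a / 2) := by
      rw [hY, hM, heq, cs_eq]; ring
    rcases hi3.eq_or_lt with hi | hi
    · rw [hM] at hd
      have hle : t ≤ G.sn R := by
        rw [hYR] at ht2
        have : G.sn a * t ≤ G.sn a * G.sn R := by linarith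
        exact le_of_mul_le_mul_left this hsa
      rcases hle.eq_or_lt with h1 | h1
      · right
        refine ⟨?_, hi.symm, hM, ?_⟩
        · apply (md_dist_eq_iff hr0.le hr.le_pi).1
          rw [hd, h1, hb, cs_eq]
          ring
        · have h2 : ‖F.ξ x‖ = G.sn R := by
            rw [F.norm_ξ hF]
            have : dist x o = R := by
              apply (md_dist_eq_iff hR.le hRs.le_pi).1
              rw [← F.M_eq hF, hM]
            rw [this]
          rw [← sub_eq_zero, ← norm_eq_zero, ← sq_eq_zero_iff, norm_sub_sq_real, norm_smul, hu,
            inner_smul_right, h2, Real.norm_eq_abs, abs_of_pos hsR]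
          change G.sn R ^ 2 - 2 * (G.sn R * t) + (G.sn R * 1) ^ 2 = 0
          rw [h1]
          ring
      · left
        apply (md_dist_lt_iff hr0.le hr.le_pi).1
        rw [hd, hb, cs_eq]
        have := mul_lt_mul_of_pos_left h1 hsb
        linarith
    · left
      have hYneg : Y < 0 := by
        rw [hYR]
        have := mul_pos hsR hsa
        linarith
      have h1 : w i * (G.sn a * t) < w i * (-2 * Y) := by nlinarith
      have h2 := lt_of_mul_lt_mul_left h1 (by linarith)
      rw [hYR] at h2
      have h3 : G.sn a * t < G.sn a * G.sn R := by linarith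
      have h4 := lt_of_mul_lt_mul_left h3 hsa.le
      apply (md_dist_lt_iff hr0.le hr.le_pi).1
      rw [hd, hM, hb, cs_eq]
      have := mul_lt_mul_of_pos_left h4 hsb
      linarith
  -- The bound on `md (dist x q)` is affine in `M x`, equals `md r` at `md R`, and decreases by
  -- `hslope`.
  · left
    apply (md_dist_lt_iff hr0.le hr.le_pi).1
    rw [hd]
    have h1 := mul_lt_mul_of_pos_left (sub_pos.2 hM) hslope
    have h2 := mul_le_mul_of_nonneg_left ht2 hsb.le
    have h3 : G.sn a * (F.M x * G.cs (r - R) + G.md (r - R) + G.sn (r - R) * t - G.md r) < 0 := by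
      have e1 : G.sn a * (G.md R * G.cs (r - R) + G.md (r - R) - G.md r) =
          2 * G.sn (r - R) * (G.md R * G.cs a + G.md a - G.md r) := by
        have e2 : G.md R * G.cs (r - R) + G.md (r - R) - G.md r = -(G.sn R * G.sn (r - R)) := by
          rw [cs_eq]; linarith
        have e3 : G.md R * G.cs a + G.md a - G.md r = -(G.sn R * G.sn a / 2) := by
          rw [heq, cs_eq]; ring
        rw [e2, e3]
        ring
      rw [hY] at h2
      nlinarith
    have h4 := neg_of_mul_neg_right h3 hsa.le
    linarith

/-! ### The disk triangle as the `r`-ball hull of its vertices. -/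

/-- The algebraic core of `IsDiskTriangle.subset_closedBall`. -/
theorem hull_inequality {κ m n mR ma ρ sR sa cR ca cr l₁ l₂ y₁ y₂ : ℝ}
    (hcR : cR = 1 - κ * mR) (hca : ca = 1 - κ * ma) (hcr : cr = 1 - κ * ρ)
    (hsa2 : sa ^ 2 = ma * (1 + ca)) (hsR : 0 < sR) (hsa : 0 < sa) (hcR0 : 0 < cR) (hca0 : 0 < ca) (hcr0 : 0 < cr)
    (hl₁ : 0 ≤ l₁) (hl₂ : 0 ≤ l₂) (hmR : mR < ρ) (hma : 0 < ma) (hρ : 0 < ρ)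
    (hm : m ≤ mR) (hn0 : 0 ≤ n) (hn : n ≤ ma)
    (heq : ρ = mR + ma - κ * mR * ma + sR * sa / 2)
    (hI1 : (ρ - ma + cr * mR) * cR = sa * sR / 2 + cr * sR ^ 2)
    (hI2 : (ρ - ma + cr * mR) * ca + sa ^ 2 + cr * sR * sa / 2 = ρ * (1 + cr))
    (hv₁ : n * cR + mR - sR * y₁ ≤ ρ) (hv₂ : n * cR + mR - sR * y₂ ≤ ρ)
    (hxk : m * ca + ma + sa * sR * (l₁ + l₂) / 2 ≤ ρ)
    (hck : 0 ≤ n * ca + ma + sa * (y₁ + y₂))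
    (hxv₁ : 0 ≤ m * cR + mR - sR * (sR * (l₁ - l₂ / 2)))
    (hxv₂ : 0 ≤ m * cR + mR - sR * (sR * (l₂ - l₁ / 2))) :
    m + n - κ * m * n - sR * (l₁ * y₁ + l₂ * y₂) ≤ ρ := by
  have b₁ := mul_le_mul_of_nonneg_left hv₁ hl₁
  have b₂ := mul_le_mul_of_nonneg_left hv₂ hl₂
  -- The vertex constraints weighted by `l₁` and `l₂` remove `y₁` and `y₂`. The remaining bound is
  -- affine in `n`, and `hHa` gives its sign at `n = ma`.
  have hH : m + n - κ * m * n - sR * (l₁ * y₁ + l₂ * y₂) - ρ ≤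
      (m - (l₁ + l₂) * mR) * (1 - κ * n) + (1 - (l₁ + l₂)) * (n - ρ) := by
    subst hcR
    linarith
  have hHa : (m - (l₁ + l₂) * mR) * ca + (1 - (l₁ + l₂)) * (ma - ρ) ≤ 0 := by
    have : (m - (l₁ + l₂) * mR) * ca + (1 - (l₁ + l₂)) * (ma - ρ) =
        m * ca + ma + sa * sR * (l₁ + l₂) / 2 - ρ := by
      subst hca
      linear_combination (l₁ + l₂) * heq
    linarith
  rw [hca] at hHa
  -- Here the bound is nonpositive at `n = 0` as well, hence in between. For larger sums a
  -- nonnegative slope in `n` would suffice.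
  by_cases hl : l₁ + l₂ ≤ 1
  · have h0 : m - (l₁ + l₂) * mR - (1 - (l₁ + l₂)) * ρ ≤ 0 := by
      have := mul_le_mul_of_nonneg_left hmR.le (sub_nonneg.2 hl)
      linarith
    have h1 := mul_nonpos_of_nonneg_of_nonpos (sub_nonneg.2 hn) h0
    have h2 := mul_nonpos_of_nonneg_of_nonpos hn0 hHa
    have h3 : ma * ((m - (l₁ + l₂) * mR) * (1 - κ * n) + (1 - (l₁ + l₂)) * (n - ρ)) ≤ 0 := by
      linarith
    have := nonpos_of_mul_nonpos_right h3 hma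
    linarith
  push Not at hl
  by_cases hslope : 0 ≤ 1 - κ * m - (l₁ + l₂) * cR
  · have h1 := mul_nonneg hslope (sub_nonneg.2 hn)
    subst hcR
    linarith
  push Not at hslope
  -- For negative slope a third constraint `hck` is added, which is tight at `c' = c k` like the two
  -- vertex constraints. The multiplier `Γ` is chosen so that the coefficient of `n - ma` in `key`
  -- vanishes.
  obtain ⟨Γ, hΓ⟩ : ∃ Γ, Γ * (sR * ca + 2 * sa * cR) = 1 - κ * m - (l₁ + l₂) * cR :=
    ⟨(1 - κ * m - (l₁ + l₂) * cR) / (sR * ca + 2 * sa * cR), by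
      field_simp⟩
  have hΓ0 : Γ < 0 := by
    have h1 : 0 < sR * ca + 2 * sa * cR := by positivity
    rw [← hΓ] at hslope
    exact neg_of_mul_neg_left hslope h1.le
  have hA : Γ * sR * (ρ * (1 + cr)) < 0 :=
    mul_neg_of_neg_of_pos (mul_neg_of_neg_of_pos hΓ0 hsR) (by positivity)
  have hB : 0 < cr * (3 / 2) * sR ^ 2 := by positivity
  -- The right-hand side of `hg` is the slack of `x` in the disk about `c k` plus `cr` times `md` of
  -- the distance from `x` to a vertex, so it is nonnegative, whereas `Γ < 0`.
  have hα : 0 ≤ l₁ + Γ * sa := by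
    have hg : (l₁ + Γ * sa) * (cr * (3 / 2) * sR ^ 2) + Γ * sR * (ρ * (1 + cr)) =
        (ρ - (m * ca + ma + sa * sR * (l₁ + l₂) / 2)) +
        cr * (m * cR + mR - sR * (sR * (l₂ - l₁ / 2))) := by
      have e : ρ - m * ca - ma + cr * (m * cR + mR) = (ρ - ma + cr * mR) * (1 - κ * m) := by
        subst hca hcR hcr
        ring
      linear_combination (-(l₁ + l₂ + 2 * Γ * sa)) * hI1 - Γ * sR * hI2 - e +
        (ρ - ma + cr * mR) * hΓ
    have h1 := mul_nonneg hcr0.le hxv₂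
    refine le_of_mul_le_mul_right (?_ : 0 * _ ≤ _ * (cr * (3 / 2) * sR ^ 2)) hB
    linarith
  have hβ : 0 ≤ l₂ + Γ * sa := by
    have hg : (l₂ + Γ * sa) * (cr * (3 / 2) * sR ^ 2) + Γ * sR * (ρ * (1 + cr)) =
        (ρ - (m * ca + ma + sa * sR * (l₁ + l₂) / 2)) +
        cr * (m * cR + mR - sR * (sR * (l₁ - l₂ / 2))) := by
      have e : ρ - m * ca - ma + cr * (m * cR + mR) = (ρ - ma + cr * mR) * (1 - κ * m) := by
        subst hca hcR hcr
        ring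
      linear_combination (-(l₁ + l₂ + 2 * Γ * sa)) * hI1 - Γ * sR * hI2 - e +
        (ρ - ma + cr * mR) * hΓ
    have h1 := mul_nonneg hcr0.le hxv₁
    refine le_of_mul_le_mul_right (?_ : 0 * _ ≤ _ * (cr * (3 / 2) * sR ^ 2)) hB
    linarith
  have hΛ : ∀ y, n * cR + mR - sR * y ≤ ρ → (n - ma) * cR - sR * y - sa * sR / 2 ≤ 0 := by
    intro y hy
    subst hcR
    linarith
  have h1 := mul_nonpos_of_nonneg_of_nonpos hα (hΛ y₁ hv₁)
  have h2 := mul_nonpos_of_nonneg_of_nonpos hβ (hΛ y₂ hv₂)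
  have h3 := mul_nonpos_of_nonpos_of_nonneg (mul_neg_of_neg_of_pos hΓ0 hsR).le hck
  have key : m + n - κ * m * n - sR * (l₁ * y₁ + l₂ * y₂) -
      (m * ca + ma + sa * sR * (l₁ + l₂) / 2) =
      (l₁ + Γ * sa) * ((n - ma) * cR - sR * y₁ - sa * sR / 2) +
      (l₂ + Γ * sa) * ((n - ma) * cR - sR * y₂ - sa * sR / 2) +
      Γ * sR * (n * ca + ma + sa * (y₁ + y₂)) := by
    have e : m + n - κ * m * n - m * ca - ma = (n - ma) * (1 - κ * m) := by
      subst hca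
      ring
    linear_combination e - (n - ma) * hΓ + Γ * sR * hsa2
  linarith

namespace IsDiskTriangle

variable {G : Geometry} {F : PolarFrame G} {o : Plane G} {r a R : ℝ}
  {u : Fin 3 → EuclideanPlane} {v c : Fin 3 → Plane G}

section
variable (h : IsDiskTriangle F o r a R u v c)
include h

/-- Some `u i` makes an angle of at least 120 degrees with the direction of `x`, and the disk about
`c i` then limits the distance from `o`. -/
theorem dist_base_le {x : Plane G} (hx : ∀ i, dist x (c i) ≤ r) : dist x o ≤ R := by
  obtain ⟨i, hi⟩ := h.triad.exists_inner_le (F.ξ x)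
  rw [F.norm_ξ h.base] at hi
  have h1 := h.dist_le_r_iff.1 (hx i)
  rw [h.md_dist_c, F.M_eq h.base] at h1
  have h2 := mul_le_mul_of_nonneg_left hi h.sn_a_pos.le
  exact le_of_md_mul_cs_add_le h.small h.r_pos.le h.a_pos h.small_a dist_nonneg
    (fun e => dist_le_pi e _ _) (sn_dist_nonneg _ _) h.R_pos.le (by rw [h.md_eq, cs_eq]; ring)
    (by linarith)

theorem dist_base_le_of_dist_v_le {x : Plane G} (hx : ∀ i, dist x (v i) ≤ r) : dist x o ≤ a := by
  obtain ⟨i, hi⟩ := h.triad.exists_inner_le (F.ξ x)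
  rw [F.norm_ξ h.base] at hi
  have h1 := h.dist_le_r_iff.1 (hx i)
  rw [h.md_dist_v, F.M_eq h.base] at h1
  have h2 := mul_le_mul_of_nonneg_left hi h.sn_R_pos.le
  exact le_of_md_mul_cs_add_le h.small h.r_pos.le h.R_pos h.small_R dist_nonneg
    (fun e => dist_le_pi e _ _) (sn_dist_nonneg _ _) h.a_pos.le (by rw [h.md_eq, cs_eq]; ring)
    (by linarith)

theorem tangent_identity₁ : (G.md r - G.md a + G.cs r * G.md R) * G.cs R =
    G.sn a * G.sn R / 2 + G.cs r * G.sn R ^ 2 := by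
  have e2 := sn_sq G R
  have e1 := h.md_eq
  simp only [cs_eq]
  linear_combination e1 - (1 - G.curv * G.md r) * e2

theorem tangent_identity₂ : (G.md r - G.md a + G.cs r * G.md R) * G.cs a + G.sn a ^ 2 +
    G.cs r * G.sn R * G.sn a / 2 = G.md r * (1 + G.cs r) := by
  have e2 := sn_sq G a
  have e1 := h.md_eq
  simp only [cs_eq]
  linear_combination (-(1 - G.curv * G.md r)) * e1 + e2

/-- Every disk of radius `r` that contains the vertices contains the disk triangle. -/
theorem subset_closedBall {c' : Plane G} (hv : ∀ i, dist c' (v i) ≤ r) :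
    (⋂ j, Metric.closedBall (c j) r) ⊆ Metric.closedBall c' r := by
  intro x hxT
  have hx : ∀ j, dist x (c j) ≤ r := fun j => Set.mem_iInter.1 hxT j
  have hMx : F.M x ≤ G.md R := by
    rw [F.M_eq h.base]
    exact (md_dist_le_iff h.R_pos.le h.small_R.le_pi).2 (h.dist_base_le hx)
  have hMc : F.M c' ≤ G.md a := by
    rw [F.M_eq h.base]
    exact (md_dist_le_iff h.a_pos.le h.small_a.le_pi).2 (h.dist_base_le_of_dist_v_le hv)
  have hMx0 := F.M_nonneg x
  have hMc0 := F.M_nonneg c'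
  have hsR := h.sn_R_pos
  have hsa := h.sn_a_pos
  have hcR := h.cs_R_pos
  have hca := h.cs_a_pos
  have hcr := h.cs_r_pos
  -- For this `k` the vector `ξ x` lies in the cone spanned by the other two directions; below, `ξ x
  -- = l₁ • ξ (v (k + 1)) + l₂ • ξ (v (k + 2))`.
  obtain ⟨k, hk⟩ := Finite.exists_min fun j => inner ℝ (F.ξ x) (u j)
  have hsum := h.triad.sum_inner_eq_zero (F.ξ x)
  have hsum' := h.triad.sum_inner_eq_zero (F.ξ c')
  have hin := h.triad.inner_eq_sum (F.ξ x) (F.ξ c')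
  rw [Fin.sum_three_cyclic _ k] at hsum hsum' hin
  have hki := hk (k + 1)
  have hkj := hk (k + 2)
  have hvi := h.dist_le_r_iff.1 (hv (k + 1))
  have hvj := h.dist_le_r_iff.1 (hv (k + 2))
  rw [h.md_dist_v] at hvi hvj
  have hxk := h.dist_le_r_iff.1 (hx k)
  rw [h.md_dist_c] at hxk
  have hck : 0 ≤ G.md (dist c' (c k)) := md_nonneg G _
  rw [h.md_dist_c] at hck
  have hxvi : 0 ≤ G.md (dist x (v (k + 1))) := md_nonneg G _
  have hxvj : 0 ≤ G.md (dist x (v (k + 2))) := md_nonneg G _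
  rw [h.md_dist_v] at hxvi hxvj
  rw [Metric.mem_closedBall]
  apply h.dist_le_r_iff.2
  rw [F.md_dist, hin]
  have hI1 := h.tangent_identity₁
  have hI2 := h.tangent_identity₂
  have heq := h.md_eq
  have hmR := md_lt_md (G := G) h.R_pos.le h.R_lt h.small.le_pi
  have hma := md_pos h.a_pos h.small_a
  have hmr := md_pos h.r_pos h.small
  clear hv hx hk
  set x₁ := inner ℝ (F.ξ x) (u (k + 1))
  set x₂ := inner ℝ (F.ξ x) (u (k + 2))
  set y₁ := inner ℝ (F.ξ c') (u (k + 1))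
  set y₂ := inner ℝ (F.ξ c') (u (k + 2))
  have ex : inner ℝ (F.ξ x) (u k) = -(x₁ + x₂) := by linarith
  have ey : inner ℝ (F.ξ c') (u k) = -(y₁ + y₂) := by linarith
  rw [ex] at hki hkj hxk ⊢
  rw [ey] at hck ⊢
  obtain ⟨l₁, hl₁⟩ : ∃ l₁, 2 * x₁ + x₂ = 3 / 2 * G.sn R * l₁ :=
    ⟨(2 * x₁ + x₂) / (3 / 2 * G.sn R), by field_simp⟩
  obtain ⟨l₂, hl₂⟩ : ∃ l₂, x₁ + 2 * x₂ = 3 / 2 * G.sn R * l₂ :=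
    ⟨(x₁ + 2 * x₂) / (3 / 2 * G.sn R), by field_simp⟩
  have hl₁0 : 0 ≤ l₁ := by
    have : 0 ≤ 3 / 2 * G.sn R * l₁ := by linarith
    exact nonneg_of_mul_nonneg_right this (by positivity)
  have hl₂0 : 0 ≤ l₂ := by
    have : 0 ≤ 3 / 2 * G.sn R * l₂ := by linarith
    exact nonneg_of_mul_nonneg_right this (by positivity)
  have hx₁ : x₁ = G.sn R * (l₁ - l₂ / 2) := by linarith
  have hx₂ : x₂ = G.sn R * (l₂ - l₁ / 2) := by linarith
  rw [hx₁] at hxvi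
  rw [hx₂] at hxvj
  have hxk' : F.M x * G.cs a + G.md a + G.sn a * G.sn R * (l₁ + l₂) / 2 ≤ G.md r := by
    have : -(x₁ + x₂) = -(G.sn R * (l₁ + l₂) / 2) := by rw [hx₁, hx₂]; ring
    rw [this] at hxk
    linarith
  have hsa2 : G.sn a ^ 2 = G.md a * (1 + G.cs a) := sn_sq_eq_mul G a
  have := hull_inequality (cs_eq G R) (cs_eq G a) (cs_eq G r) hsa2 hsR hsa hcR hca hcr hl₁0 hl₂0 hmR
    hma hmr hMx hMc0 hMc heq hI1 hI2 hvi hvj hxk' (by linarith) hxvi hxvj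
  refine le_trans (le_of_eq ?_) this
  rw [hx₁, hx₂]
  ring

end
end IsDiskTriangle

/-! ### Inradius, minimal width and congruence of disk triangles. -/

namespace IsDiskTriangle

variable {G : Geometry} {F : PolarFrame G} {o : Plane G} {r a R : ℝ}
  {u : Fin 3 → EuclideanPlane} {v c : Fin 3 → Plane G}

theorem isCompact_iInter (c : Fin 3 → Plane G) (r : ℝ) : IsCompact (⋂ j, Metric.closedBall (c j) r) :=
  (isCompact_closedBall (c 0) r).of_isClosed_subset
    (isClosed_iInter fun _ => Metric.isClosed_closedBall) (Set.iInter_subset _ 0)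

section
variable (h : IsDiskTriangle F o r a R u v c)
include h

theorem closedBall_subset_and_inradius_eq :
    Metric.closedBall o (r - a) ⊆ ⋂ j, Metric.closedBall (c j) r ∧
      inradius (⋂ j, Metric.closedBall (c j) r) = r - a := by
  refine inradius_eq_of_minimal_enclosing_ball (C := Set.range c) h.small
    (Set.biInter_range (f := c) (g := fun y => Metric.closedBall y r)).symm h.a_lt ?_ fun o' R' hR' => ?_
  · rintro _ ⟨i, rfl⟩
    rw [Metric.mem_closedBall, h.dist_c_base]
  · by_contra hc
    push Not at hc
    have h1 : ∀ i, G.md (dist o' (c i)) ≤ G.md R' := fun i => by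
      have h2 : dist (c i) o' ≤ R' := hR' ⟨i, rfl⟩
      rw [dist_comm]
      exact md_le_md dist_nonneg h2 (h.small_a.mono hc.le).le_pi
    have h3 : G.md R' < G.md a :=
      md_lt_md (dist_nonneg.trans (hR' ⟨0, rfl⟩ : dist (c 0) o' ≤ R')) hc h.small_a.le_pi
    -- In the sum of `md (dist o' (c i))` over `i` the directional terms cancel, so the average is
    -- at least `md a`.
    have h4 := h.triad.sum_inner_eq_zero (F.ξ o')
    have h5 := mul_nonneg (F.M_nonneg o') h.cs_a_pos.le
    have e0 := h1 0
    have e1 := h1 1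
    have e2 := h1 2
    rw [h.md_dist_c] at e0 e1 e2
    rw [Fin.sum_univ_three] at h4
    have h6 := congrArg (G.sn a * ·) h4
    rw [mul_zero] at h6
    linarith

theorem exists_inscribed_point {K : Set (Plane G)} (hK : Metric.closedBall o (r - a) ⊆ K)
    (i : Fin 3) : ∃ p ∈ K, F.M p = G.md (r - a) ∧ F.ξ p = G.sn (r - a) • -u i := by
  have h1 : 0 ≤ r - a := sub_nonneg.2 h.a_lt.le
  obtain ⟨p, hp, hp', hpo⟩ := F.exists_polar h.base h1
    (h.small.mono (by linarith [h.a_pos])).le_pi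
    (show ‖-u i‖ = 1 by rw [norm_neg, h.triad.norm_eq])
  exact ⟨p, hK (Metric.mem_closedBall.2 hpo.le), hp, hp'⟩

theorem exists_supports : ∃ l, Supports l (⋂ j, Metric.closedBall (c j) r) := by
  obtain ⟨p, hpK, hp, hp'⟩ := h.exists_inscribed_point h.closedBall_subset_and_inradius_eq.1 0
  exact exists_supports_of_subset_ball (h.triad.norm_eq 0) h.small (sub_nonneg.2 h.a_lt.le)
    (by linarith [h.a_pos]) (by rw [sub_sub_cancel]; exact h.c_M 0)
    (by rw [sub_sub_cancel]; exact h.c_ξ 0) (Set.iInter_subset _ 0) hpK hp hp'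

/-- The upper bound is the lens estimate with equal weights `1 / 3`, the same as for a general body;
the lower bound is `exists_le_nline`. -/
theorem minimalWidth_eq (hRa : R ≤ a) :
    minimalWidth (⋂ j, Metric.closedBall (c j) r) = r - a + R := by
  have ha := h.a_pos
  have har := h.a_lt
  have hR := h.R_pos
  apply le_antisymm
  · obtain ⟨p, hpK, hp, hp'⟩ := h.exists_inscribed_point h.closedBall_subset_and_inradius_eq.1 0
    obtain ⟨q, hq, hq', -⟩ := F.exists_polar h.base (sub_nonneg.2 h.R_lt.le)
      (h.small.mono (by linarith)).le_pi (show ‖-u 0‖ = 1 by rw [norm_neg, h.triad.norm_eq])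
    refine minimalWidth_le_of_lens (h.triad.norm_eq 0) h.small (sub_nonneg.2 har.le) hR.le
      (by linarith) (by linarith) (by rw [sub_sub_cancel]; exact h.c_M 0)
      (by rw [sub_sub_cancel]; exact h.c_ξ 0) hq hq' (Set.iInter_subset _ 0) (fun x hx => ?_)
      hpK hp hp'
    have := dist_lt_or_eq_of_mem_disks (w := fun _ => 1 / 3) (i := 0) (x := x) h.base h.small ha
      har hR h.R_lt h.md_eq (h.triad.norm_eq 0) (fun _ => by norm_num)
      (by rw [Fin.sum_univ_three]; norm_num)
      (by rw [← Finset.smul_sum, h.triad.sum_eq_zero, smul_zero]) (fun _ => le_rfl)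
      (fun j => by
        rw [← h.md_dist_c]
        exact h.dist_le_r_iff.1 (Set.mem_iInter.1 hx j)) hq hq'
    exact this.elim le_of_lt fun e => e.1.le
  · exact le_minimalWidth (isCompact_iInter c r) h.exists_supports (by linarith)
      (h.small.mono (by linarith)) h.small (Set.iInter_subset _ 0)
      fun l hl => h.exists_le_nline hRa hl

theorem lt_minimalWidth (haR : a < R) : r < minimalWidth (⋂ j, Metric.closedBall (c j) r) := by
  obtain ⟨δ, hδ, hδ1, hδ2⟩ : ∃ δ, 0 < δ ∧ dist (c 0) (c 1) + δ ≤ r ∧ G.Small (r + δ) := by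
    have h1 := h.dist_c_c_lt (show (0 : Fin 3) ≠ 1 by decide) haR
    by_cases hG : G = .spherical
    · have h2 := h.small hG
      refine ⟨min (r - dist (c 0) (c 1)) ((Real.pi / 2 - r) / 2),
        lt_min (sub_pos.2 h1) (by linarith), ?_, fun _ => ?_⟩
      · linarith [min_le_left (r - dist (c 0) (c 1)) ((Real.pi / 2 - r) / 2)]
      · linarith [min_le_right (r - dist (c 0) (c 1)) ((Real.pi / 2 - r) / 2)]
    · exact ⟨r - dist (c 0) (c 1), sub_pos.2 h1, by linarith, fun e => absurd e hG⟩
  have := le_minimalWidth (isCompact_iInter c r) h.exists_supports (δ := r + δ)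
    (by linarith [h.r_pos]) hδ2 h.small (Set.iInter_subset _ 0)
    fun l hl => h.exists_le_nline_of_lt haR hδ hδ2 hδ1 hl
  linarith

theorem dist_v_v_eq {i j k l : Fin 3} (hij : i ≠ j) (hkl : k ≠ l) :
    dist (v i) (v j) = dist (v k) (v l) := by
  apply (md_dist_eq_iff dist_nonneg (fun e => dist_le_pi e _ _)).1
  rw [h.md_dist_v, h.md_dist_v, h.v_M, h.v_ξ, h.v_M, h.v_ξ, inner_smul_left, inner_smul_left,
    h.triad.inner_eq i j hij, h.triad.inner_eq k l hkl]

theorem isRegularDiskTriangle (hRa : R ≤ a) :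
    IsRegularDiskTriangle r (⋂ j, Metric.closedBall (c j) r) := by
  have h01 : (0 : Fin 3) ≠ 1 := by decide
  refine ⟨v, c, ⟨dist (v 0) (v 1), ?_, fun i j hij => h.dist_v_v_eq hij h01⟩,
    fun i j hij => ?_, fun i => ?_, rfl⟩
  · linarith [h.le_dist_v_v h01 hRa, h.a_lt, h.R_pos]
  · rw [dist_comm]
    exact h.dist_v_c hij.symm
  · rw [dist_comm, h.dist_v_c_self]
    exact h.abs_sub_lt

end

/-- The linear map that takes one triad to another. -/
noncomputable def triadMap (u u' : Fin 3 → EuclideanPlane) (x : EuclideanPlane) : EuclideanPlane :=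
  (2 / 3 : ℝ) • ∑ i, inner ℝ x (u i) • u' i

theorem inner_triadMap {u u' : Fin 3 → EuclideanPlane} (hu : IsTriad u) (hu' : IsTriad u')
    (x : EuclideanPlane) (j : Fin 3) : inner ℝ (triadMap u u' x) (u' j) = inner ℝ x (u j) := by
  have h1 := hu.sum_inner_eq_zero x
  rw [Fin.sum_three_cyclic _ j] at h1
  rw [triadMap, Fin.sum_three_cyclic _ j, inner_smul_left, inner_add_left, inner_add_left,
    inner_smul_left, inner_smul_left, inner_smul_left, real_inner_self_eq_norm_sq, hu'.norm_eq,
    hu'.inner_eq _ _ (Fin.ne_add_one_three j).symm, hu'.inner_eq _ _ (Fin.ne_add_two_three j).symm]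
  simp only [conj_trivial]
  linear_combination (-1 / 3) * h1

theorem triadMap_triadMap {u u' : Fin 3 → EuclideanPlane} (hu : IsTriad u) (hu' : IsTriad u')
    (x : EuclideanPlane) : triadMap u' u (triadMap u u' x) = x := by
  conv_rhs => rw [hu.eq_sum x]
  rw [triadMap.eq_1 u' u]
  simp only [inner_triadMap hu hu']

theorem inner_triadMap_triadMap {u u' : Fin 3 → EuclideanPlane} (hu : IsTriad u)
    (hu' : IsTriad u') (x y : EuclideanPlane) :
    inner ℝ (triadMap u u' x) (triadMap u u' y) = inner ℝ x y := by
  rw [hu'.inner_eq_sum (triadMap u u' x), hu.inner_eq_sum x]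
  simp only [inner_triadMap hu hu']

theorem triadMap_apply {u u' : Fin 3 → EuclideanPlane} (hu : IsTriad u) (hu' : IsTriad u')
    (i : Fin 3) : triadMap u u' (u i) = u' i := by
  conv_rhs => rw [hu'.eq_sum (u' i)]
  rw [triadMap]
  congr 1
  refine Finset.sum_congr rfl fun j _ => ?_
  rcases eq_or_ne i j with rfl | hij
  · rw [real_inner_self_eq_norm_sq, real_inner_self_eq_norm_sq, hu.norm_eq, hu'.norm_eq]
  · rw [hu.inner_eq _ _ hij, hu'.inner_eq _ _ hij]

/-- Distances depend only on `M` and on inner products of `ξ`. Keeping `M` and applying to `ξ` the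
linear isometry between the triads is therefore an isometry of the plane, and it matches the arc
centres. -/
theorem congruentSets {F' : PolarFrame G} {o' : Plane G} {u' : Fin 3 → EuclideanPlane}
    {v' c' : Fin 3 → Plane G} (h : IsDiskTriangle F o r a R u v c)
    (h' : IsDiskTriangle F' o' r a R u' v' c') :
    CongruentSets (⋂ j, Metric.closedBall (c j) r) (⋂ j, Metric.closedBall (c' j) r) := by
  have key : ∀ {F₁ F₂ : PolarFrame G} {u₁ u₂ : Fin 3 → EuclideanPlane}, IsTriad u₁ → IsTriad u₂ →
      ∃ f : Plane G → Plane G, ∀ x, F₂.M (f x) = F₁.M x ∧ F₂.ξ (f x) = triadMap u₁ u₂ (F₁.ξ x) := by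
    intro F₁ F₂ u₁ u₂ h₁ h₂
    refine Classical.skolem.1 fun x => F₂.exists_point _ _ (F₁.M_nonneg x) ?_
    rw [← F₁.norm_sq, ← real_inner_self_eq_norm_sq, inner_triadMap_triadMap h₁ h₂,
      real_inner_self_eq_norm_sq]
  obtain ⟨f, hf⟩ := key (F₁ := F) (F₂ := F') h.triad h'.triad
  obtain ⟨g, hg⟩ := key (F₁ := F') (F₂ := F) h'.triad h.triad
  have hfg : ∀ x, f (g x) = x := fun x => by
    apply F'.ext_point
    · rw [(hf _).1, (hg _).1]
    · rw [(hf _).2, (hg _).2, triadMap_triadMap h'.triad h.triad]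
  have hiso : Isometry f := Isometry.of_dist_eq fun x y => by
    apply (md_dist_eq_iff dist_nonneg (fun e => dist_le_pi e _ _)).1
    rw [F'.md_dist, F.md_dist, (hf x).1, (hf y).1, (hf x).2, (hf y).2,
      inner_triadMap_triadMap h.triad h'.triad]
  refine ⟨IsometryEquiv.mk' f g hfg hiso, ?_⟩
  rw [Set.image_iInter (IsometryEquiv.bijective _)]
  refine Set.iInter_congr fun j => ?_
  rw [IsometryEquiv.image_closedBall]
  congr 1
  apply F'.ext_point
  · rw [h'.c_M, ← h.c_M j]
    exact (hf (c j)).1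
  · rw [h'.c_ξ]
    refine ((hf (c j)).2).trans ?_
    rw [h.c_ξ, ← triadMap_apply h.triad h'.triad j]
    simp only [triadMap, inner_smul_left, conj_trivial, mul_smul, ← Finset.smul_sum]
    rw [smul_comm]

end IsDiskTriangle

/-! ### Existence of disk triangles of prescribed width. -/

theorem exists_isTriad : ∃ u : Fin 3 → EuclideanPlane, IsTriad u := by
  have h3 : √3 * √3 = 3 := Real.mul_self_sqrt (by norm_num)
  have hn : ∀ x y : ℝ, x ^ 2 + y ^ 2 = 1 → ‖(!₂[x, y] : EuclideanPlane)‖ = 1 := fun x y hxy => by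
    rw [← sq_eq_sq₀ (norm_nonneg _) zero_le_one, norm_sq_eq_coords]
    simpa using hxy
  refine ⟨![!₂[1, 0], !₂[-1 / 2, √3 / 2], !₂[-1 / 2, -√3 / 2]], ⟨fun i => ?_, fun i j hij => ?_⟩⟩
  · fin_cases i <;> exact hn _ _ (by nlinarith)
  · rw [inner_eq_coords]
    fin_cases i <;> fin_cases j <;> first | exact absurd rfl hij | (simp <;> nlinarith)

/-- For `0 < w ≤ r` there is a disk triangle of minimal width `w`. -/
theorem exists_isDiskTriangle_of_width {G : Geometry} {r w : ℝ} (o : Plane G) (hr : G.Small r)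
    (hw : 0 < w) (hwr : w ≤ r) :
    ∃ (F : PolarFrame G) (a R : ℝ) (u : Fin 3 → EuclideanPlane) (v c : Fin 3 → Plane G),
      IsDiskTriangle F o r a R u v c ∧ R ≤ a ∧ r - a + R = w := by
  have hr0 : 0 < r := hw.trans_le hwr
  -- The unknown `ρ` is the inradius, so `a = r - ρ` and `R = w - ρ`. The law of cosines `g ρ = md
  -- r` is solved by the intermediate value theorem.
  set g : ℝ → ℝ := fun ρ => G.md (w - ρ) + G.md (r - ρ) - G.curv * G.md (w - ρ) * G.md (r - ρ) +
    G.sn (w - ρ) * G.sn (r - ρ) / 2 with hg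
  have hgc : Continuous g := by
    have h1 := continuous_md G
    have h2 := continuous_sn G
    fun_prop
  have hg0 : G.md r < g 0 := by
    have h1 := mul_pos (md_pos hw (hr.mono hwr)) (cs_pos_of_nonneg hr0.le hr)
    have h2 := mul_pos (sn_pos hw (hr.mono hwr)) (sn_pos hr0 hr)
    rw [cs_eq] at h1
    simp only [hg, sub_zero]
    linarith
  have hgw : g w < G.md r := by
    have h1 := md_lt_md (G := G) (sub_nonneg.2 hwr) (sub_lt_self r hw) hr.le_pi
    simpa [hg, md_zero, sn_zero] using h1
  obtain ⟨ρ, ⟨hρ0, hρw⟩, hρ⟩ := intermediate_value_Ioo' hw.le hgc.continuousOn ⟨hgw, hg0⟩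
  obtain ⟨F, hF⟩ := exists_polarFrame o
  obtain ⟨u, hu⟩ := exists_isTriad
  have hv := fun i => F.exists_polar hF (sub_nonneg.2 hρw.le)
    (hr.mono (by linarith)).le_pi (hu.norm_eq i)
  have hc := fun i => F.exists_polar hF (show 0 ≤ r - ρ by linarith)
    (hr.mono (by linarith)).le_pi (hu.norm_eq i)
  choose v hvM hvξ _ using hv
  choose c hcM hcξ _ using hc
  exact ⟨F, r - ρ, w - ρ, u, v, c, ⟨hF, hr, by linarith, by linarith, by linarith, by linarith, hu,
    hvM, hvξ, hcM, hcξ, by rw [← hρ]⟩, by linarith, by ring⟩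

theorem IsTriad.of_sum_eq_zero {u : Fin 3 → EuclideanPlane} (hu : ∀ i, ‖u i‖ = 1)
    (h : ∑ i, u i = 0) : IsTriad u := by
  refine ⟨hu, ?_⟩
  have key : ∀ x y z : EuclideanPlane, ‖x‖ = 1 → ‖y‖ = 1 → ‖z‖ = 1 → x + y + z = 0 →
      inner ℝ x y = -1 / 2 := fun x y z hx hy hz he => by
    have h1 := norm_add_sq_real x y
    rw [eq_neg_of_add_eq_zero_left he, norm_neg, hx, hy, hz] at h1
    linarith
  intro i j hij
  rw [Fin.sum_three_cyclic _ i] at h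
  rcases Fin.eq_or_three i j with rfl | rfl | rfl
  · exact absurd rfl hij
  · exact key _ _ _ (hu _) (hu _) (hu _) h
  · exact key _ _ (u (i + 1)) (hu _) (hu _) (hu _) (by rw [← h]; abel)

theorem CongruentSets.inradius_eq {X : Type*} [MetricSpace X] {A B : Set X}
    (h : CongruentSets A B) : inradius A = inradius B := by
  obtain ⟨φ, rfl⟩ := h
  unfold inradius
  congr 1
  ext R
  refine and_congr_right fun _ => ⟨?_, ?_⟩
  · rintro ⟨x, hx, hs⟩
    refine ⟨φ x, Set.mem_image_of_mem _ hx, ?_⟩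
    rw [← IsometryEquiv.image_closedBall]
    exact Set.image_mono hs
  · rintro ⟨_, ⟨x, hx, rfl⟩, hs⟩
    rw [← IsometryEquiv.image_closedBall] at hs
    exact ⟨x, hx, (Set.image_subset_image_iff φ.injective).1 hs⟩

/-! ### Comparison of a general body with the disk triangle, and rigidity. -/

/-- An `r`-ball convex body whose inradius is given by the circumradius `a'` of the centres of the
disks that contain it. -/
theorem IsBallConvexBody.exists_circumcentre {G : Geometry} {r : ℝ} {K : Set (Plane G)}
    (hr : G.Small r) (hK : IsBallConvexBody r K) :
    ∃ (F : PolarFrame G) (o : Plane G) (a' : ℝ), F.M o = 0 ∧ 0 ≤ a' ∧ a' < r ∧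
      Metric.closedBall o (r - a') ⊆ K ∧ inradius K = r - a' ∧
      (0 : EuclideanPlane) ∈
        convexHull ℝ (F.ξ '' {c ∈ {c | K ⊆ Metric.closedBall c r} | dist c o = a'}) := by
  set C := {c | K ⊆ Metric.closedBall c r} with hC
  obtain ⟨k, hk⟩ := hK.nonempty_interior
  obtain ⟨ε, hε, hkε⟩ := Metric.nhds_basis_closedBall.mem_iff.1 (mem_interior_iff_mem_nhds.1 hk)
  -- A disk of radius `ε` inside `K` bounds the circumradius of `C` away from `r`.
  have hCk : C ⊆ Metric.closedBall k (r - ε) := fun c hc => by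
    have := dist_add_le_of_closedBall_subset hr hε.le (hkε.trans hc)
    rw [Metric.mem_closedBall, dist_comm]
    linarith
  have hCc : IsClosed C := by
    have : C = ⋂ x ∈ K, Metric.closedBall x r := by
      ext c
      simp only [hC, Set.mem_ofPred_eq, Set.mem_iInter, Metric.mem_closedBall, Set.subset_def,
        dist_comm]
    rw [this]
    exact isClosed_biInter fun _ _ => Metric.isClosed_closedBall
  obtain ⟨o, a', ha0, -, hCo, hmin, hconv⟩ := exists_minimal_enclosing_ball
    ((isCompact_closedBall k (r - ε)).of_isClosed_subset hCc hCk) hK.exists_ball hr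
    (hCk.trans (Metric.closedBall_subset_closedBall (by linarith)))
  have har : a' < r := (hmin _ _ hCk).trans_lt (by linarith)
  obtain ⟨F, hF⟩ := exists_polarFrame o
  obtain ⟨h1, h2⟩ := inradius_eq_of_minimal_enclosing_ball hr hK.eq_iInter har hCo hmin
  exact ⟨F, o, a', hF, ha0, har, h1, h2, hconv F hF⟩

/-- An `r`-ball convex body whose inradius is at most that of a disk triangle of the same minimal
width is a disk triangle with the same parameters. -/
theorem IsBallConvexBody.exists_isDiskTriangle_of_inradius_le {G : Geometry} {r a R : ℝ}
    {K : Set (Plane G)} (hr : G.Small r) (hK : IsBallConvexBody r K) (ha : 0 < a) (har : a < r)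
    (hR : 0 < R) (hRa : R ≤ a)
    (heq : G.md r = G.md R + G.md a - G.curv * G.md R * G.md a + G.sn R * G.sn a / 2)
    (hw : r - a + R ≤ minimalWidth K) (hin : inradius K ≤ r - a) :
    inradius K = r - a ∧ ∃ (F : PolarFrame G) (o : Plane G) (u : Fin 3 → EuclideanPlane)
      (v c : Fin 3 → Plane G), IsDiskTriangle F o r a R u v c ∧
        K = ⋂ i, Metric.closedBall (c i) r := by
  obtain ⟨F, o, a', hF, ha0, har', hoK, hinK, hconv⟩ := hK.exists_circumcentre hr
  have haa : a ≤ a' := by linarith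
  have hRr : R < r := hRa.trans_lt har
  have hs : G.Small a' := hr.mono har'.le
  have hsn := sn_pos (ha.trans_le haa) hs
  obtain ⟨w, z, hw0, hw1, hz, hwz⟩ := exists_weights_of_mem_convexHull hconv
  choose c hc hcz using hz
  have hcM : ∀ i, F.M (c i) = G.md a' := fun i => by rw [F.M_eq hF, (hc i).2]
  set u : Fin 3 → EuclideanPlane := fun i => (G.sn a')⁻¹ • z i with hu
  have hcξ : ∀ i, F.ξ (c i) = G.sn a' • u i := fun i => by
    rw [hu, hcz]
    exact (smul_inv_smul₀ hsn.ne' _).symm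
  have hu1 : ∀ i, ‖u i‖ = 1 := fun i => by
    have h1 := F.norm_ξ hF (c i)
    rw [hcξ, norm_smul, (hc i).2, Real.norm_eq_abs, abs_of_pos hsn] at h1
    exact mul_left_cancel₀ hsn.ne' (h1.trans (mul_one _).symm)
  have hwu : ∑ j, w j • u j = 0 := by
    simp only [hu, smul_comm _ (G.sn a')⁻¹]
    rw [← Finset.smul_sum, hwz, smul_zero]
  have hKc : ∀ i, K ⊆ Metric.closedBall (c i) r := fun i => (hc i).1
  -- `K` stays in the disks whose centres are pulled in from distance `a'` to `a`. The required
  -- bound `M x ≤ md r` is the weighted mean of the three disk conditions.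
  have hxK : ∀ x ∈ K, ∀ j,
      F.M x * G.cs a + G.md a - G.sn a * inner ℝ (F.ξ x) (u j) ≤ G.md r := by
    intro x hx
    have h1 : ∀ j, F.M x * G.cs a' + G.md a' - G.sn a' * inner ℝ (F.ξ x) (u j) ≤ G.md r := by
      intro j
      rw [← F.md_dist_polar_right x (hcM j) (hcξ j)]
      exact md_le_md dist_nonneg (hKc j hx) hr.le_pi
    have h2 : F.M x ≤ G.md r := by
      refine le_md_of_mul_cs_add_le hr ha0 har' ?_
      have h3 : inner ℝ (F.ξ x) (∑ j, w j • u j) = 0 := by rw [hwu, inner_zero_right]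
      simp only [Fin.sum_univ_three, inner_add_right, inner_smul_right] at h3
      rw [Fin.sum_univ_three] at hw1
      have e0 := mul_le_mul_of_nonneg_left (h1 0) (hw0 0)
      have e1 := mul_le_mul_of_nonneg_left (h1 1) (hw0 1)
      have e2 := mul_le_mul_of_nonneg_left (h1 2) (hw0 2)
      have e3 : (F.M x * G.cs a' + G.md a' - G.md r) * (w 0 + w 1 + w 2) =
        F.M x * G.cs a' + G.md a' - G.md r := by rw [hw1, mul_one]
      have e4 : G.sn a' * (w 0 * inner ℝ (F.ξ x) (u 0) + w 1 * inner ℝ (F.ξ x) (u 1) +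
        w 2 * inner ℝ (F.ξ x) (u 2)) = 0 := by rw [h3, mul_zero]
      linarith
    exact fun j => md_bound_of_le hr ha haa har' h2 (h1 j)
  -- The lens is formed with the original centre at distance `a'` and the covering disk about `q`
  -- computed from `a`, so its width is at most `r - a' + R ≤ r - a + R`. The assumed width leaves
  -- only the equality case.
  have key : ∀ i, (∀ j, w j ≤ w i) →
      w i = 1 / 3 ∧ a' ≤ a ∧ ∃ x ∈ K, F.M x = G.md R ∧ F.ξ x = G.sn R • u i := by
    intro i hi
    have hui : ‖-u i‖ = 1 := by rw [norm_neg, hu1]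
    obtain ⟨q, hq, hq', -⟩ := F.exists_polar hF (sub_nonneg.2 hRr.le)
      (hr.mono (by linarith)).le_pi hui
    obtain ⟨p, hp, hp', hpo⟩ := F.exists_polar hF (sub_nonneg.2 har'.le)
      (hr.mono (by linarith)).le_pi hui
    have hpK : p ∈ K := hoK (Metric.mem_closedBall.2 hpo.le)
    have hM : F.M (c i) = G.md (r - (r - a')) := by rw [sub_sub_cancel]; exact hcM i
    have hξ : F.ξ (c i) = G.sn (r - (r - a')) • u i := by rw [sub_sub_cancel]; exact hcξ i
    have hd := fun x hx => dist_lt_or_eq_of_mem_disks (q := q) hF hr ha har hR hRr heq (hu1 i) hw0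
      hw1 hwu hi (hxK x hx) hq hq'
    have h1 : minimalWidth K ≤ r - a' + R :=
      minimalWidth_le_of_lens (hu1 i) hr (sub_nonneg.2 har'.le) hR.le (by linarith) (by linarith)
        hM hξ hq hq' (hKc i) (fun x hx => (hd x hx).elim le_of_lt fun e => e.1.le) hpK hp hp'
    by_cases hall : ∀ x ∈ K, dist x q < r
    · have := minimalWidth_lt_of_lens hF (hu1 i) hr (sub_nonneg.2 har'.le) hR (sub_pos.2 har')
        (by linarith) hM hξ hq hq' hK.isCompact (hKc i) hall hpK hp hp'
      linarith
    · push Not at hall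
      obtain ⟨x, hx, hxq⟩ := hall
      obtain ⟨-, h2, h3, h4⟩ := (hd x hx).resolve_left hxq.not_gt
      exact ⟨h2, by linarith, x, hx, h3, h4⟩
  obtain ⟨i, hi⟩ := Finite.exists_max w
  have hwi := (key i hi).1
  obtain rfl : a' = a := le_antisymm (key i hi).2.1 haa
  have hwj : ∀ j, w j = 1 / 3 := by
    rw [Fin.sum_three_cyclic _ i] at hw1
    have h1 := hi (i + 1)
    have h2 := hi (i + 2)
    intro j
    rcases Fin.eq_or_three i j with rfl | rfl | rfl
    · exact hwi
    · linarith
    · linarith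
  -- Now every index has maximal weight, so the equality case yields all three vertices.
  choose v hvK hvM hvξ using fun j => (key j fun k => by rw [hwj, hwj]).2.2
  have htri : IsTriad u := IsTriad.of_sum_eq_zero hu1 (by
    simp only [hwj] at hwu
    rw [← Finset.smul_sum] at hwu
    exact (smul_eq_zero.1 hwu).resolve_left (by norm_num))
  have hT : IsDiskTriangle F o r a' R u v c :=
    ⟨hF, hr, ha, har, hR, hRr, htri, hvM, hvξ, hcM, hcξ, heq⟩
  refine ⟨hinK, F, o, u, v, c, hT, Set.Subset.antisymm (Set.subset_iInter hKc) ?_⟩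
  rw [hK.eq_iInter]
  refine Set.subset_iInter₂ fun c' hc' => hT.subset_closedBall fun j => ?_
  rw [dist_comm]
  exact hc' (hvK j)

theorem theorem2 (G : Geometry) (r w : ℝ) (hw : 0 < w) (hwr : w ≤ r)
    (hr : G = Geometry.spherical → r < Real.pi / 2)
    (K : Set (Plane G)) (hK : IsBallConvexBody r K) (hKw : minimalWidth K = w) :
    (∃ T : Set (Plane G), IsRegularDiskTriangle r T ∧ minimalWidth T = w) ∧
    ∀ T : Set (Plane G), IsRegularDiskTriangle r T → minimalWidth T = w →
      inradius T ≤ inradius K ∧ (inradius K = inradius T ↔ CongruentSets K T) := by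
  constructor
  · obtain ⟨o, -⟩ := hK.nonempty_interior
    obtain ⟨F, a, R, u, v, c, hT, hRa, hw'⟩ := exists_isDiskTriangle_of_width o hr hw hwr
    exact ⟨_, hT.isRegularDiskTriangle hRa, by rw [hT.minimalWidth_eq hRa, hw']⟩
  · intro T hT hTw
    obtain ⟨F, o, a, R, u, v, c, h, rfl⟩ := exists_isDiskTriangle hr hT
    -- A triangle with `a < R` would have minimal width greater than `r ≥ w`.
    have hRa : R ≤ a := by
      by_contra hc
      have := h.lt_minimalWidth (not_le.1 hc)
      linarith
    rw [h.minimalWidth_eq hRa] at hTw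
    have hin := h.closedBall_subset_and_inradius_eq.2
    have hrigid := hK.exists_isDiskTriangle_of_inradius_le hr h.a_pos h.a_lt h.R_pos hRa h.md_eq
      (by rw [hKw, hTw])
    refine ⟨?_, fun e => ?_, CongruentSets.inradius_eq⟩
    · rw [hin]
      by_contra hc
      exact hc (hrigid (not_le.1 hc).le).1.ge
    · obtain ⟨-, F', o', u', v', c', h', hK'⟩ := hrigid (by rw [e, hin])
      rw [hK']
      exact h'.congruentSets h
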